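/- Let $M$ be a compact manifold without boundary of dimension $n=p+q$, let $\mathcal F$ be a smooth foliation of $M$ of dimension $p$ and codimension $q$, and let $g$ be a Riemannian metric on $M$ that is bundle-like for $\mathcal F$. For a leaf $L$ let $\overline L$ be its closure, an embedded submanifold of $M$. For $k\ge 0$ let $\Sigma_{p+k}$ be the union of the leaf closures of dimension $p+k$, and let $k_1$ and $k_N$ be the least and the greatest $k$ with $\Sigma_{p+k}\neq\emptyset$; write $\Sigma_{max}=\Sigma_{p+k_N}$, which is foliated by the leaf closures it contains. The zero section of $T^*M$ is removed throughout. Put $$\mathcal C_{max}=\{(\eta_y,\xi_x)\mid \xi_x\in N^*\overline L,\ \overline L\subset\Sigma_{max},\ \eta_y=(dh^{-1})^*\xi_x \text{ for a holonomy map } h \text{ from } x \text{ to } y \text{ of the foliation of } \Sigma_{max} \text{ by leaf closures}\},$$ $$\mathcal C_{0}=\{(\eta_y,\xi_x)\mid \xi_x\in N^*\overline L,\ \overline L\subset\Sigma_{p},\ \eta_y=(dh^{-1})^*\xi_x \text{ for a holonomy map } h \text{ from } x \text{ to } y \text{ of } \mathcal F\}$$ (these are components of the canonical relation of the basic projector of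 $(M,\mathcal F)$). Each is considered with its sheets: for a holonomy map $h$ between two local transversals, the sheet of $h$ is the set of those pairs $(\eta_y,\xi_x)$ in the relation with $\eta_y=(dh^{-1})^*\xi_x$. Let $\Phi^t$ be the hamiltonian flow of $|\xi|_g$ on $T^*M\setminus 0$ and let $$\Lambda=\{(\Phi^t(\eta),\eta,(t,\tau))\mid \eta\in T^*M\setminus 0,\ t\in\mathbb R,\ \tau=-|\eta|_g\}\subset T^*M\times T^*M\times T^*\mathbb R$$ be the canonical relation of $e^{-it\sqrt\Delta}$. Finally let $Y=T^*M\times\Delta(T^*M\times T^*M)\times T^*M\times T^*\mathbb R$, where $\Delta(T^*M\times T^*M)$ is the diagonal. Then $\mathcal C_{max}$ and $\Lambda$ intersect cleanly: $\Lambda$ is an embedded submanifold, $\mathcal C_{max}$ is the union of its sheets, each sheet $S$ is an embedded submanifold of $T^*M\times T^*M$ (so that $\mathcal C_{max}$ is a possibly self-intersecting immersed submanifold), and $S\times\Lambda$ intersects $Y$ cleanly, that is, $S\times\Lambda$, $Y$ and $(S\times\Lambda)\cap Y$ are embedded submanifolds and $T_P\bigl((S\times\Lambda)\cap Y\bigr)=T_P(S\times\Lambda)\cap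 T_PY$ at every point $P$ of the intersection. If $k_1=0$, that is, if the leaves in the minimal stratum are compact, then $\mathcal C_0$ and $\Lambda$ intersect cleanly in the same sense (components of different dimensions being allowed in the submanifolds). The same holds with the sign convention $\tau=+|\eta|_g$ in $\Lambda$. -/

import Mathlib

open Bundle Set Topology
open scoped Manifold ContDiff

noncomputable section

namespace BasicWave

/-! ### Submanifolds, tangent spaces, clean intersection -/

section Submanifolds

variable {V : Type*} [NormedAddCommGroup V] [NormedSpace ℝ V] {H : Type*} [TopologicalSpace H]
  {X : Type*} [TopologicalSpace X] [ChartedSpace H X]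

/-- Near `x`, the subset `S` of the manifold `X` is an embedded submanifold of dimension `d`:
on some open neighbourhood it is the zero set of a smooth submersion to `ℝᶜ`, `c + d = dim X`. -/
def IsSubmanifoldAt (I : ModelWithCorners ℝ V H) (S : Set X) (d : ℕ) (x : X) : Prop :=
  ∃ U : Set X, IsOpen U ∧ x ∈ U ∧ ∃ c : ℕ, c + d = Module.finrank ℝ V ∧
    ∃ f : X → EuclideanSpace ℝ (Fin c),
      ContMDiffOn I 𝓘(ℝ, EuclideanSpace ℝ (Fin c)) ∞ f U ∧
      S ∩ U = {z ∈ U | f z = 0} ∧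
      ∀ z ∈ U, Function.Surjective (mfderiv I 𝓘(ℝ, EuclideanSpace ℝ (Fin c)) f z)

/-- `S` is an embedded submanifold, all of whose components have dimension `d`. -/
def IsSubmanifoldOfDim (I : ModelWithCorners ℝ V H) (S : Set X) (d : ℕ) : Prop :=
  ∀ x ∈ S, IsSubmanifoldAt I S d x

/-- `S` is an embedded submanifold (components of different dimensions are allowed). -/
def IsSubmanifold (I : ModelWithCorners ℝ V H) (S : Set X) : Prop :=
  ∀ x ∈ S, ∃ d : ℕ, IsSubmanifoldAt I S d x

/-- The tangent space `T_x S`: the velocities at `x` of the smooth curves that stay in `S`. -/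
def tangentSet (I : ModelWithCorners ℝ V H) (S : Set X) (x : X) : Set (TangentSpace I x) :=
  {v | ∃ c : ℝ → X, c 0 = x ∧ (∀ᶠ s in 𝓝 (0 : ℝ), c s ∈ S) ∧
    ContMDiffAt 𝓘(ℝ, ℝ) I ∞ c 0 ∧ mfderiv 𝓘(ℝ, ℝ) I c 0 (1 : ℝ) = (v : V)}

/-- The embedded submanifolds `S` and `T` intersect cleanly: `S ∩ T` is an embedded submanifold
and `T_x (S ∩ T) = T_x S ∩ T_x T` at each of its points. -/
def CleanIntersection (I : ModelWithCorners ℝ V H) (S T : Set X) : Prop :=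
  IsSubmanifold I S ∧ IsSubmanifold I T ∧ IsSubmanifold I (S ∩ T) ∧
    ∀ x ∈ S ∩ T, tangentSet I (S ∩ T) x = tangentSet I S x ∩ tangentSet I T x

end Submanifolds

section Geometry

variable {n : ℕ} {M : Type*} [TopologicalSpace M] [ChartedSpace (EuclideanSpace ℝ (Fin n)) M]
  [IsManifold (𝓡 n) ∞ M]

/-! ### Foliations and their holonomy -/

/-- Candidates for distinguished charts: homeomorphisms from an open subset of `M` to an open
subset of `ℝᵃ × ℝᵇ` (leaf coordinates, transverse coordinates). -/
abbrev FolChart (M : Type*) [TopologicalSpace M] (a b : ℕ) :=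
  OpenPartialHomeomorph M (EuclideanSpace ℝ (Fin a) × EuclideanSpace ℝ (Fin b))

/-- `φ` is a smooth chart onto a product of balls; its plaques are the (connected) sets
`φ⁻¹(ball × {v})`. -/
def IsSmoothBox (n : ℕ) {M : Type*} [TopologicalSpace M]
    [ChartedSpace (EuclideanSpace ℝ (Fin n)) M] {a b : ℕ} (φ : FolChart M a b) : Prop :=
  φ.target = Metric.ball 0 1 ×ˢ Metric.ball 0 1 ∧
  ContMDiffOn (𝓡 n) 𝓘(ℝ, EuclideanSpace ℝ (Fin a) × EuclideanSpace ℝ (Fin b)) ∞ φ φ.source ∧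
  ContMDiffOn 𝓘(ℝ, EuclideanSpace ℝ (Fin a) × EuclideanSpace ℝ (Fin b)) (𝓡 n) ∞ φ.symm φ.target

/-- The transverse coordinates of a distinguished chart. -/
def transverse {a b : ℕ} (φ : FolChart M a b) (x : M) : EuclideanSpace ℝ (Fin b) := (φ x).2

/-- The differential of the transverse coordinates; its kernel is the tangent space of the
plaque through `x`. -/
def dTransverse (n : ℕ) {M : Type*} [TopologicalSpace M]
    [ChartedSpace (EuclideanSpace ℝ (Fin n)) M] {a b : ℕ} (φ : FolChart M a b) (x : M) :
    TangentSpace (𝓡 n) x →L[ℝ] EuclideanSpace ℝ (Fin b) :=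
  mfderiv (𝓡 n) 𝓘(ℝ, EuclideanSpace ℝ (Fin b)) (transverse φ) x

/-- A smooth foliation of `M` of dimension `p` and codimension `q`, given by an atlas of
distinguished charts: near each common point of two charts the transverse coordinates of one are
a function of those of the other. -/
structure Foliation (n : ℕ) (M : Type*) [TopologicalSpace M]
    [ChartedSpace (EuclideanSpace ℝ (Fin n)) M] (p q : ℕ) where
  atlas : Set (FolChart M p q)
  smoothBox : ∀ φ ∈ atlas, IsSmoothBox n φ
  cover : ∀ x : M, ∃ φ ∈ atlas, x ∈ φ.source
  compatible : ∀ φ ∈ atlas, ∀ ψ ∈ atlas, ∀ x ∈ φ.source ∩ ψ.source,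
    ∃ τ : EuclideanSpace ℝ (Fin q) → EuclideanSpace ℝ (Fin q),
      ∀ᶠ z in 𝓝 x, transverse ψ z = τ (transverse φ z)

/-- `x` and `y` lie in the same plaque of `φ`. -/
def SamePlaque {a b : ℕ} (φ : FolChart M a b) (x y : M) : Prop :=
  x ∈ φ.source ∧ y ∈ φ.source ∧ transverse φ x = transverse φ y

/-- The holonomy pseudogroup of an atlas of distinguished charts, as local diffeomorphisms between
the local transversals of two charts (written in transverse coordinates). It is generated under
composition by the changes of transverse coordinates at the points common to two charts. -/
inductive Holonomy {a b : ℕ} (𝒜 : Set (FolChart M a b)) :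
    FolChart M a b → FolChart M a b →
      OpenPartialHomeomorph (EuclideanSpace ℝ (Fin b)) (EuclideanSpace ℝ (Fin b)) → Prop
  | step (φ ψ : FolChart M a b)
      (τ : OpenPartialHomeomorph (EuclideanSpace ℝ (Fin b)) (EuclideanSpace ℝ (Fin b)))
      (hφ : φ ∈ 𝒜) (hψ : ψ ∈ 𝒜)
      (smooth : ContDiffOn ℝ ∞ τ τ.source) (smooth_symm : ContDiffOn ℝ ∞ τ.symm τ.target)
      (change : ∀ v ∈ τ.source, ∃ x ∈ φ.source ∩ ψ.source, transverse φ x = v ∧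
        ∀ᶠ z in 𝓝 x, transverse ψ z = τ (transverse φ z)) : Holonomy 𝒜 φ ψ τ
  | comp (φ ψ χ : FolChart M a b)
      (h h' : OpenPartialHomeomorph (EuclideanSpace ℝ (Fin b)) (EuclideanSpace ℝ (Fin b)))
      (left : Holonomy 𝒜 φ ψ h) (right : Holonomy 𝒜 ψ χ h') : Holonomy 𝒜 φ χ (h.trans h')

namespace Foliation

variable {p q : ℕ} (F : Foliation n M p q)

/-- The leaf through `x`: the points reached from `x` by a chain of plaques. -/
def leaf (x : M) : Set M :=
  {y | Relation.ReflTransGen (fun z w => ∃ φ ∈ F.atlas, SamePlaque φ z w) x y}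

/-- The stratum `Σ_{p+k}`: the points whose leaf closure has dimension `p + k`. -/
def stratum (k : ℕ) : Set M :=
  {x | IsSubmanifoldOfDim (𝓡 n) (closure (F.leaf x)) (p + k)}

/-- The (maximal) atlas of the foliation of the stratum `Σ_{p+k}` by leaf closures, when this
stratum is open in `M`: the distinguished charts inside `Σ_{p+k}` with `(p+k)`-dimensional plaques,
each plaque lying in a single leaf closure. -/
def closureAtlas (k : ℕ) : Set (FolChart M (p + k) (q - k)) :=
  {φ | IsSmoothBox n φ ∧ φ.source ⊆ F.stratum k ∧
    ∀ x y, SamePlaque φ x y → y ∈ closure (F.leaf x)}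

/-- The metric `g` is bundle-like: in each distinguished chart, the inner product of vectors
orthogonal to the leaves depends only on their transverse components and on the plaque. -/
def IsBundleLike (g : ContMDiffRiemannianMetric (𝓡 n) ∞ (EuclideanSpace ℝ (Fin n))
    (fun x : M => TangentSpace (𝓡 n) x)) : Prop :=
  ∀ φ ∈ F.atlas, ∀ x y : M, SamePlaque φ x y →
    ∀ (u : TangentSpace (𝓡 n) x) (v : TangentSpace (𝓡 n) y),
      (∀ w, dTransverse n φ x w = 0 → g.inner x u w = 0) →
      (∀ w, dTransverse n φ y w = 0 → g.inner y v w = 0) →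
      dTransverse n φ x u = dTransverse n φ y v → g.inner x u u = g.inner y v v

end Foliation

/-! ### The cotangent bundle and the half-wave canonical relation -/

/-- The cotangent bundle `T*M`. -/
abbrev Cot (n : ℕ) (M : Type*) [TopologicalSpace M] [ChartedSpace (EuclideanSpace ℝ (Fin n)) M]
    [IsManifold (𝓡 n) ∞ M] :=
  TotalSpace (EuclideanSpace ℝ (Fin n) →L[ℝ] ℝ) (fun x : M => TangentSpace (𝓡 n) x →L[ℝ] ℝ)

instance : TopologicalSpace (Cot n M) :=
  ContinuousLinearMap.topologicalSpaceTotalSpace (RingHom.id ℝ) (EuclideanSpace ℝ (Fin n))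
    (fun x : M => TangentSpace (𝓡 n) x) ℝ (fun _ : M => ℝ)

instance : ChartedSpace (ModelProd (EuclideanSpace ℝ (Fin n))
    (EuclideanSpace ℝ (Fin n) →L[ℝ] ℝ)) (Cot n M) := FiberBundle.chartedSpace

/-- The model with corners of `T*M`. -/
abbrev cotModel (n : ℕ) := (𝓡 n).prod 𝓘(ℝ, EuclideanSpace ℝ (Fin n) →L[ℝ] ℝ)

/-- The norm of a covector: `|ξ| = sup {ξ(v) : g(v, v) ≤ 1}`. -/
def conorm (g : ContMDiffRiemannianMetric (𝓡 n) ∞ (EuclideanSpace ℝ (Fin n))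
    (fun x : M => TangentSpace (𝓡 n) x)) (ξ : Cot n M) : ℝ :=
  sSup {r | ∃ v : TangentSpace (𝓡 n) ξ.proj, g.inner ξ.proj v v ≤ 1 ∧ r = ξ.snd v}

/-- The canonical symplectic form `dx ∧ dξ` of `T*M` at `ξ`. The preferred chart of `T*M` at `ξ`,
which identifies the tangent space with `ℝⁿ × (ℝⁿ)*`, is the one induced by a chart of `M`. -/
def symplecticForm (ξ : Cot n M) (X Y : TangentSpace (cotModel n) ξ) : ℝ :=
  let X' : EuclideanSpace ℝ (Fin n) × (EuclideanSpace ℝ (Fin n) →L[ℝ] ℝ) := X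
  let Y' : EuclideanSpace ℝ (Fin n) × (EuclideanSpace ℝ (Fin n) →L[ℝ] ℝ) := Y
  Y'.2 X'.1 - X'.2 Y'.1

/-- `X` is the value at `ξ` of the hamiltonian vector field of `h`: in canonical coordinates
`ẋ = ∂h/∂ξ`, `ξ̇ = -∂h/∂x`. -/
def IsHamiltonianVector (h : Cot n M → ℝ) (ξ : Cot n M) (X : TangentSpace (cotModel n) ξ) : Prop :=
  ∀ Y : TangentSpace (cotModel n) ξ,
    symplecticForm ξ X Y = (mfderiv (cotModel n) 𝓘(ℝ, ℝ) h ξ Y : ℝ)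

/-- `c` is a trajectory in `T*M ∖ 0` of the hamiltonian flow of `h`. -/
def IsHamiltonianTrajectory (h : Cot n M → ℝ) (c : ℝ → Cot n M) : Prop :=
  ∀ s : ℝ, (c s).snd ≠ 0 ∧ MDifferentiableAt 𝓘(ℝ, ℝ) (cotModel n) c s ∧
    IsHamiltonianVector h (c s) (mfderiv 𝓘(ℝ, ℝ) (cotModel n) c s (1 : ℝ))

/-- The canonical relation `Λ` of the half-wave group:
the points `(ξ, η, (t, τ))` of `T*M × T*M × T*ℝ` with `ξ = Φᵗ(η)`, `η ≠ 0` and `τ = σ |η|`, where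
`Φᵗ` is the hamiltonian flow of the norm. The sign is `σ = -1` for `exp(-it√Δ)`. -/
def waveRelation (g : ContMDiffRiemannianMetric (𝓡 n) ∞ (EuclideanSpace ℝ (Fin n))
    (fun x : M => TangentSpace (𝓡 n) x)) (σ : ℝ) : Set (Cot n M × Cot n M × (ℝ × ℝ)) :=
  {P | ∃ c : ℝ → Cot n M, IsHamiltonianTrajectory (conorm g) c ∧
    c 0 = P.2.1 ∧ c P.2.2.1 = P.1 ∧ P.2.2.2 = σ * conorm g P.2.1}

/-! ### The canonical relation of the basic projector -/

/-- The pairs `(η, ξ)` of covectors related by `η = (dh⁻¹)* ξ`, for a local diffeomorphism `h`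
between the transversals of `φ` and `ψ`: here `ξ` and `η` annihilate the plaques of `φ` and `ψ`
through their base points `x` and `y`, the transverse coordinates of `y` are the image under `h`
of those of `x`, and `ζ` is the transverse part of `η`. -/
def holonomySheet {a b : ℕ} (φ ψ : FolChart M a b)
    (h : OpenPartialHomeomorph (EuclideanSpace ℝ (Fin b)) (EuclideanSpace ℝ (Fin b))) :
    Set (Cot n M × Cot n M) :=
  {P | P.2.proj ∈ φ.source ∧ P.1.proj ∈ ψ.source ∧ transverse φ P.2.proj ∈ h.source ∧
    transverse ψ P.1.proj = h (transverse φ P.2.proj) ∧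
    ∃ ζ : EuclideanSpace ℝ (Fin b) →L[ℝ] ℝ,
      (∀ w, P.1.snd w = ζ (dTransverse n ψ P.1.proj w)) ∧
      (∀ w, P.2.snd w =
        ζ (fderiv ℝ h (transverse φ P.2.proj) (dTransverse n φ P.2.proj w)))}

/-- The leaf through `ξ` of the lifted foliation: the covectors `(dh⁻¹)* ξ`, for `h` a holonomy
map. -/
def liftedLeaf {a b : ℕ} (𝒜 : Set (FolChart M a b)) (ξ : Cot n M) : Set (Cot n M) :=
  {η | ∃ φ ψ h, Holonomy 𝒜 φ ψ h ∧ (η, ξ) ∈ holonomySheet φ ψ h}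

namespace Foliation

variable {p q : ℕ} (F : Foliation n M p q)

/-- The nonzero covectors in `N*L̄`, for the leaf closures `L̄` in the stratum `Σ_{p+k}`. -/
def conormals (k : ℕ) : Set (Cot n M) :=
  {ξ | ξ.proj ∈ F.stratum k ∧ ξ.snd ≠ 0 ∧
    ∀ v ∈ tangentSet (𝓡 n) (closure (F.leaf ξ.proj)) ξ.proj, ξ.snd v = 0}

/-- The relation `{(η, ξ) : ξ ∈ N*L̄, L̄ ⊆ Σ_{p+k}, η ∈ ℒ_ξ}`, where `ℒ_ξ` is the orbit of `ξ`
under the holonomy of the atlas `𝒜`. -/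
def conormalRelation (k : ℕ) {a b : ℕ} (𝒜 : Set (FolChart M a b)) : Set (Cot n M × Cot n M) :=
  {P | P.2 ∈ F.conormals k ∧ P.1 ∈ liftedLeaf 𝒜 P.2}

/-- The pieces of `conormalRelation` cut out by single holonomy maps. -/
def sheets (k : ℕ) {a b : ℕ} (𝒜 : Set (FolChart M a b)) : Set (Set (Cot n M × Cot n M)) :=
  {S | ∃ φ ψ h, Holonomy 𝒜 φ ψ h ∧ S = holonomySheet φ ψ h ∩ F.conormalRelation k 𝒜}

/-- `𝒞_max`: the stratum of maximal dimension `p + k`, with the holonomy of its foliation by leaf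
closures. -/
def Cmax (k : ℕ) : Set (Cot n M × Cot n M) := F.conormalRelation k (F.closureAtlas k)

/-- `𝒞_0`: the stratum of compact leaves, with the holonomy of the foliation itself. -/
def Czero : Set (Cot n M × Cot n M) := F.conormalRelation 0 F.atlas

end Foliation

/-- The model with corners of `(T*M × T*M) × (T*M × T*M × T*ℝ)`, with `T*ℝ = ℝ × ℝ`. -/
abbrev ambientModel (n : ℕ) :=
  ((cotModel n).prod (cotModel n)).prod
    ((cotModel n).prod ((cotModel n).prod 𝓘(ℝ, ℝ × ℝ)))

/-- `Y = T*M × Δ(T*M × T*M) × T*M × T*ℝ`. -/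
def diagonalY (n : ℕ) (M : Type*) [TopologicalSpace M]
    [ChartedSpace (EuclideanSpace ℝ (Fin n)) M] [IsManifold (𝓡 n) ∞ M] :
    Set ((Cot n M × Cot n M) × (Cot n M × Cot n M × (ℝ × ℝ))) :=
  {P | P.1.2 = P.2.1}

/-- `C ⊆ T*M × T*M` is a (possibly self-intersecting) immersed submanifold, made up of the
embedded sheets `𝔖`, and it intersects the canonical relation `Λ` cleanly: `Λ` is an embedded
submanifold and, for each sheet `S` of `C`, so is `S` and `S × Λ` meets `Y` cleanly. -/
def IntersectsCleanly (C : Set (Cot n M × Cot n M)) (𝔖 : Set (Set (Cot n M × Cot n M)))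
    (Λ : Set (Cot n M × Cot n M × (ℝ × ℝ))) : Prop :=
  ⋃₀ 𝔖 = C ∧ IsSubmanifold ((cotModel n).prod ((cotModel n).prod 𝓘(ℝ, ℝ × ℝ))) Λ ∧
    ∀ S ∈ 𝔖, IsSubmanifold ((cotModel n).prod (cotModel n)) S ∧
      CleanIntersection (ambientModel n) (S ×ˢ Λ) (diagonalY n M)

end Geometry

end BasicWave

end

set_option linter.unusedSectionVars false

noncomputable section

namespace BasicWave

/-! ### Smooth dependence of the solutions of an ODE on the initial value -/

section Nemytskii

variable {K : Type*} [TopologicalSpace K] [CompactSpace K]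

/-! Cleanness is automatic once the sheets are known to be submanifolds. The hamiltonian flow `Φ` of
the norm is smooth off the zero section, so `Λ` is a graph over the pairs (η, t). If S is a
submanifold of pairs (η, ξ) with ξ ≠ 0, then (S × Λ) ∩ Y consists of the points ((η, ξ), (ξ, Φ⁻ᵗξ,
(t, σ|ξ|))), a graph over S × ℝ. Its tangent spaces are found with two smooth maps: Q, which fixes
Y, and R, which fixes S × Λ, such that R ∘ Q maps S × Λ into the intersection. A vector tangent to
both sets is fixed by dR and dQ, hence tangent to the intersection
(`cleanIntersection_waveRelation`). The flow is complete because the energy |ξ|²/2 is a proper first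
integral on the cotangent bundle of the compact manifold M; its smoothness comes from the inverse
function theorem on a space of continuous curves.

It remains to treat the sheets. In distinguished charts the sheet of h is given by v' = h(v), η = ζ
∘ pr₂, ξ = ζ ∘ dh ∘ pr₂, by ξ ≠ 0, and by the requirement that v lie in the slice of the stratum by
the transversal. The conormality to the leaf closure is then automatic, since plaques and leaf
closures have the same dimension. So the sheet is a submanifold as soon as that slice is one
(`isSubmanifold_sheet`). For `Cmax` the charts lie inside the stratum and the slice is the whole
transversal.

For `Czero` the slice is shown to be, near each of its points, a linear subspace in exponential
coordinates. For a bundle-like metric the energy of a conormal covector is constant along the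
plaques of the lifted foliation, so the cogeodesic flow preserves conormal covectors and permutes
the lifted leaves (`Foliation.LiftRel.geoFlow`). Let x lie on a closed leaf of the stratum and let ζ
be a small conormal covector at x. If the holonomy orbit of ζ in the conormal space at x is finite,
its lifted leaf is compact, and the flow carries it onto a compact set whose projection is a closed
leaf of the stratum (`Foliation.proj_geoFlow_mem_stratum`). Conversely, if the geodesic of ζ ends in
the stratum, the whole orbit of ζ ends on one closed leaf, which meets the transversal discretely;
as the exponential map is injective on small covectors, the orbit is finite
(`Foliation.finite_orbit`). Since transport along leaves is linear, the covectors with finite orbit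
form a linear subspace (`Foliation.finiteOrbits`), and the exponential chart carries it to the slice
(`exists_isSubmanifoldAt_minimal_stratum`). -/

/-- The pointwise application of a bilinear map to continuous functions. -/
def applyCLM (K : Type*) [TopologicalSpace K] [CompactSpace K] {A E F : Type*}
    [NormedAddCommGroup A] [NormedSpace ℝ A]
    [NormedAddCommGroup E] [NormedSpace ℝ E] [NormedAddCommGroup F] [NormedSpace ℝ F]
    (B : A →L[ℝ] E →L[ℝ] F) : C(K, A) →L[ℝ] C(K, E) →L[ℝ] C(K, F) :=
  LinearMap.mkContinuous₂
    (LinearMap.mk₂ ℝ (fun (a : C(K, A)) (β : C(K, E)) =>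
        (⟨fun t => B (a t) (β t), by fun_prop⟩ : C(K, F)))
      (by intros; ext; simp) (by intros; ext; simp) (by intros; ext; simp) (by intros; ext; simp))
    ‖B‖ (by
      intro a β
      change ‖(⟨fun t => B (a t) (β t), _⟩ : C(K, F))‖ ≤ _
      rw [ContinuousMap.norm_le _ (by positivity)]
      intro t
      refine (B.le_opNorm₂ _ _).trans ?_
      gcongr
      · exact a.norm_coe_le_norm t
      · exact β.norm_coe_le_norm t)

/-- Postcomposition with `f'` is continuous for the supremum norm, so `f'` varies little along all
the segments from α(t) to α(t) + β(t) at once; the mean value inequality at each t then gives a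
remainder that is uniform in t. -/
lemma hasFDerivAt_continuousMap_comp {A E F : Type*} [NormedAddCommGroup A] [NormedSpace ℝ A]
    [NormedAddCommGroup E] [NormedSpace ℝ E] [NormedAddCommGroup F] [NormedSpace ℝ F]
    (B : A →L[ℝ] E →L[ℝ] F) (f : C(E, F)) (f' : C(E, A))
    (hf : ∀ x, HasFDerivAt f (B (f' x)) x) (α : C(K, E)) :
    HasFDerivAt (fun α : C(K, E) => f.comp α) (applyCLM K B (f'.comp α)) α := by
  rw [hasFDerivAt_iff_isLittleO_nhds_zero, Asymptotics.isLittleO_iff]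
  intro ε hε
  have hc : Continuous (fun α : C(K, E) => f'.comp α) := ContinuousMap.continuous_postcomp f'
  obtain ⟨δ, hδ, h⟩ := Metric.continuousAt_iff.1 (hc.continuousAt (x := α)) (ε / (‖B‖ + 1))
    (by positivity)
  filter_upwards [Metric.ball_mem_nhds (0 : C(K, E)) hδ] with β hβ
  rw [ContinuousMap.norm_le _ (by positivity)]
  intro t
  have key : ∀ x ∈ segment ℝ (α t) (α t + β t), ‖B (f' x) - B (f' (α t))‖ ≤ ε := by
    rintro x hx
    rw [segment_eq_image'] at hx
    obtain ⟨s, hs, rfl⟩ := hx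
    have h1 : dist (α + s • β) α < δ := by
      rw [dist_eq_norm]
      simp only [add_sub_cancel_left]
      rw [norm_smul, Real.norm_of_nonneg hs.1]
      have : ‖β‖ < δ := by simpa using hβ
      nlinarith [norm_nonneg β, hs.2]
    have h2 := (h h1).le
    rw [dist_eq_norm] at h2
    have h3 := (ContinuousMap.norm_coe_le_norm _ t).trans h2
    simp only [ContinuousMap.sub_apply, ContinuousMap.comp_apply, ContinuousMap.add_apply,
      ContinuousMap.smul_apply] at h3
    rw [add_sub_cancel_left, ← map_sub]
    calc _ ≤ ‖B‖ * ‖f' (α t + s • β t) - f' (α t)‖ := B.le_opNorm _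
      _ ≤ (‖B‖ + 1) * (ε / (‖B‖ + 1)) := by gcongr; linarith
      _ = ε := by field_simp
  have := (convex_segment (𝕜 := ℝ) (α t) (α t + β t)).norm_image_sub_le_of_norm_hasFDerivWithin_le'
    (fun x _ => (hf x).hasFDerivWithinAt) key (left_mem_segment ℝ _ _) (right_mem_segment ℝ _ _)
  simp only [add_sub_cancel_left] at this
  have h4 : ‖β t‖ ≤ ‖β‖ := β.norm_coe_le_norm t
  calc _ = ‖f (α t + β t) - f (α t) - B (f' (α t)) (β t)‖ := rfl
    _ ≤ ε * ‖β t‖ := this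
    _ ≤ ε * ‖β‖ := by gcongr

lemma contDiff_succ_continuousMap_comp {A E F : Type*} [NormedAddCommGroup A] [NormedSpace ℝ A]
    [NormedAddCommGroup E] [NormedSpace ℝ E] [NormedAddCommGroup F] [NormedSpace ℝ F]
    (B : A →L[ℝ] E →L[ℝ] F) (f : C(E, F)) (f' : C(E, A)) (n : ℕ)
    (hf : ∀ x, HasFDerivAt f (B (f' x)) x)
    (hn : ContDiff ℝ n (fun α : C(K, E) => f'.comp α)) :
    ContDiff ℝ (n + 1) (fun α : C(K, E) => f.comp α) :=
  contDiff_succ_iff_hasFDerivAt.2 ⟨fun α => applyCLM K B (f'.comp α),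
    (applyCLM K B).contDiff.comp hn, hasFDerivAt_continuousMap_comp B f f' hf⟩

/-- Composition with a smooth map is smooth on spaces of continuous functions. -/
lemma contDiff_continuousMap_comp.{u, v} {K : Type v} [TopologicalSpace K] [CompactSpace K]
    {E : Type u} [NormedAddCommGroup E] [NormedSpace ℝ E] (n : ℕ) : ∀ {F : Type u}
    [NormedAddCommGroup F] [NormedSpace ℝ F]
    (f : C(E, F)) (_ : ContDiff ℝ n f), ContDiff ℝ n (fun α : C(K, E) => f.comp α) := by
  -- The target F has to vary: the inductive step applies the hypothesis to the derivative, with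
  -- values in E →L F. This is why E and F share a universe.
  induction n with
  | zero =>
    intro F _ _ f _
    exact contDiff_zero.2 (ContinuousMap.continuous_postcomp f)
  | succ n ih =>
    intro F _ _ f hf
    have hf' : ContDiff ℝ n (fderiv ℝ f) := hf.fderiv_right (by norm_cast)
    exact contDiff_succ_continuousMap_comp (ContinuousLinearMap.id ℝ (E →L[ℝ] F)) f
      ⟨fderiv ℝ f, hf'.continuous⟩ n (fun x => (hf.differentiable (by simp) x).hasFDerivAt)
      (ih _ hf')

lemma contDiff_infty_continuousMap_comp.{u} {E F : Type u}
    [NormedAddCommGroup E] [NormedSpace ℝ E] [NormedAddCommGroup F] [NormedSpace ℝ F]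
    (f : C(E, F)) (hf : ContDiff ℝ ∞ f) : ContDiff ℝ ∞ (fun α : C(K, E) => f.comp α) := by
  rw [contDiff_infty] at hf ⊢
  exact fun n => contDiff_continuousMap_comp n f (hf n)

end Nemytskii

/-- The inverse function theorem for maps that are smooth near a point. -/
theorem exists_smooth_localInverse {E F : Type*} [NormedAddCommGroup E] [NormedSpace ℝ E]
    [CompleteSpace E] [NormedAddCommGroup F] [NormedSpace ℝ F] {f : E → F} {u : Set E} {a : E}
    (hu : IsOpen u) (ha : a ∈ u) (hf : ContDiffOn ℝ ∞ f u) (f' : E ≃L[ℝ] F)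
    (hf' : HasFDerivAt f (f' : E →L[ℝ] F) a) :
    ∃ e : OpenPartialHomeomorph E F, a ∈ e.source ∧ e.source ⊆ u ∧ ⇑e = f ∧
      ContDiffOn ℝ ∞ e e.source ∧ ContDiffOn ℝ ∞ e.symm e.target := by
  have hfa : ContDiffAt ℝ ∞ f a := hf.contDiffAt (hu.mem_nhds ha)
  let e₀ := hfa.toOpenPartialHomeomorph f hf' (by simp)
  have he₀ : ⇑e₀ = f := rfl
  have hfd : ContinuousOn (fderiv ℝ f) u := hf.continuousOn_fderiv_of_isOpen hu (by simp)
  -- Restricting to the open set where the derivative is invertible makes the inverse smooth on the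
  -- whole target and not only near f(a).
  let v : Set E := u ∩ fderiv ℝ f ⁻¹' range ((↑) : (E ≃L[ℝ] F) → E →L[ℝ] F)
  have hv : IsOpen v := hfd.isOpen_inter_preimage hu (ContinuousLinearEquiv.isOpen)
  have hav : a ∈ v := ⟨ha, by rw [mem_preimage, hf'.fderiv]; exact mem_range_self _⟩
  refine ⟨e₀.restrOpen v hv, ⟨hfa.mem_toOpenPartialHomeomorph_source hf' (by simp), hav⟩,
    fun x hx => hx.2.1, he₀, ?_, ?_⟩
  · exact hf.mono fun x hx => hx.2.1
  · intro y hy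
    have hy' := (e₀.restrOpen v hv).map_target hy
    obtain ⟨L, hL⟩ := hy'.2.2
    apply ContDiffAt.contDiffWithinAt
    have hc : ContDiffAt ℝ ∞ f ((e₀.restrOpen v hv).symm y) :=
      hf.contDiffAt (hu.mem_nhds hy'.2.1)
    refine (e₀.restrOpen v hv).contDiffAt_symm (f₀' := L) hy ?_ hc
    rw [hL]
    exact (hc.differentiableAt (by simp)).hasFDerivAt

/-! ### The smooth local flow of a vector field -/

section LocalFlow

variable {E : Type*} [NormedAddCommGroup E] [NormedSpace ℝ E] [CompleteSpace E]

/-- The Volterra operator `α ↦ ∫₀ᵗ α`. -/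
def volterra (E : Type*) [NormedAddCommGroup E] [NormedSpace ℝ E] [CompleteSpace E] :
    C(Icc (0 : ℝ) 1, E) →L[ℝ] C(Icc (0 : ℝ) 1, E) :=
  LinearMap.mkContinuous
    { toFun := fun α => ⟨fun t => ∫ s in (0 : ℝ)..t, IccExtend zero_le_one α s, by
        have h : Continuous (IccExtend (zero_le_one' ℝ) α) := α.continuous.Icc_extend'
        exact (intervalIntegral.continuous_primitive (fun a b => h.intervalIntegrable a b) 0).comp
          continuous_subtype_val⟩
      map_add' := by
        intro α β
        ext t
        have h (γ : C(Icc (0 : ℝ) 1, E)) : Continuous (IccExtend (zero_le_one' ℝ) γ) :=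
          γ.continuous.Icc_extend'
        exact intervalIntegral.integral_add ((h α).intervalIntegrable _ _)
          ((h β).intervalIntegrable _ _)
      map_smul' := by
        intro c α
        ext t
        exact intervalIntegral.integral_smul c _ }
    1 (by
      intro α
      rw [one_mul, ContinuousMap.norm_le _ (norm_nonneg _)]
      rintro ⟨t, ht⟩
      have := intervalIntegral.norm_integral_le_of_norm_le_const (a := 0) (b := t) (C := ‖α‖)
        (f := IccExtend (zero_le_one' ℝ) α) (fun x _ => α.norm_coe_le_norm _)
      refine this.trans ?_
      rw [sub_zero, abs_of_nonneg ht.1]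
      nlinarith [norm_nonneg α, ht.2])

lemma volterra_apply (α : C(Icc (0 : ℝ) 1, E)) (t : Icc (0 : ℝ) 1) :
    volterra E α t = ∫ s in (0 : ℝ)..t, IccExtend zero_le_one α s := rfl

/-- Multiplication by a bump function. A globally smooth field is wanted so that composition with it
is defined on all continuous curves. -/
lemma exists_contDiff_eventuallyEq {E F : Type*} [NormedAddCommGroup E] [NormedSpace ℝ E]
    [FiniteDimensional ℝ E] [NormedAddCommGroup F] [NormedSpace ℝ F] {f : E → F} {u : Set E}
    {x₀ : E} (hu : u ∈ 𝓝 x₀) (hf : ContDiffOn ℝ ∞ f u) :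
    ∃ g : E → F, ContDiff ℝ ∞ g ∧ ∀ᶠ x in 𝓝 x₀, g x = f x := by
  obtain ⟨v, hvu, hv, hxv⟩ := mem_nhds_iff.1 hu
  obtain ⟨r, hr, hrv⟩ := Metric.isOpen_iff.1 hv x₀ hxv
  let b : ContDiffBump x₀ := ⟨r / 4, r / 2, by positivity, by linarith⟩
  refine ⟨fun x => b x • f x, contDiff_iff_contDiffAt.2 fun x => ?_, ?_⟩
  · by_cases hx : x ∈ Metric.ball x₀ r
    · exact b.contDiffAt.smul (hf.contDiffAt (Filter.mem_of_superset
        (hv.mem_nhds (hrv hx)) hvu))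
    · have : ∀ᶠ y in 𝓝 x, b y • f y = 0 := by
        have hx' : x ∈ (Metric.closedBall x₀ (r / 2))ᶜ := by
          simp only [Metric.mem_ball, not_lt, mem_compl_iff, Metric.mem_closedBall, not_le] at hx ⊢
          linarith
        filter_upwards [Metric.isClosed_closedBall.isOpen_compl.mem_nhds hx'] with y hy
        rw [b.zero_of_le_dist, zero_smul]
        simp only [mem_compl_iff, Metric.mem_closedBall, not_le] at hy
        exact hy.le
      exact contDiffAt_const.congr_of_eventuallyEq this
  · filter_upwards [b.eventuallyEq_one] with x hx
    simp only [Pi.one_apply] at hx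
    rw [hx, one_smul]

/-- A smooth vector field has a smooth local flow. -/
theorem exists_smooth_local_flow {E : Type*} [NormedAddCommGroup E] [NormedSpace ℝ E]
    [FiniteDimensional ℝ E] {f : E → E} {u : Set E} {x₀ : E} (hu : u ∈ 𝓝 x₀)
    (hf : ContDiffOn ℝ ∞ f u) :
    ∃ ε > 0, ∃ U : Set E, IsOpen U ∧ x₀ ∈ U ∧ ∃ Φ : ℝ × E → E,
      (∀ x ∈ U, Φ (0, x) = x) ∧
      (∀ t ∈ Ioo (-ε) ε, ∀ x ∈ U, Φ (t, x) ∈ u ∧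
        HasDerivAt (fun s => Φ (s, x)) (f (Φ (t, x))) t) ∧
      ContDiffOn ℝ ∞ Φ (Ioo (-ε) ε ×ˢ U) := by
  have : CompleteSpace E := FiniteDimensional.complete ℝ E
  obtain ⟨g, hg, hgf⟩ := exists_contDiff_eventuallyEq hu hf
  -- the defining equation of the solutions, rescaled to the unit interval
  let C := C(Icc (0 : ℝ) 1, E)
  let N : C → C := fun γ => (⟨g, hg.continuous⟩ : C(E, E)).comp γ
  have hN : ContDiff ℝ ∞ N := contDiff_infty_continuousMap_comp _ hg
  let cst : E →L[ℝ] C := ContinuousLinearMap.const ℝ (Icc (0 : ℝ) 1)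
  let G : (E × ℝ) × C → (E × ℝ) × C :=
    fun P => (P.1, P.2 - cst P.1.1 - P.1.2 • volterra E (N P.2))
  have hG : ContDiff ℝ ∞ G := by
    refine contDiff_fst.prodMk ((contDiff_snd.sub (cst.contDiff.comp
      (contDiff_fst.comp contDiff_fst))).sub ?_)
    exact (contDiff_snd.comp contDiff_fst).smul
      ((volterra E).contDiff.comp (hN.comp contDiff_snd))
  let a₀ : (E × ℝ) × C := ((x₀, 0), cst x₀)
  let B : (E × ℝ) →L[ℝ] C := -(cst ∘L ContinuousLinearMap.fst ℝ E ℝ) -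
    (ContinuousLinearMap.snd ℝ E ℝ).smulRight (volterra E (N (cst x₀)))
  -- The integral term carries the factor t, which vanishes at the base point. So the derivative of
  -- G there is the identity plus a part B that maps the parameters to the curves; changing the sign
  -- of B inverts it.
  let G' : ((E × ℝ) × C) ≃L[ℝ] ((E × ℝ) × C) :=
    ContinuousLinearEquiv.equivOfInverse
      ((ContinuousLinearMap.fst ℝ (E × ℝ) C).prod
        (ContinuousLinearMap.snd ℝ (E × ℝ) C + B ∘L ContinuousLinearMap.fst ℝ (E × ℝ) C))
      ((ContinuousLinearMap.fst ℝ (E × ℝ) C).prod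
        (ContinuousLinearMap.snd ℝ (E × ℝ) C - B ∘L ContinuousLinearMap.fst ℝ (E × ℝ) C))
      (fun P => by simp) (fun P => by simp)
  have hG' : HasFDerivAt G (G' : ((E × ℝ) × C) →L[ℝ] ((E × ℝ) × C)) a₀ := by
    have h1 : HasFDerivAt (fun P : (E × ℝ) × C => P.1)
      (ContinuousLinearMap.fst ℝ (E × ℝ) C) a₀ := hasFDerivAt_fst
    have h2 : HasFDerivAt (fun P : (E × ℝ) × C => P.2)
      (ContinuousLinearMap.snd ℝ (E × ℝ) C) a₀ := hasFDerivAt_snd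
    have h3 := ((volterra E).hasFDerivAt.comp a₀
      (((hN.differentiable (by simp)) (cst x₀)).hasFDerivAt.comp a₀ h2))
    have h4 := (h1.snd).smul h3
    have h5 := h1.prodMk ((h2.sub (cst.hasFDerivAt.comp a₀ h1.fst)).sub h4)
    refine h5.congr_fderiv ?_
    ext P <;> simp [G', B, a₀]
  obtain ⟨e, hae, -, heG, -, hes⟩ := exists_smooth_localInverse isOpen_univ (mem_univ a₀)
    hG.contDiffOn G' hG'
  -- solutions
  obtain ⟨ε, hε, a, r, L, K, hr, hPL⟩ := IsPicardLindelof.of_contDiffAt_one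
    (hg.contDiffAt (x := x₀) |>.of_le (by exact_mod_cast le_top) : ContDiffAt ℝ 1 g x₀)
  obtain ⟨α, hα, hαc⟩ := (hPL 0).exists_forall_mem_closedBall_eq_hasDerivWithinAt_continuousOn
  simp only [zero_sub, zero_add] at hα hαc
  have hα0 : α (x₀, 0) = x₀ := (hα x₀ (Metric.mem_closedBall_self r.2)).1
  have hαat : ContinuousAt α (x₀, 0) := hαc.continuousAt
    (prod_mem_nhds (Metric.closedBall_mem_nhds _ hr) (Icc_mem_nhds (by linarith) hε))
  obtain ⟨ρ, hρ, hρe⟩ : ∃ ρ > 0, Metric.ball a₀ ρ ⊆ e.source :=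
    Metric.isOpen_iff.1 e.open_source a₀ hae
  have hnear : ∀ᶠ z in 𝓝 x₀, g z = f z ∧ z ∈ u ∧ dist z x₀ < ρ / 2 :=
    hgf.and (Filter.Eventually.and hu (Metric.ball_mem_nhds _ (by positivity)))
  have hev : ∀ᶠ P in 𝓝 (x₀, (0 : ℝ)), g (α P) = f (α P) ∧ α P ∈ u ∧ dist (α P) x₀ < ρ / 2 := by
    have := hαat.tendsto
    rw [hα0] at this
    exact this.eventually hnear
  obtain ⟨δ, hδ, hδ'⟩ := Metric.eventually_nhds_iff_ball.1 hev
  -- The bound δ keeps the solutions where g = f and within ρ/2 of x₀, ε is the existence time, and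
  -- ρ keeps the parameters in the domain of the local inverse of G.
  let ε' := min (min δ ε) ρ
  have hε' : 0 < ε' := by positivity
  have hr' : (0 : ℝ) < r := hr
  let U : Set E := Metric.ball x₀ (min (min δ r) ρ)
  have hball : ∀ t ∈ Ioo (-ε') ε', ∀ x ∈ U, (x, t) ∈ Metric.ball (x₀, (0 : ℝ)) δ := by
    intro t ht x hx
    rw [Metric.mem_ball, Prod.dist_eq, max_lt_iff]
    refine ⟨lt_of_lt_of_le hx ((min_le_left _ _).trans (min_le_left _ _)), ?_⟩
    rw [Real.dist_0_eq_abs]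
    exact lt_of_lt_of_le (abs_lt.2 ht) ((min_le_left _ _).trans (min_le_left _ _))
  have hUr : ∀ x ∈ U, x ∈ Metric.closedBall x₀ r := fun x hx =>
    Metric.mem_closedBall.2
      (lt_of_lt_of_le hx ((min_le_left _ _).trans (min_le_right _ _))).le
  have hIε : ∀ t ∈ Ioo (-ε') ε', t ∈ Ioo (-ε) ε := fun t ht => by
    have : ε' ≤ ε := (min_le_left _ _).trans (min_le_right _ _)
    exact ⟨by linarith [ht.1], by linarith [ht.2]⟩
  have hderg : ∀ t ∈ Ioo (-ε') ε', ∀ x ∈ U,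
      HasDerivAt (fun s => α (x, s)) (g (α (x, t))) t := fun t ht x hx =>
    ((hα x (hUr x hx)).2 t (Ioo_subset_Icc_self (hIε t ht))).hasDerivAt
      (Icc_mem_nhds (hIε t ht).1 (hIε t ht).2)
  have hsc : ∀ t ∈ Ioo (-ε') ε', ∀ s ∈ Icc (0 : ℝ) 1, t * s ∈ Ioo (-ε') ε' := by
    intro t ht s hs
    rw [mem_Ioo, ← abs_lt] at ht ⊢
    rw [abs_mul, abs_of_nonneg hs.1]
    nlinarith [abs_nonneg t, hs.2]
  -- The solution with initial value x, rescaled to s ↦ α(x, ts), solves G = ((x, t), 0) and is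
  -- close to the constant curve. Hence it is the value of the smooth local inverse, and α(x, t) is
  -- its evaluation at s = 1.
  have hrep : ∀ t ∈ Ioo (-ε') ε', ∀ x ∈ U, ((x, t), (0 : C)) ∈ e.target ∧
      α (x, t) = (e.symm ((x, t), 0)).2 ⟨1, by simp⟩ := by
    intro t ht x hx
    have hcont : Continuous fun s : Icc (0 : ℝ) 1 => α (x, t * s) := by
      rw [continuous_iff_continuousAt]
      intro s
      exact (hderg _ (hsc t ht s s.2) x hx).continuousAt.comp
        (f := fun s : Icc (0 : ℝ) 1 => t * (s : ℝ)) (by fun_prop)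
    let γ : C := ⟨fun s => α (x, t * s), hcont⟩
    have hmem : ((x, t), γ) ∈ e.source := by
      apply hρe
      rw [Metric.mem_ball, Prod.dist_eq, Prod.dist_eq, max_lt_iff, max_lt_iff]
      refine ⟨⟨lt_of_lt_of_le hx (min_le_right _ _), ?_⟩, ?_⟩
      · rw [Real.dist_0_eq_abs]
        exact lt_of_lt_of_le (abs_lt.2 ht) (min_le_right _ _)
      · refine lt_of_le_of_lt ((ContinuousMap.dist_le (by positivity)).2 fun s => ?_)
          (half_lt_self hρ)
        exact (hδ' _ (hball _ (hsc t ht s s.2) x hx)).2.2.le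
    have heq : e ((x, t), γ) = ((x, t), 0) := by
      rw [heG]
      refine Prod.ext rfl ?_
      ext s
      have hder : ∀ σ ∈ uIcc 0 (s : ℝ), HasDerivAt (fun σ => α (x, t * σ))
          (t • IccExtend zero_le_one (N γ) σ) σ := by
        intro σ hσ
        rw [uIcc_of_le s.2.1] at hσ
        have hσ' : σ ∈ Icc (0 : ℝ) 1 := ⟨hσ.1, hσ.2.trans s.2.2⟩
        rw [IccExtend_of_mem _ _ hσ']
        have h1 := (hderg _ (hsc t ht σ hσ') x hx).scomp σ ((hasDerivAt_id σ).const_mul t)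
        have h2 : N γ ⟨σ, hσ'⟩ = g (α (x, t * σ)) := rfl
        simpa [h2, Function.comp_def] using h1
      have hint := intervalIntegral.integral_eq_sub_of_hasDerivAt hder
        (((N γ).continuous.Icc_extend' (h := zero_le_one)).const_smul t |>.intervalIntegrable _ _)
      rw [intervalIntegral.integral_smul] at hint
      change γ s - x - t • volterra E (N γ) s = 0
      have hγ : γ s = α (x, t * s) := rfl
      rw [volterra_apply, hint, mul_zero, (hα x (hUr x hx)).1, hγ, sub_self]
    rw [← heq, e.left_inv hmem]
    refine ⟨e.map_source hmem, ?_⟩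
    change α (x, t) = α (x, t * 1)
    rw [mul_one]
  refine ⟨ε', hε', U, Metric.isOpen_ball, Metric.mem_ball_self (by positivity),
    fun P => α (P.2, P.1), fun x hx => (hα x (hUr x hx)).1, fun t ht x hx => ?_, ?_⟩
  · have h := hδ' _ (hball t ht x hx)
    refine ⟨h.2.1, ?_⟩
    rw [← h.1]
    exact hderg t ht x hx
  · have h1 : ContDiffOn ℝ ∞ (fun P : ℝ × E => (e.symm ((P.2, P.1), 0)).2 ⟨1, by simp⟩)
        (Ioo (-ε') ε' ×ˢ U) := by
      have h2 : ContDiffOn ℝ ∞ (fun P : ℝ × E => e.symm ((P.2, P.1), 0))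
          (Ioo (-ε') ε' ×ˢ U) :=
        hes.comp (ContDiff.contDiffOn (by fun_prop)) fun P hP => (hrep P.1 hP.1 P.2 hP.2).1
      exact (ContinuousMap.evalCLM ℝ (⟨1, by simp⟩ : Icc (0 : ℝ) 1)).contDiff.comp_contDiffOn h2.snd
    exact h1.congr fun P hP => (hrep P.1 hP.1 P.2 hP.2).2

end LocalFlow

/-! ### Smooth vector fields in charts and their flows -/

section Flow

variable {W : Type*} [NormedAddCommGroup W] [NormedSpace ℝ W] {H : Type*} [TopologicalSpace H]
  {I : ModelWithCorners ℝ W H} {N : Type*} [TopologicalSpace N] [ChartedSpace H N]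
  {V : Type*} [NormedAddCommGroup V] [NormedSpace ℝ V]

/-- A diffeomorphism from an open subset of a manifold to an open subset of a vector space. -/
structure IsSmoothChart (I : ModelWithCorners ℝ W H) (κ : OpenPartialHomeomorph N V) : Prop where
  smooth : ContMDiffOn I 𝓘(ℝ, V) ∞ κ κ.source
  smooth_symm : ContMDiffOn 𝓘(ℝ, V) I ∞ κ.symm κ.target

namespace IsSmoothChart

variable {κ : OpenPartialHomeomorph N V} (hκ : IsSmoothChart I κ)
include hκ

lemma contMDiffAt {x : N} (hx : x ∈ κ.source) : ContMDiffAt I 𝓘(ℝ, V) ∞ κ x :=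
  hκ.smooth.contMDiffAt (κ.open_source.mem_nhds hx)

lemma contMDiffAt_symm {z : V} (hz : z ∈ κ.target) : ContMDiffAt 𝓘(ℝ, V) I ∞ κ.symm z :=
  hκ.smooth_symm.contMDiffAt (κ.open_target.mem_nhds hz)

lemma mdifferentiableAt {x : N} (hx : x ∈ κ.source) : MDifferentiableAt I 𝓘(ℝ, V) κ x :=
  (hκ.contMDiffAt hx).mdifferentiableAt (by simp)

lemma mdifferentiableAt_symm {z : V} (hz : z ∈ κ.target) :
    MDifferentiableAt 𝓘(ℝ, V) I κ.symm z :=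
  (hκ.contMDiffAt_symm hz).mdifferentiableAt (by simp)

lemma mfderiv_symm_mfderiv {x : N} (hx : x ∈ κ.source) (v : TangentSpace I x) :
    mfderiv 𝓘(ℝ, V) I κ.symm (κ x) (mfderiv I 𝓘(ℝ, V) κ x v) = v := by
  have h1 : HasMFDerivAt I I (κ.symm ∘ κ) x
      ((mfderiv 𝓘(ℝ, V) I κ.symm (κ x)).comp (mfderiv I 𝓘(ℝ, V) κ x)) :=
    (hκ.mdifferentiableAt_symm (κ.map_source hx)).hasMFDerivAt.comp x
      (hκ.mdifferentiableAt hx).hasMFDerivAt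
  have h2 : HasMFDerivAt I I (κ.symm ∘ κ) x (ContinuousLinearMap.id ℝ (TangentSpace I x)) := by
    refine (hasMFDerivAt_id x).congr_of_eventuallyEq ?_
    filter_upwards [κ.open_source.mem_nhds hx] with y hy
    exact κ.left_inv hy
  have h3 := hasMFDerivAt_unique h1 h2
  exact congrArg (fun L => L v) h3

lemma mfderiv_mfderiv_symm {z : V} (hz : z ∈ κ.target) (v : V) :
    mfderiv I 𝓘(ℝ, V) κ (κ.symm z) (mfderiv 𝓘(ℝ, V) I κ.symm z v) = v := by
  have h1 : HasMFDerivAt 𝓘(ℝ, V) 𝓘(ℝ, V) (κ ∘ κ.symm) z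
      ((mfderiv I 𝓘(ℝ, V) κ (κ.symm z)).comp (mfderiv 𝓘(ℝ, V) I κ.symm z)) :=
    (hκ.mdifferentiableAt (κ.map_target hz)).hasMFDerivAt.comp z
      (hκ.mdifferentiableAt_symm hz).hasMFDerivAt
  have h2 : HasMFDerivAt 𝓘(ℝ, V) 𝓘(ℝ, V) (κ ∘ κ.symm) z
      (ContinuousLinearMap.id ℝ (TangentSpace 𝓘(ℝ, V) z)) := by
    refine (hasMFDerivAt_id z).congr_of_eventuallyEq ?_
    filter_upwards [κ.open_target.mem_nhds hz] with y hy
    exact κ.right_inv hy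
  have h3 := hasMFDerivAt_unique h1 h2
  exact congrArg (fun L => L v) h3

/-- The differential of a chart, as an equivalence. -/
def tangentEquiv {x : N} (hx : x ∈ κ.source) : TangentSpace I x ≃L[ℝ] V :=
  ContinuousLinearEquiv.equivOfInverse (mfderiv I 𝓘(ℝ, V) κ x)
    (mfderiv 𝓘(ℝ, V) I κ.symm (κ x)) (hκ.mfderiv_symm_mfderiv hx) (fun v => by
      have h := hκ.mfderiv_mfderiv_symm (κ.map_source hx) v
      rwa [κ.left_inv hx] at h)

end IsSmoothChart

/-- In each of a family of charts covering the manifold the vector field `X` is smooth. -/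
def IsSmoothField (V : Type*) [NormedAddCommGroup V] [NormedSpace ℝ V]
    (X : ∀ x : N, TangentSpace I x) : Prop :=
  ∀ x₀ : N, ∃ κ : OpenPartialHomeomorph N V, x₀ ∈ κ.source ∧ IsSmoothChart I κ ∧
    ∃ f : V → V, ContDiffOn ℝ ∞ f κ.target ∧
      ∀ x ∈ κ.source, mfderiv I 𝓘(ℝ, V) κ x (X x) = f (κ x)

variable {X : ∀ x : N, TangentSpace I x}

/-- Class C¹ is what the uniqueness and the continuation of integral curves require. -/
lemma IsSmoothField.contMDiff [IsManifold I ∞ N] (hX : IsSmoothField V X) :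
    ContMDiff I I.tangent 1 (fun x => (⟨x, X x⟩ : TangentBundle I N)) := by
  intro x₀
  obtain ⟨κ, hx₀, hκ, f, hf, hfX⟩ := hX x₀
  have h1 : ContMDiffOn 𝓘(ℝ, V).tangent I.tangent 1
      (tangentMapWithin 𝓘(ℝ, V) I κ.symm κ.target) (π V (TangentSpace 𝓘(ℝ, V)) ⁻¹' κ.target) :=
    (hκ.smooth_symm).contMDiffOn_tangentMapWithin (by norm_cast) κ.open_target.uniqueMDiffOn
  have h2 : ContMDiffOn 𝓘(ℝ, V) 𝓘(ℝ, V).tangent 1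
      (fun z => (⟨z, f z⟩ : TangentBundle 𝓘(ℝ, V) V)) κ.target :=
    contMDiffOn_vectorSpace_iff_contDiffOn.2 (hf.of_le (by exact_mod_cast le_top))
  have h3 : ContMDiffOn I I.tangent 1 (fun x => tangentMapWithin 𝓘(ℝ, V) I κ.symm κ.target
      (⟨κ x, f (κ x)⟩ : TangentBundle 𝓘(ℝ, V) V)) κ.source :=
    h1.comp (h2.comp (hκ.smooth.of_le (by exact_mod_cast le_top)) κ.mapsTo)
      fun x hx => κ.map_source hx
  refine (h3.contMDiffAt (κ.open_source.mem_nhds hx₀)).congr_of_eventuallyEq ?_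
  filter_upwards [κ.open_source.mem_nhds hx₀] with x hx
  have h4 := hκ.mfderiv_symm_mfderiv hx (X x)
  rw [hfX x hx] at h4
  have h5 : mfderivWithin 𝓘(ℝ, V) I κ.symm κ.target (κ x) (f (κ x)) =
      mfderiv 𝓘(ℝ, V) I κ.symm (κ x) (f (κ x)) := by
    rw [mfderivWithin_of_isOpen κ.open_target (κ.map_source hx)]
  have h6 : κ.symm (κ x) = x := κ.left_inv hx
  refine Bundle.TotalSpace.ext h6.symm ?_
  exact (heq_of_eq (h5.trans h4)).symm

/-- A smooth vector field has smooth local flows. -/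
lemma IsSmoothField.exists_local_flow [FiniteDimensional ℝ V] (hX : IsSmoothField V X) (x₀ : N) :
    ∃ ε > 0, ∃ U : Set N, IsOpen U ∧ x₀ ∈ U ∧ ∃ Θ : ℝ → N → N,
      (∀ x ∈ U, Θ 0 x = x) ∧
      (∀ x ∈ U, IsMIntegralCurveOn (fun t => Θ t x) X (Ioo (-ε) ε)) ∧
      ContMDiffOn (𝓘(ℝ, ℝ).prod I) I ∞ (fun P : ℝ × N => Θ P.1 P.2) (Ioo (-ε) ε ×ˢ U) := by
  obtain ⟨κ, hx₀, hκ, f, hf, hfX⟩ := hX x₀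
  obtain ⟨ε, hε, U, hU, hxU, Φ, h0, h1, h2⟩ := exists_smooth_local_flow
    (κ.open_target.mem_nhds (κ.map_source hx₀)) hf
  refine ⟨ε, hε, κ.source ∩ κ ⁻¹' U, κ.isOpen_inter_preimage hU, ⟨hx₀, hxU⟩,
    fun t x => κ.symm (Φ (t, κ x)), fun x hx => ?_, fun x hx t ht => ?_, ?_⟩
  · simp only [h0 _ hx.2, κ.left_inv hx.1]
  · obtain ⟨h3, h4⟩ := h1 t ht (κ x) hx.2
    have h5 : HasMFDerivAt 𝓘(ℝ, ℝ) 𝓘(ℝ, V) (fun s => Φ (s, κ x)) t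
        ((1 : ℝ →L[ℝ] ℝ).smulRight (f (Φ (t, κ x)))) := h4.hasFDerivAt.hasMFDerivAt
    have h6 := (hκ.mdifferentiableAt_symm h3).hasMFDerivAt.comp t h5
    refine HasMFDerivAt.hasMFDerivWithinAt ?_
    refine h6.congr_mfderiv ?_
    apply ContinuousLinearMap.ext_ring
    have h7 := hκ.mfderiv_symm_mfderiv (κ.map_target h3) (X (κ.symm (Φ (t, κ x))))
    rw [hfX _ (κ.map_target h3), κ.right_inv h3] at h7
    have h8 : ((1 : ℝ →L[ℝ] ℝ).smulRight (f (Φ (t, κ x)))) 1 = f (Φ (t, κ x)) := by simp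
    have h9 : ((1 : ℝ →L[ℝ] ℝ).smulRight (X (κ.symm (Φ (t, κ x))))) 1 =
      X (κ.symm (Φ (t, κ x))) := by simp
    refine Eq.trans ?_ h9.symm
    refine Eq.trans ?_ h7
    exact congrArg (mfderiv 𝓘(ℝ, V) I κ.symm (Φ (t, κ x))) h8
  · refine hκ.smooth_symm.comp (t := κ.target) (ContMDiffOn.comp (t := Ioo (-ε) ε ×ˢ U)
      (I' := 𝓘(ℝ, ℝ).prod 𝓘(ℝ, V)) (g := Φ) (f := fun P : ℝ × N => (P.1, κ P.2)) ?_ ?_ ?_) ?_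
    · rw [← modelWithCornersSelf_prod, chartedSpaceSelf_prod]
      exact h2.contMDiffOn
    · exact contMDiffOn_fst.prodMk (hκ.smooth.comp contMDiffOn_snd fun P hP => hP.2.1)
    · exact fun P hP => ⟨hP.1, hP.2.2⟩
    · exact fun P hP => (h1 _ hP.1 _ hP.2.2).1

/-- Finitely many local flows cover K, which gives a common existence time there; outside K the
constant curves are integral curves. A uniform existence time makes every integral curve global. -/
lemma exists_isMIntegralCurve_of_isCompact [IsManifold I ∞ N] [T2Space N] [BoundarylessManifold I N]
    [CompleteSpace W] [FiniteDimensional ℝ V] (hX : IsSmoothField V X) {K : Set N}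
    (hK : IsCompact K) (h0 : ∀ x ∉ K, X x = 0) (x : N) :
    ∃ γ : ℝ → N, γ 0 = x ∧ IsMIntegralCurve γ X := by
  have : IsManifold I 1 N := IsManifold.of_le (n := ∞) (by exact_mod_cast le_top)
  choose ε hε U hU hxU Θ hΘ0 hΘ _ using hX.exists_local_flow
  obtain ⟨t, ht⟩ := hK.elim_finite_subcover U hU fun x _ => mem_iUnion.2 ⟨x, hxU x⟩
  obtain ⟨δ, hδ, hδ'⟩ : ∃ δ > 0, ∀ i ∈ t, δ ≤ ε i := by
    by_cases hne : t.Nonempty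
    · obtain ⟨i, hi, hmin⟩ := t.exists_min_image ε hne
      exact ⟨ε i, hε i, hmin⟩
    · exact ⟨1, one_pos, fun i hi => (hne ⟨i, hi⟩).elim⟩
  refine exists_isMIntegralCurve_of_isMIntegralCurveOn hX.contMDiff hδ (fun y => ?_) x
  by_cases hy : y ∈ K
  · obtain ⟨i, hi, hyi⟩ := mem_iUnion₂.1 (ht hy)
    exact ⟨fun s => Θ i s y, hΘ0 i y hyi, (hΘ i y hyi).mono
      (Ioo_subset_Ioo (neg_le_neg (hδ' i hi)) (hδ' i hi))⟩
  · exact ⟨fun _ => y, rfl, (isMIntegralCurve_const (h0 y hy)).isMIntegralCurveOn _⟩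

/-- A first integral is constant along the integral curves of a vector field. -/
lemma eq_of_isMIntegralCurve {h : N → ℝ} (hh : ContMDiff I 𝓘(ℝ, ℝ) ∞ h)
    (hinv : ∀ x, mfderiv I 𝓘(ℝ, ℝ) h x (X x) = (0 : ℝ)) {γ : ℝ → N} (hγ : IsMIntegralCurve γ X)
    (t : ℝ) : h (γ t) = h (γ 0) := by
  have hd : ∀ s, HasDerivAt (h ∘ γ) 0 s := by
    intro s
    let L : ℝ →L[ℝ] ℝ := (mfderiv I 𝓘(ℝ, ℝ) h (γ s)).comp ((1 : ℝ →L[ℝ] ℝ).smulRight (X (γ s)))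
    have h1 : HasFDerivAt (h ∘ γ) L s :=
      ((hh.mdifferentiable (by simp) (γ s)).hasMFDerivAt.comp s (hγ s)).hasFDerivAt
    have h2 := h1.hasDerivAt
    have h3 : L 1 = 0 := by
      have h9 : ((1 : ℝ →L[ℝ] ℝ).smulRight (X (γ s))) 1 = X (γ s) := by simp
      exact (congrArg (mfderiv I 𝓘(ℝ, ℝ) h (γ s)) h9).trans (hinv (γ s))
    exact h3 ▸ h2
  exact is_const_of_deriv_eq_zero (fun s => (hd s).differentiableAt) (fun s => (hd s).deriv) t 0

/-- A smooth vector field that has a proper first integral is complete. -/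
lemma exists_isMIntegralCurve_of_firstIntegral [IsManifold I ∞ N] [T2Space N]
    [BoundarylessManifold I N] [CompleteSpace W] [FiniteDimensional ℝ V] (hX : IsSmoothField V X)
    {h : N → ℝ} (hh : ContMDiff I 𝓘(ℝ, ℝ) ∞ h)
    (hinv : ∀ x, mfderiv I 𝓘(ℝ, ℝ) h x (X x) = (0 : ℝ))
    (hK : ∀ R : ℝ, IsCompact {x | |h x| ≤ R}) (x : N) :
    ∃ γ : ℝ → N, γ 0 = x ∧ IsMIntegralCurve γ X := by
  -- The field is multiplied by a cutoff of h, so that it vanishes outside a compact set. The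
  -- integral curves of the new field still preserve h, hence the one through x stays where the
  -- cutoff equals 1 and is an integral curve of X.
  let b : ContDiffBump (0 : ℝ) := ⟨|h x| + 1, |h x| + 2, by positivity, by linarith⟩
  let X' : ∀ y : N, TangentSpace I y := fun y => b (h y) • X y
  have hX' : IsSmoothField V X' := by
    intro x₀
    obtain ⟨κ, hx₀, hκ, f, hf, hfX⟩ := hX x₀
    refine ⟨κ, hx₀, hκ, fun z => b (h (κ.symm z)) • f z, ?_, fun y hy => ?_⟩
    · refine ContDiffOn.smul ?_ hf
      have := hh.comp_contMDiffOn hκ.smooth_symm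
      exact b.contDiff.comp_contDiffOn (contMDiffOn_iff_contDiffOn.1 this)
    · have h1 : mfderiv I 𝓘(ℝ, V) κ y (X' y) = b (h y) • mfderiv I 𝓘(ℝ, V) κ y (X y) :=
        (mfderiv I 𝓘(ℝ, V) κ y).map_smul _ _
      have h4 : b (h (κ.symm (κ y))) = b (h y) := by rw [κ.left_inv hy]
      exact (h1.trans (congrArg (fun v : V => b (h y) • v) (hfX y hy))).trans
        (congrArg (fun r : ℝ => r • f (κ y)) h4.symm)
  obtain ⟨γ, hγ0, hγ⟩ := exists_isMIntegralCurve_of_isCompact hX' (hK (|h x| + 2)) (fun y hy => by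
    have : b (h y) = 0 := b.zero_of_le_dist (by
      simp only [mem_ofPred_eq, not_le] at hy
      rw [Real.dist_0_eq_abs]
      exact hy.le)
    simp only [X', this, zero_smul]) x
  refine ⟨γ, hγ0, fun t => ?_⟩
  have h2 : h (γ t) = h x := by
    rw [← hγ0]
    refine eq_of_isMIntegralCurve hh (fun y => ?_) hγ t
    have h1 : mfderiv I 𝓘(ℝ, ℝ) h y (X' y) = b (h y) • mfderiv I 𝓘(ℝ, ℝ) h y (X y) :=
      (mfderiv I 𝓘(ℝ, ℝ) h y).map_smul _ _
    exact h1.trans ((congrArg (fun v : ℝ => b (h y) • v) (hinv y)).trans (smul_zero _))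
  have h3 : X' (γ t) = X (γ t) := by
    have : b (h (γ t)) = 1 := b.one_of_mem_closedBall (by
      rw [h2, Metric.mem_closedBall, Real.dist_0_eq_abs]
      exact (lt_add_one _).le)
    simp only [X', this, one_smul]
  exact h3 ▸ hγ t

lemma flow_add [IsManifold I ∞ N] [T2Space N] [BoundarylessManifold I N]
    (hX : IsSmoothField V X) {Ψ : ℝ → N → N} (h0 : ∀ x, Ψ 0 x = x)
    (hΨ : ∀ x, IsMIntegralCurve (fun t => Ψ t x) X) (s t : ℝ) (x : N) :
    Ψ (s + t) x = Ψ s (Ψ t x) := by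
  have : IsManifold I 1 N := IsManifold.of_le (n := ∞) (by exact_mod_cast le_top)
  have h1 := isMIntegralCurve_Ioo_eq_of_contMDiff_boundaryless (t₀ := (0 : ℝ)) hX.contMDiff
    ((hΨ x).comp_add t) (hΨ (Ψ t x)) (by simp [h0])
  exact congrFun h1 s

/-- The flow of a complete smooth vector field is smooth. -/
theorem contMDiff_flow [IsManifold I ∞ N] [T2Space N] [BoundarylessManifold I N]
    [FiniteDimensional ℝ V] (hX : IsSmoothField V X) {Ψ : ℝ → N → N} (h0 : ∀ x, Ψ 0 x = x)
    (hΨ : ∀ x, IsMIntegralCurve (fun t => Ψ t x) X) :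
    ContMDiff (𝓘(ℝ, ℝ).prod I) I ∞ (fun P : ℝ × N => Ψ P.1 P.2) := by
  have : IsManifold I 1 N := IsManifold.of_le (n := ∞) (by exact_mod_cast le_top)
  have hloc : ∀ x₀, ∃ ε > 0, ∃ U : Set N, IsOpen U ∧ x₀ ∈ U ∧
      ContMDiffOn (𝓘(ℝ, ℝ).prod I) I ∞ (fun P : ℝ × N => Ψ P.1 P.2) (Ioo (-ε) ε ×ˢ U) := by
    intro x₀
    obtain ⟨ε, hε, U, hU, hxU, Θ, hΘ0, hΘ, hs⟩ := hX.exists_local_flow x₀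
    refine ⟨ε, hε, U, hU, hxU, hs.congr fun P hP => ?_⟩
    exact isMIntegralCurveOn_Ioo_eqOn_of_contMDiff_boundaryless (t₀ := 0) ⟨by linarith, hε⟩
      hX.contMDiff ((hΨ P.2).isMIntegralCurveOn _) (hΘ P.2 hP.2)
      (by simp [h0, hΘ0 _ hP.2]) hP.1
  rintro ⟨t₀, x⟩
  -- The times t near which the flow is smooth around (t, x). This set contains 0; it is shown to be
  -- open and closed.
  let S : Set ℝ := {t | ∃ O : Set (ℝ × N), IsOpen O ∧ (t, x) ∈ O ∧
    ContMDiffOn (𝓘(ℝ, ℝ).prod I) I ∞ (fun P : ℝ × N => Ψ P.1 P.2) O}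
  have hcx : Continuous fun t => Ψ t x := (hΨ x).continuous
  -- Around Ψ(t₁, x) the flow is smooth for short times. For s and t close to t₁ the identity Ψₜ =
  -- Ψₜ₋ₛ ∘ Ψₛ carries smoothness from s to t; the radius ε/2 ensures |t - s| < ε. The symmetry in s
  -- and t yields both openness and closedness.
  have hstep : ∀ t₁, ∃ δ > 0, ∀ t ∈ Metric.ball t₁ δ, ∀ s ∈ Metric.ball t₁ δ, s ∈ S → t ∈ S := by
    intro t₁
    obtain ⟨ε, hε, U, hU, hxU, hs⟩ := hloc (Ψ t₁ x)
    obtain ⟨δ, hδ, hδU⟩ := Metric.isOpen_iff.1 (hU.preimage hcx) t₁ hxU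
    refine ⟨min δ (ε / 2), by positivity, fun t ht s hs' => ?_⟩
    rintro ⟨O, hO, hsO, hOs⟩
    have hOslice : ∀ P : ℝ × N, (s, P.2) ∈ O → ContMDiffAt (𝓘(ℝ, ℝ).prod I) I ∞
        (fun P : ℝ × N => Ψ s P.2) P := fun P hP =>
      (hOs.contMDiffAt (hO.mem_nhds hP)).comp P
        (f := fun P : ℝ × N => ((s, P.2) : ℝ × N)) (contMDiffAt_const.prodMk contMDiffAt_snd)
    have hOo : IsOpen {P : ℝ × N | (s, P.2) ∈ O} := hO.preimage (by fun_prop)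
    have hcont : ContinuousOn (fun P : ℝ × N => Ψ s P.2) {P : ℝ × N | (s, P.2) ∈ O} :=
      fun P hP => (hOslice P hP).continuousAt.continuousWithinAt
    refine ⟨({P : ℝ × N | (s, P.2) ∈ O} ∩ (fun P : ℝ × N => Ψ s P.2) ⁻¹' U) ∩
      {P : ℝ × N | P.1 - s ∈ Ioo (-ε) ε},
      (hcont.isOpen_inter_preimage hOo hU).inter (isOpen_Ioo.preimage (by fun_prop)),
      ⟨⟨hsO, hδU (Metric.ball_subset_ball (min_le_left _ _) hs')⟩, ?_⟩, ?_⟩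
    · simp only [Metric.mem_ball, lt_min_iff, Real.dist_eq, abs_lt] at ht hs'
      exact ⟨by linarith [ht.2.1, hs'.2.2], by linarith [ht.2.2, hs'.2.1]⟩
    · intro P hP
      have h1 : ContMDiffAt (𝓘(ℝ, ℝ).prod I) I ∞
          (fun P : ℝ × N => Ψ (P.1 - s) (Ψ s P.2)) P := by
        refine ContMDiffAt.comp (I' := 𝓘(ℝ, ℝ).prod I) P
          (g := fun P : ℝ × N => Ψ P.1 P.2) (f := fun P : ℝ × N => (P.1 - s, Ψ s P.2))
          (hs.contMDiffAt ((isOpen_Ioo.prod hU).mem_nhds ⟨hP.2, hP.1.2⟩)) ?_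
        refine ContMDiffAt.prodMk ?_ (hOslice P hP.1.1)
        exact (contDiff_id.sub contDiff_const).contMDiff.contMDiffAt.comp P contMDiffAt_fst
      refine (h1.congr_of_eventuallyEq (Filter.Eventually.of_forall fun Q => ?_)).contMDiffWithinAt
      simp only [← flow_add hX h0 hΨ, sub_add_cancel]
  have hSo : IsClopen S := by
    constructor
    · rw [← isOpen_compl_iff, Metric.isOpen_iff]
      intro t ht
      obtain ⟨δ, hδ, h⟩ := hstep t
      exact ⟨δ, hδ, fun s hs hsS => ht (h t (Metric.mem_ball_self hδ) s hs hsS)⟩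
    · rw [Metric.isOpen_iff]
      intro t ht
      obtain ⟨δ, hδ, h⟩ := hstep t
      exact ⟨δ, hδ, fun s hs => h s hs t (Metric.mem_ball_self hδ) ht⟩
  have h0S : (0 : ℝ) ∈ S := by
    obtain ⟨ε, hε, U, hU, hxU, hs⟩ := hloc x
    exact ⟨_, isOpen_Ioo.prod hU, ⟨⟨by linarith, hε⟩, hxU⟩, hs⟩
  have hSu : S = univ := hSo.eq_univ ⟨0, h0S⟩
  obtain ⟨O, hO, hmem, hs⟩ : t₀ ∈ S := hSu ▸ mem_univ t₀
  exact hs.contMDiffAt (hO.mem_nhds hmem)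

end Flow

/-! ### Constructions of submanifolds -/

section SubmanifoldConstructions

variable {V : Type*} [NormedAddCommGroup V] [NormedSpace ℝ V] [FiniteDimensional ℝ V]
  {H : Type*} [TopologicalSpace H] {I : ModelWithCorners ℝ V H}
  {X : Type*} [TopologicalSpace X] [ChartedSpace H X]
  {V' : Type*} [NormedAddCommGroup V'] [NormedSpace ℝ V'] [FiniteDimensional ℝ V']
  {H' : Type*} [TopologicalSpace H'] {I' : ModelWithCorners ℝ V' H'}
  {X' : Type*} [TopologicalSpace X'] [ChartedSpace H' X']

lemma hasMFDerivAt_prodMk_space {E F : Type*} [NormedAddCommGroup E] [NormedSpace ℝ E]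
    [NormedAddCommGroup F] [NormedSpace ℝ F] {f : X → E} {g : X → F} {x : X}
    {f' : TangentSpace I x →L[ℝ] E} {g' : TangentSpace I x →L[ℝ] F}
    (hf : HasMFDerivAt I 𝓘(ℝ, E) f x f') (hg : HasMFDerivAt I 𝓘(ℝ, F) g x g') :
    HasMFDerivAt I 𝓘(ℝ, E × F) (fun y => (f y, g y)) x (f'.prod g') :=
  ⟨hf.1.prodMk hg.1, hf.2.prodMk hg.2⟩

/-- Composition with a linear isomorphism to Euclidean space allows equations with values in any
finite-dimensional space. -/
lemma isSubmanifoldAt_of_submersion {Z : Type*} [NormedAddCommGroup Z] [NormedSpace ℝ Z]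
    [FiniteDimensional ℝ Z] {S U : Set X} {x : X} {d : ℕ} (hU : IsOpen U) (hx : x ∈ U) {f : X → Z}
    (hf : ContMDiffOn I 𝓘(ℝ, Z) ∞ f U) (hS : ∀ z ∈ U, z ∈ S ↔ f z = 0)
    (hs : ∀ z ∈ U, Function.Surjective (mfderiv I 𝓘(ℝ, Z) f z))
    (hd : Module.finrank ℝ Z + d = Module.finrank ℝ V) : IsSubmanifoldAt I S d x := by
  let L : Z ≃L[ℝ] EuclideanSpace ℝ (Fin (Module.finrank ℝ Z)) := toEuclidean
  have hL : ContMDiff 𝓘(ℝ, Z) 𝓘(ℝ, EuclideanSpace ℝ (Fin (Module.finrank ℝ Z))) ∞ L :=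
    L.contDiff.contMDiff
  refine ⟨U, hU, hx, Module.finrank ℝ Z, hd, L ∘ f, hL.comp_contMDiffOn hf, ?_, ?_⟩
  · ext z
    constructor
    · rintro ⟨h1, h2⟩
      exact ⟨h2, by simp [(hS z h2).1 h1]⟩
    · rintro ⟨h1, h2⟩
      exact ⟨(hS z h1).2 (by simpa using h2), h1⟩
  · intro z hz
    have h1 : MDifferentiableAt I 𝓘(ℝ, Z) f z :=
      (hf.contMDiffAt (hU.mem_nhds hz)).mdifferentiableAt (by simp)
    have h2 := (L.hasFDerivAt (x := f z)).hasMFDerivAt.comp z h1.hasMFDerivAt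
    rw [h2.mfderiv]
    exact L.surjective.comp (hs z hz)

lemma finrank_le_of_surjective_mfderiv {f : X → X'} {x : X}
    (h : Function.Surjective (mfderiv I I' f x)) :
    Module.finrank ℝ V' ≤ Module.finrank ℝ V := by
  let L : V →L[ℝ] V' := mfderiv I I' f x
  exact LinearMap.finrank_le_finrank_of_surjective (f := (L : V →ₗ[ℝ] V')) h

lemma exists_isSubmanifoldAt_of_submersion {Z : Type*} [NormedAddCommGroup Z] [NormedSpace ℝ Z]
    [FiniteDimensional ℝ Z] {S U : Set X} {x : X} (hU : IsOpen U) (hx : x ∈ U) {f : X → Z}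
    (hf : ContMDiffOn I 𝓘(ℝ, Z) ∞ f U) (hS : ∀ z ∈ U, z ∈ S ↔ f z = 0)
    (hs : ∀ z ∈ U, Function.Surjective (mfderiv I 𝓘(ℝ, Z) f z)) :
    ∃ d, IsSubmanifoldAt I S d x :=
  ⟨_, isSubmanifoldAt_of_submersion hU hx hf hS hs
    (Nat.add_sub_cancel' (finrank_le_of_surjective_mfderiv (hs x hx)))⟩

lemma exists_isSubmanifoldAt_of_isOpen {S : Set X} {x : X} (hS : IsOpen S) (hx : x ∈ S) :
    ∃ d, IsSubmanifoldAt I S d x := by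
  refine exists_isSubmanifoldAt_of_submersion (Z := EuclideanSpace ℝ (Fin 0)) hS hx
    (f := fun _ => 0) contMDiffOn_const (fun z hz => by simp [hz]) fun z _ v => ⟨0, ?_⟩
  exact Subsingleton.elim (α := EuclideanSpace ℝ (Fin 0)) _ _

/-- The preimage of a submanifold under a submersion. -/
lemma exists_isSubmanifoldAt_preimage {S O : Set X} {S' : Set X'} {x : X} {g : X → X'}
    (hO : IsOpen O) (hx : x ∈ O) (hg : ContMDiffOn I I' ∞ g O)
    (hgs : ∀ z ∈ O, Function.Surjective (mfderiv I I' g z))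
    (hS : ∀ z ∈ O, z ∈ S ↔ g z ∈ S') (hS' : ∃ d, IsSubmanifoldAt I' S' d (g x)) :
    ∃ d, IsSubmanifoldAt I S d x := by
  obtain ⟨d, U, hU, hxU, c, hc, f, hf, hfS, hfs⟩ := hS'
  refine exists_isSubmanifoldAt_of_submersion (f := f ∘ g)
    (hg.continuousOn.isOpen_inter_preimage hO hU) ⟨hx, hxU⟩
    (hf.comp (hg.mono inter_subset_left) fun z hz => hz.2) (fun z hz => ?_) fun z hz => ?_
  · rw [hS z hz.1]
    have := Set.ext_iff.1 hfS (g z)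
    constructor
    · intro h
      exact (this.1 ⟨h, hz.2⟩).2
    · intro h
      exact (this.2 ⟨hz.2, h⟩).1
  · have h1 : MDifferentiableAt I I' g z :=
      (hg.contMDiffAt (hO.mem_nhds hz.1)).mdifferentiableAt (by simp)
    have h2 : MDifferentiableAt I' 𝓘(ℝ, EuclideanSpace ℝ (Fin c)) f (g z) :=
      (hf.contMDiffAt (hU.mem_nhds hz.2)).mdifferentiableAt (by simp)
    rw [(h2.hasMFDerivAt.comp z h1.hasMFDerivAt).mfderiv]
    exact (hfs _ hz.2).comp (hgs z hz.1)

/-- A map with a local right inverse is a submersion. -/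
lemma surjective_mfderiv_of_rightInverse {g : X → X'} {s : X' → X} {z : X}
    (hg : MDifferentiableAt I I' g z) (hs : MDifferentiableAt I' I s (g z)) (hz : s (g z) = z)
    (h : ∀ᶠ w in 𝓝 (g z), g (s w) = w) : Function.Surjective (mfderiv I I' g z) := by
  have h1 : HasMFDerivAt I' I' (g ∘ s) (g z)
      ((mfderiv I I' g (s (g z))).comp (mfderiv I' I s (g z))) :=
    HasMFDerivAt.comp (g z) (by rw [hz]; exact hg.hasMFDerivAt) hs.hasMFDerivAt
  have h2 : HasMFDerivAt I' I' (g ∘ s) (g z) (ContinuousLinearMap.id ℝ (TangentSpace I' (g z))) :=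
    (hasMFDerivAt_id (g z)).congr_of_eventuallyEq h
  have h3 := hasMFDerivAt_unique h1 h2
  rw [hz] at h3
  intro w
  exact ⟨mfderiv I' I s (g z) w, congrArg (fun L => L w) h3⟩

lemma IsSmoothChart.exists_isSubmanifoldAt {κ : OpenPartialHomeomorph X V'}
    (hκ : IsSmoothChart I κ) {S : Set X} {S' : Set V'} {x : X} (hx : x ∈ κ.source)
    (hS : ∀ z ∈ κ.source, z ∈ S ↔ κ z ∈ S') (hS' : ∃ d, IsSubmanifoldAt 𝓘(ℝ, V') S' d (κ x)) :
    ∃ d, IsSubmanifoldAt I S d x :=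
  exists_isSubmanifoldAt_preimage κ.open_source hx hκ.smooth
    (fun _ hz => (hκ.tangentEquiv hz).surjective) hS hS'

/-- The manifold is covered by smooth charts with values in `V'`. -/
def HasSmoothCharts (I : ModelWithCorners ℝ V H) (X : Type*) [TopologicalSpace X]
    [ChartedSpace H X] (V' : Type*) [NormedAddCommGroup V'] [NormedSpace ℝ V'] : Prop :=
  ∀ x : X, ∃ κ : OpenPartialHomeomorph X V', x ∈ κ.source ∧ IsSmoothChart I κ

omit [FiniteDimensional ℝ V'] in
lemma hasSmoothCharts_self : HasSmoothCharts 𝓘(ℝ, V') V' V' := fun x =>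
  ⟨OpenPartialHomeomorph.refl V', mem_univ x, ⟨contMDiffOn_id, contMDiffOn_id⟩⟩

lemma HasSmoothCharts.prod {Z Z' : Type*} [NormedAddCommGroup Z] [NormedSpace ℝ Z]
    [NormedAddCommGroup Z'] [NormedSpace ℝ Z'] (h : HasSmoothCharts I X Z)
    (h' : HasSmoothCharts I' X' Z') : HasSmoothCharts (I.prod I') (X × X') (Z × Z') := by
  rintro ⟨x, x'⟩
  obtain ⟨κ, hx, hκ⟩ := h x
  obtain ⟨κ', hx', hκ'⟩ := h' x'
  refine ⟨κ.prod κ', ⟨hx, hx'⟩, ?_, ?_⟩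
  · rw [modelWithCornersSelf_prod, ← chartedSpaceSelf_prod]
    exact hκ.smooth.prodMap hκ'.smooth
  · rw [modelWithCornersSelf_prod, ← chartedSpaceSelf_prod]
    exact hκ.smooth_symm.prodMap hκ'.smooth_symm

/-- The graph of a smooth map over a submanifold. -/
lemma exists_isSubmanifoldAt_graph {Z : Type*} [NormedAddCommGroup Z] [NormedSpace ℝ Z]
    [FiniteDimensional ℝ Z] (hX' : HasSmoothCharts I' X' Z) {S O : Set X} {x : X} {B : X → X'}
    (hO : IsOpen O) (hx : x ∈ O) (hB : ContMDiffOn I I' ∞ B O)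
    (hS : ∃ d, IsSubmanifoldAt I S d x) :
    ∃ d, IsSubmanifoldAt (I.prod I') {P : X × X' | P.1 ∈ S ∧ P.2 = B P.1} d (x, B x) := by
  obtain ⟨d, U, hU, hxU, c, hc, f, hf, hfS, hfs⟩ := hS
  obtain ⟨κ, hxκ, hκ⟩ := hX' (B x)
  let O' : Set X := O ∩ B ⁻¹' κ.source
  have hO' : IsOpen O' := hB.continuousOn.isOpen_inter_preimage hO κ.open_source
  have hκB : ContMDiffOn I 𝓘(ℝ, Z) ∞ (κ ∘ B) O' :=
    hκ.smooth.comp (hB.mono inter_subset_left) fun z hz => hz.2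
  -- The graph condition is written as a difference in a chart around B(x). The derivative is
  -- triangular, so surjectivity follows from that of df and of the differential of the chart.
  let F : X × X' → EuclideanSpace ℝ (Fin c) × Z := fun P => (f P.1, κ P.2 - κ (B P.1))
  have hF : ContMDiffOn (I.prod I') 𝓘(ℝ, EuclideanSpace ℝ (Fin c) × Z) ∞ F
      ((U ∩ O') ×ˢ κ.source) := by
    rw [modelWithCornersSelf_prod, ← chartedSpaceSelf_prod]
    exact (hf.comp contMDiffOn_fst fun P hP => hP.1.1).prodMk
      ((hκ.smooth.comp contMDiffOn_snd fun P hP => hP.2).sub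
        (hκB.comp contMDiffOn_fst fun P hP => hP.1.2))
  refine exists_isSubmanifoldAt_of_submersion (f := F) ((hU.inter hO').prod κ.open_source)
    ⟨⟨hxU, hx, hxκ⟩, hxκ⟩ hF ?_ ?_
  · rintro ⟨z, w⟩ ⟨hz, hw⟩
    have h1 := Set.ext_iff.1 hfS z
    constructor
    · rintro ⟨h2, h3⟩
      simp only at h2 h3
      simp only [F, h3, sub_self, (h1.1 ⟨h2, hz.1⟩).2, Prod.mk_eq_zero, and_self]
    · intro h2
      simp only [F, Prod.mk_eq_zero, sub_eq_zero] at h2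
      exact ⟨(h1.2 ⟨hz.1, h2.1⟩).1, κ.injOn hw hz.2.2 h2.2⟩
  · rintro ⟨z, w⟩ ⟨hz, hw⟩
    have d1 : HasMFDerivAt I 𝓘(ℝ, EuclideanSpace ℝ (Fin c)) f z (mfderiv I _ f z) :=
      ((hf.contMDiffAt (hU.mem_nhds hz.1)).mdifferentiableAt (by simp)).hasMFDerivAt
    have d2 : HasMFDerivAt I 𝓘(ℝ, Z) (κ ∘ B) z (mfderiv I _ (κ ∘ B) z) :=
      ((hκB.contMDiffAt (hO'.mem_nhds hz.2)).mdifferentiableAt (by simp)).hasMFDerivAt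
    have d3 : HasMFDerivAt I' 𝓘(ℝ, Z) κ w (mfderiv I' _ κ w) :=
      (hκ.mdifferentiableAt hw).hasMFDerivAt
    have e1 := d1.comp (f := (Prod.fst : X × X' → X)) (z, w) (hasMFDerivAt_fst (I := I) (I' := I') (z, w))
    have e2 := d2.comp (f := (Prod.fst : X × X' → X)) (z, w) (hasMFDerivAt_fst (I := I) (I' := I') (z, w))
    have e3 := d3.comp (f := (Prod.snd : X × X' → X')) (z, w) (hasMFDerivAt_snd (I := I) (I' := I') (z, w))
    have e4 := hasMFDerivAt_prodMk_space e1 (e3.sub e2)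
    have e5 : HasMFDerivAt (I.prod I') 𝓘(ℝ, EuclideanSpace ℝ (Fin c) × Z) F (z, w) _ := e4
    rw [e5.mfderiv]
    rintro ⟨a, b⟩
    obtain ⟨u, hu⟩ := hfs z hz.1 a
    let D : V →L[ℝ] Z := mfderiv I 𝓘(ℝ, Z) (κ ∘ B) z
    let D' : V' →L[ℝ] Z := mfderiv I' 𝓘(ℝ, Z) κ w
    obtain ⟨v, hv⟩ := (hκ.tangentEquiv hw).surjective (b + D u)
    refine ⟨(u, v), ?_⟩
    refine Prod.ext hu ?_
    change D' v - D u = b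
    exact sub_eq_of_eq_add hv

lemma exists_isSubmanifoldAt_prod {S : Set X} {S' : Set X'} {x : X} {x' : X'}
    (hS : ∃ d, IsSubmanifoldAt I S d x) (hS' : ∃ d, IsSubmanifoldAt I' S' d x') :
    ∃ d, IsSubmanifoldAt (I.prod I') (S ×ˢ S') d (x, x') := by
  obtain ⟨d, U, hU, hxU, c, hc, f, hf, hfS, hfs⟩ := hS
  obtain ⟨d', U', hU', hxU', c', hc', f', hf', hfS', hfs'⟩ := hS'
  let F : X × X' → EuclideanSpace ℝ (Fin c) × EuclideanSpace ℝ (Fin c') :=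
    fun P => (f P.1, f' P.2)
  have hF : ContMDiffOn (I.prod I') 𝓘(ℝ, EuclideanSpace ℝ (Fin c) × EuclideanSpace ℝ (Fin c')) ∞ F
      (U ×ˢ U') := by
    rw [modelWithCornersSelf_prod, ← chartedSpaceSelf_prod]
    exact hf.prodMap hf'
  refine exists_isSubmanifoldAt_of_submersion (f := F) (hU.prod hU') ⟨hxU, hxU'⟩ hF ?_ ?_
  · rintro ⟨z, w⟩ ⟨hz, hw⟩
    have h1 := Set.ext_iff.1 hfS z
    have h2 := Set.ext_iff.1 hfS' w
    simp only [mem_inter_iff, mem_ofPred_eq, hz, and_true, true_and, hw] at h1 h2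
    simp only [F, Prod.mk_eq_zero, mem_prod, h1, h2]
  · rintro ⟨z, w⟩ ⟨hz, hw⟩
    have d1 := ((hf.contMDiffAt (hU.mem_nhds hz)).mdifferentiableAt (by simp)).hasMFDerivAt
    have d2 := ((hf'.contMDiffAt (hU'.mem_nhds hw)).mdifferentiableAt (by simp)).hasMFDerivAt
    have e1 := d1.comp (f := (Prod.fst : X × X' → X)) (z, w) (hasMFDerivAt_fst (I := I) (I' := I') (z, w))
    have e2 := d2.comp (f := (Prod.snd : X × X' → X')) (z, w) (hasMFDerivAt_snd (I := I) (I' := I') (z, w))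
    have e5 : HasMFDerivAt (I.prod I')
      𝓘(ℝ, EuclideanSpace ℝ (Fin c) × EuclideanSpace ℝ (Fin c')) F (z, w) _ := hasMFDerivAt_prodMk_space e1 e2
    rw [e5.mfderiv]
    rintro ⟨a, b⟩
    obtain ⟨u, hu⟩ := hfs z hz a
    obtain ⟨v, hv⟩ := hfs' w hw b
    exact ⟨(u, v), Prod.ext hu hv⟩

/-- A subset that is, in the coordinates `(g, A)`, the graph of a smooth map `B` over a
submanifold. -/
lemma exists_isSubmanifoldAt_of_graph {V'' : Type*} [NormedAddCommGroup V''] [NormedSpace ℝ V'']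
    [FiniteDimensional ℝ V''] {H'' : Type*} [TopologicalSpace H''] {J : ModelWithCorners ℝ V'' H''}
    {N : Type*} [TopologicalSpace N] [ChartedSpace H'' N]
    {Z : Type*} [NormedAddCommGroup Z] [NormedSpace ℝ Z] [FiniteDimensional ℝ Z]
    (hN : HasSmoothCharts J N Z) {S : Set X} {S' O : Set X'} {x : X} {g : X → X'} {A : X → N}
    {B : X' → N} {s : X' × N → X} (hg : ContMDiff I I' ∞ g) (hA : ContMDiff I J ∞ A)
    (hs : ContMDiff (I'.prod J) I ∞ s) (hs1 : ∀ z, s (g z, A z) = z)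
    (hs2 : ∀ w, (g (s w), A (s w)) = w) (hO : IsOpen O) (hx : g x ∈ O)
    (hB : ContMDiffOn I' J ∞ B O) (hxB : A x = B (g x)) (hS' : ∃ d, IsSubmanifoldAt I' S' d (g x))
    (hS : ∀ z, z ∈ S ↔ g z ∈ S' ∧ A z = B (g z)) : ∃ d, IsSubmanifoldAt I S d x := by
  have h := exists_isSubmanifoldAt_graph hN hO hx hB hS'
  rw [← hxB] at h
  have hgA : ContMDiff I (I'.prod J) ∞ (fun z => (g z, A z)) := hg.prodMk hA
  refine exists_isSubmanifoldAt_preimage (g := fun z => (g z, A z)) isOpen_univ (mem_univ x)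
    hgA.contMDiffOn (fun z _ => ?_) (fun z _ => hS z) h
  exact surjective_mfderiv_of_rightInverse (hgA.mdifferentiable (by simp) z)
    (hs.mdifferentiable (by simp) _) (hs1 z) (Filter.Eventually.of_forall hs2)

end SubmanifoldConstructions

/-! ### The charts of the cotangent bundle induced by charts of the manifold -/

section CotangentCharts

variable {n : ℕ} {M : Type*} [TopologicalSpace M] [ChartedSpace (EuclideanSpace ℝ (Fin n)) M]
  [IsManifold (𝓡 n) ∞ M]
  {V : Type*} [NormedAddCommGroup V] [NormedSpace ℝ V]
  {V' : Type*} [NormedAddCommGroup V'] [NormedSpace ℝ V']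

/-- The fibre coordinate of a covector, in the preferred trivialization at its base point. -/
def covec (ξ : Cot n M) : EuclideanSpace ℝ (Fin n) →L[ℝ] ℝ := ξ.snd

/-- The differential of a chart of `M`. -/
def dChart (κ : OpenPartialHomeomorph M V) (x : M) : EuclideanSpace ℝ (Fin n) →L[ℝ] V :=
  mfderiv (𝓡 n) 𝓘(ℝ, V) κ x

/-- The differential of the inverse of a chart of `M`. -/
def dChartSymm (n : ℕ) {M : Type*} [TopologicalSpace M]
    [ChartedSpace (EuclideanSpace ℝ (Fin n)) M]
    (κ : OpenPartialHomeomorph M V) (z : V) : V →L[ℝ] EuclideanSpace ℝ (Fin n) :=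
  mfderiv 𝓘(ℝ, V) (𝓡 n) κ.symm z

lemma isSmoothChart_chartAt (x₀ : M) :
    IsSmoothChart (𝓡 n) (chartAt (EuclideanSpace ℝ (Fin n)) x₀) :=
  ⟨contMDiffOn_chart, contMDiffOn_chart_symm⟩

namespace IsSmoothChart

variable {κ : OpenPartialHomeomorph M V} (hκ : IsSmoothChart (𝓡 n) κ)
  {c : OpenPartialHomeomorph M V'} (hc : IsSmoothChart (𝓡 n) c)
include hκ

lemma dChartSymm_dChart {x : M} (hx : x ∈ κ.source) (v : EuclideanSpace ℝ (Fin n)) :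
    dChartSymm n κ (κ x) (dChart κ x v) = v := hκ.mfderiv_symm_mfderiv hx v

lemma dChart_dChartSymm {x : M} (hx : x ∈ κ.source) (v : V) :
    dChart κ x (dChartSymm n κ (κ x) v) = v := (hκ.tangentEquiv hx).right_inv v

include hc

lemma hasFDerivAt_transition {x : M} (hx : x ∈ κ.source) (hx' : x ∈ c.source) :
    HasFDerivAt (κ ∘ c.symm) (dChart κ x ∘L dChartSymm n c (c x)) (c x) := by
  have h1 : MDifferentiableAt (𝓡 n) 𝓘(ℝ, V) κ (c.symm (c x)) := by
    rw [c.left_inv hx']; exact hκ.mdifferentiableAt hx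
  have h2 := h1.hasMFDerivAt.comp (c x)
    (hc.mdifferentiableAt_symm (c.map_source hx')).hasMFDerivAt
  have h3 := h2.hasFDerivAt
  have h4 : c.symm (c x) = x := c.left_inv hx'
  refine h3.congr_fderiv ?_
  change (dChart κ (c.symm (c x))).comp _ = (dChart κ x).comp _
  rw [h4]
  rfl

lemma contDiffOn_transition :
    ContDiffOn ℝ ∞ (κ ∘ c.symm) (c.target ∩ c.symm ⁻¹' κ.source) :=
  contMDiffOn_iff_contDiffOn.1 (hκ.smooth.comp (hc.smooth_symm.mono inter_subset_left)
    fun _ hz => hz.2)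

lemma contDiffOn_fderiv_transition :
    ContDiffOn ℝ ∞ (fderiv ℝ (κ ∘ c.symm)) (c.target ∩ c.symm ⁻¹' κ.source) :=
  (hκ.contDiffOn_transition hc).fderiv_of_isOpen
    (c.symm.isOpen_inter_preimage κ.open_source) (by norm_num)

end IsSmoothChart

/-- The coordinates of a covector induced by a chart of the manifold. -/
def cotCoord (κ : OpenPartialHomeomorph M V) (ξ : Cot n M) : V × (V →L[ℝ] ℝ) :=
  (κ ξ.proj, covec ξ ∘L dChartSymm n κ (κ ξ.proj))

/-- The covector with given coordinates. -/
def cotCoordSymm (n : ℕ) {M : Type*} [TopologicalSpace M]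
    [ChartedSpace (EuclideanSpace ℝ (Fin n)) M] [IsManifold (𝓡 n) ∞ M]
    (κ : OpenPartialHomeomorph M V) (P : V × (V →L[ℝ] ℝ)) : Cot n M :=
  ⟨κ.symm P.1, P.2 ∘L dChart κ (κ.symm P.1)⟩

/-- The bundle of homomorphisms is trivialized by precomposing with the inverse trivialization of
the tangent bundle, which is the derivative of the inverse chart. This identifies the bundle charts
of the cotangent bundle with the classical canonical coordinates used from here on. -/
lemma trivializationAt_cot {x₀ : M} {ξ : Cot n M}
    (h : ξ.proj ∈ (chartAt (EuclideanSpace ℝ (Fin n)) x₀).source) :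
    trivializationAt (EuclideanSpace ℝ (Fin n) →L[ℝ] ℝ)
      (fun x : M => TangentSpace (𝓡 n) x →L[ℝ] ℝ) x₀ ξ = (ξ.proj,
        covec ξ ∘L dChartSymm n (chartAt (EuclideanSpace ℝ (Fin n)) x₀)
          (chartAt (EuclideanSpace ℝ (Fin n)) x₀ ξ.proj)) := by
  have : IsManifold (𝓡 n) 1 M := IsManifold.of_le (n := ∞) (by exact_mod_cast le_top)
  refine (hom_trivializationAt_apply (RingHom.id ℝ) x₀ ξ).trans ?_
  refine Prod.ext rfl ?_
  ext v
  have h1 := TangentBundle.symmL_trivializationAt (I := 𝓡 n) (𝕜 := ℝ) h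
  have h2 : (mfderivWithin 𝓘(ℝ, EuclideanSpace ℝ (Fin n)) (𝓡 n)
    (extChartAt (𝓡 n) x₀).symm (range (𝓡 n)) (extChartAt (𝓡 n) x₀ ξ.proj)) =
      mfderiv 𝓘(ℝ, EuclideanSpace ℝ (Fin n)) (𝓡 n)
    (extChartAt (𝓡 n) x₀).symm (extChartAt (𝓡 n) x₀ ξ.proj) := by
    rw [modelWithCornersSelf_coe, range_id, mfderivWithin_univ]
  rw [h2] at h1
  have h3 : (Trivialization.symmL ℝ (trivializationAt (EuclideanSpace ℝ (Fin n))
    (TangentSpace (𝓡 n)) x₀) ξ.proj) v = dChartSymm n (chartAt (EuclideanSpace ℝ (Fin n)) x₀)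
          (chartAt (EuclideanSpace ℝ (Fin n)) x₀ ξ.proj) v := by
    rw [h1]
    simp only [mfld_simps]
    rfl
  refine Eq.trans ?_ (congrArg (covec ξ) h3)
  change ContinuousLinearMap.inCoordinates (EuclideanSpace ℝ (Fin n)) (TangentSpace (𝓡 n)) ℝ
    (fun _ : M => ℝ) x₀ ξ.proj x₀ ξ.proj ξ.snd v = _
  unfold ContinuousLinearMap.inCoordinates
  simp
  rfl

lemma extChartAt_cot {ξ₀ ξ : Cot n M}
    (h : ξ.proj ∈ (chartAt (EuclideanSpace ℝ (Fin n)) ξ₀.proj).source) :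
    extChartAt (cotModel n) ξ₀ ξ =
      cotCoord (chartAt (EuclideanSpace ℝ (Fin n)) ξ₀.proj) ξ := by
  have h1 := trivializationAt_cot h
  have h2 : extChartAt (cotModel n) ξ₀ ξ =
    (chartAt (EuclideanSpace ℝ (Fin n)) ξ₀.proj (trivializationAt (EuclideanSpace ℝ (Fin n) →L[ℝ] ℝ)
      (fun x : M => TangentSpace (𝓡 n) x →L[ℝ] ℝ) ξ₀.proj ξ).1,
      (trivializationAt (EuclideanSpace ℝ (Fin n) →L[ℝ] ℝ)
      (fun x : M => TangentSpace (𝓡 n) x →L[ℝ] ℝ) ξ₀.proj ξ).2) := rfl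
  rw [h2, h1]
  rfl

lemma cotCoord_snd_transition {κ : OpenPartialHomeomorph M V} (hκ : IsSmoothChart (𝓡 n) κ)
    {c : OpenPartialHomeomorph M V'} (hc : IsSmoothChart (𝓡 n) c) {ξ : Cot n M}
    (h : ξ.proj ∈ κ.source) (h' : ξ.proj ∈ c.source) :
    (cotCoord κ ξ).2 = (cotCoord c ξ).2 ∘L fderiv ℝ (c ∘ κ.symm) (κ ξ.proj) := by
  rw [(hc.hasFDerivAt_transition hκ h' h).fderiv]
  ext v
  exact congrArg (covec ξ) (hc.dChartSymm_dChart h' _).symm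

lemma contMDiff_cot_proj : ContMDiff (cotModel n) (𝓡 n) ∞ (fun ξ : Cot n M => ξ.proj) :=
  Bundle.contMDiff_proj _

lemma IsSmoothChart.contMDiffOn_cotCoord {κ : OpenPartialHomeomorph M V}
    (hκ : IsSmoothChart (𝓡 n) κ) :
    ContMDiffOn (cotModel n) 𝓘(ℝ, V × (V →L[ℝ] ℝ)) ∞ (cotCoord κ)
      ((fun ξ : Cot n M => ξ.proj) ⁻¹' κ.source) := by
  intro ξ₀ hξ₀
  let c := chartAt (EuclideanSpace ℝ (Fin n)) ξ₀.proj
  have hc : IsSmoothChart (𝓡 n) c := isSmoothChart_chartAt _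
  have hc₀ : ξ₀.proj ∈ c.source := mem_chart_source _ _
  have hproj := contMDiff_cot_proj (n := n) (M := M)
  have h1 : ContMDiffAt (cotModel n) 𝓘(ℝ, V) ∞ (fun ξ : Cot n M => κ ξ.proj) ξ₀ :=
    (hκ.contMDiffAt hξ₀).comp ξ₀ (hproj ξ₀)
  have h2 := (Bundle.contMDiffAt_totalSpace.1 (contMDiffAt_id (I := cotModel n) (n := ∞)
    (x := ξ₀))).2
  have h3 : ContMDiffAt (cotModel n) 𝓘(ℝ, V →L[ℝ] EuclideanSpace ℝ (Fin n)) ∞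
      (fun ξ : Cot n M => fderiv ℝ (c ∘ κ.symm) (κ ξ.proj)) ξ₀ := by
    have h4 := (hc.contDiffOn_fderiv_transition hκ).contDiffAt (x := κ ξ₀.proj)
      ((κ.symm.isOpen_inter_preimage c.open_source).mem_nhds
        ⟨κ.map_source hξ₀, by simpa [κ.left_inv hξ₀] using hc₀⟩)
    exact h4.contMDiffAt.comp ξ₀ h1
  have h4 := h2.clm_comp h3
  have h5 : ContMDiffAt (cotModel n) 𝓘(ℝ, V →L[ℝ] ℝ) ∞
      (fun ξ : Cot n M => (cotCoord κ ξ).2) ξ₀ := by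
    refine h4.congr_of_eventuallyEq ?_
    filter_upwards [hproj.continuous.continuousAt.preimage_mem_nhds (κ.open_source.mem_nhds hξ₀),
      hproj.continuous.continuousAt.preimage_mem_nhds (c.open_source.mem_nhds hc₀)] with ξ h6 h7
    rw [cotCoord_snd_transition hκ hc h6 h7]
    have h8 := congrArg Prod.snd (trivializationAt_cot (ξ := ξ) (x₀ := ξ₀.proj) h7)
    exact congrArg (fun L : EuclideanSpace ℝ (Fin n) →L[ℝ] ℝ =>
      L ∘L fderiv ℝ (c ∘ κ.symm) (κ ξ.proj)) h8.symm
  exact (h1.prodMk_space h5).contMDiffWithinAt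

lemma IsSmoothChart.contMDiffOn_cotCoordSymm {κ : OpenPartialHomeomorph M V}
    (hκ : IsSmoothChart (𝓡 n) κ) :
    ContMDiffOn 𝓘(ℝ, V × (V →L[ℝ] ℝ)) (cotModel n) ∞ (cotCoordSymm n κ) (κ.target ×ˢ univ) := by
  rintro P₀ ⟨hP₀, -⟩
  let c := chartAt (EuclideanSpace ℝ (Fin n)) (κ.symm P₀.1)
  have hc : IsSmoothChart (𝓡 n) c := isSmoothChart_chartAt _
  have hc₀ : κ.symm P₀.1 ∈ c.source := mem_chart_source _ _
  have h1 : ContMDiffAt 𝓘(ℝ, V × (V →L[ℝ] ℝ)) (𝓡 n) ∞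
      (fun P : V × (V →L[ℝ] ℝ) => κ.symm P.1) P₀ :=
    (hκ.contMDiffAt_symm hP₀).comp P₀ contDiff_fst.contMDiff.contMDiffAt
  have h3 : ContMDiffAt 𝓘(ℝ, V × (V →L[ℝ] ℝ)) 𝓘(ℝ, EuclideanSpace ℝ (Fin n) →L[ℝ] V) ∞
      (fun P : V × (V →L[ℝ] ℝ) => fderiv ℝ (κ ∘ c.symm) (c (κ.symm P.1))) P₀ := by
    have h4 := (hκ.contDiffOn_fderiv_transition hc).contDiffAt (x := c (κ.symm P₀.1))
      ((c.symm.isOpen_inter_preimage κ.open_source).mem_nhds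
        ⟨c.map_source hc₀, by simpa [c.left_inv hc₀] using κ.map_target hP₀⟩)
    exact h4.contMDiffAt.comp P₀ ((hc.contMDiffAt hc₀).comp P₀ h1)
  have h2 : ContMDiffAt 𝓘(ℝ, V × (V →L[ℝ] ℝ)) 𝓘(ℝ, V →L[ℝ] ℝ) ∞
    (fun P : V × (V →L[ℝ] ℝ) => P.2) P₀ := contDiff_snd.contMDiff.contMDiffAt
  refine ContMDiffAt.contMDiffWithinAt (Bundle.contMDiffAt_totalSpace.2 ⟨h1, ?_⟩)
  refine (h2.clm_comp h3).congr_of_eventuallyEq ?_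
  have hκ1 : ∀ᶠ P : V × (V →L[ℝ] ℝ) in 𝓝 P₀, P.1 ∈ κ.target :=
    continuous_fst.continuousAt.preimage_mem_nhds (κ.open_target.mem_nhds hP₀)
  filter_upwards [hκ1, h1.continuousAt.preimage_mem_nhds (c.open_source.mem_nhds hc₀)] with P h6 h7
  have h8 := congrArg Prod.snd (trivializationAt_cot (ξ := cotCoordSymm n κ P)
    (x₀ := κ.symm P₀.1) h7)
  refine h8.trans ?_
  rw [(hκ.hasFDerivAt_transition hc (κ.map_target h6) h7).fderiv]
  rfl

lemma IsSmoothChart.cotCoord_cotCoordSymm {κ : OpenPartialHomeomorph M V}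
    (hκ : IsSmoothChart (𝓡 n) κ) {P : V × (V →L[ℝ] ℝ)} (hP : P.1 ∈ κ.target) :
    cotCoord κ (cotCoordSymm n κ P) = P := by
  refine Prod.ext (κ.right_inv hP) ?_
  ext v
  exact congrArg P.2 (hκ.dChart_dChartSymm (κ.map_target hP) v)

lemma IsSmoothChart.cotCoordSymm_cotCoord {κ : OpenPartialHomeomorph M V}
    (hκ : IsSmoothChart (𝓡 n) κ) {ξ : Cot n M} (hξ : ξ.proj ∈ κ.source) :
    cotCoordSymm n κ (cotCoord κ ξ) = ξ := by
  refine Bundle.TotalSpace.ext (κ.left_inv hξ) ?_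
  have h1 : (cotCoord κ ξ).2 ∘L dChart κ (κ.symm (κ ξ.proj)) = covec ξ := by
    rw [κ.left_inv hξ]
    ext v
    exact congrArg (covec ξ) (hκ.dChartSymm_dChart hξ v)
  exact heq_of_eq h1

/-- The chart of the cotangent bundle induced by a chart of the manifold. -/
def IsSmoothChart.cotLift {κ : OpenPartialHomeomorph M V} (hκ : IsSmoothChart (𝓡 n) κ) :
    OpenPartialHomeomorph (Cot n M) (V × (V →L[ℝ] ℝ)) where
  toFun := cotCoord κ
  invFun := cotCoordSymm n κ
  source := (fun ξ : Cot n M => ξ.proj) ⁻¹' κ.source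
  target := κ.target ×ˢ univ
  map_source' := fun _ hξ => ⟨κ.map_source hξ, mem_univ _⟩
  map_target' := fun _ hP => κ.map_target hP.1
  left_inv' := fun _ hξ => hκ.cotCoordSymm_cotCoord hξ
  right_inv' := fun _ hP => hκ.cotCoord_cotCoordSymm hP.1
  open_source := κ.open_source.preimage contMDiff_cot_proj.continuous
  open_target := κ.open_target.prod isOpen_univ
  continuousOn_toFun := hκ.contMDiffOn_cotCoord.continuousOn
  continuousOn_invFun := hκ.contMDiffOn_cotCoordSymm.continuousOn

lemma IsSmoothChart.isSmoothChart_cotLift {κ : OpenPartialHomeomorph M V}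
    (hκ : IsSmoothChart (𝓡 n) κ) : IsSmoothChart (cotModel n) hκ.cotLift :=
  ⟨hκ.contMDiffOn_cotCoord, hκ.contMDiffOn_cotCoordSymm⟩

lemma hasSmoothCharts_cot : HasSmoothCharts (cotModel n) (Cot n M)
    (EuclideanSpace ℝ (Fin n) × (EuclideanSpace ℝ (Fin n) →L[ℝ] ℝ)) := fun ξ =>
  ⟨(isSmoothChart_chartAt ξ.proj).cotLift, mem_chart_source (EuclideanSpace ℝ (Fin n)) ξ.proj,
    (isSmoothChart_chartAt ξ.proj).isSmoothChart_cotLift⟩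

/-- Uniqueness of integral curves in the cotangent bundle needs it to be Hausdorff. Covectors over
one point are separated in an induced chart, the others by their base points. -/
instance [T2Space M] : T2Space (Cot n M) := by
  refine ⟨fun ξ η hne => ?_⟩
  have hc : Continuous (fun ξ : Cot n M => ξ.proj) := contMDiff_cot_proj.continuous
  by_cases h : ξ.proj = η.proj
  · let e := (isSmoothChart_chartAt (n := n) ξ.proj).cotLift
    have h1 : ξ ∈ e.source := mem_chart_source (EuclideanSpace ℝ (Fin n)) ξ.proj
    have h2 : η ∈ e.source := by
      change η.proj ∈ (chartAt (EuclideanSpace ℝ (Fin n)) ξ.proj).source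
      rw [← h]; exact h1
    obtain ⟨u, v, hu, hv, hxu, hyv, huv⟩ := t2_separation (fun h3 => hne (e.injOn h1 h2 h3))
    exact ⟨e.source ∩ e ⁻¹' u, e.source ∩ e ⁻¹' v, e.isOpen_inter_preimage hu,
      e.isOpen_inter_preimage hv, ⟨h1, hxu⟩, ⟨h2, hyv⟩,
      (huv.preimage e).mono inter_subset_right inter_subset_right⟩
  · obtain ⟨u, v, hu, hv, hxu, hyv, huv⟩ := t2_separation h
    exact ⟨_, _, hu.preimage hc, hv.preimage hc, hxu, hyv, huv.preimage _⟩

end CotangentCharts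

/-! ### The symplectic form in induced charts -/

section Symplectic

set_option synthInstance.maxHeartbeats 400000

variable {V : Type*} [NormedAddCommGroup V] [NormedSpace ℝ V]
  {V' : Type*} [NormedAddCommGroup V'] [NormedSpace ℝ V']

/-- The canonical symplectic form of `V × V*`, as a map to the dual space. -/
def sympl (V : Type*) [NormedAddCommGroup V] [NormedSpace ℝ V] :
    (V × (V →L[ℝ] ℝ)) →ₗ[ℝ] ((V × (V →L[ℝ] ℝ)) →L[ℝ] ℝ) where
  toFun X := (ContinuousLinearMap.apply ℝ ℝ X.1) ∘L ContinuousLinearMap.snd ℝ V (V →L[ℝ] ℝ) -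
    X.2 ∘L ContinuousLinearMap.fst ℝ V (V →L[ℝ] ℝ)
  map_add' X Y := ContinuousLinearMap.ext fun Z => by
    change Z.2 (X.1 + Y.1) - (X.2 Z.1 + Y.2 Z.1) = (Z.2 X.1 - X.2 Z.1) + (Z.2 Y.1 - Y.2 Z.1)
    rw [map_add]
    ring
  map_smul' r X := ContinuousLinearMap.ext fun Z => by
    change Z.2 (r • X.1) - r • X.2 Z.1 = r • (Z.2 X.1 - X.2 Z.1)
    rw [map_smul, smul_sub]

lemma sympl_apply (X Y : V × (V →L[ℝ] ℝ)) : sympl V X Y = Y.2 X.1 - X.2 Y.1 := rfl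

lemma sympl_injective {X : V × (V →L[ℝ] ℝ)} (hX : sympl V X = 0) : X = 0 := by
  have h (Y : V × (V →L[ℝ] ℝ)) : Y.2 X.1 - X.2 Y.1 = 0 := congrArg (fun L => L Y) hX
  refine Prod.ext ?_ ?_
  · refine SeparatingDual.eq_zero_of_forall_dual_eq_zero (R := ℝ) fun a => ?_
    simpa using h (0, a)
  · ext w
    simpa using h (w, 0)

/-- An injective linear map from a finite-dimensional space to its dual is an isomorphism. -/
def dualEquivOfInjective {W : Type*} [NormedAddCommGroup W] [NormedSpace ℝ W]
    [FiniteDimensional ℝ W] (L : W →ₗ[ℝ] (W →L[ℝ] ℝ)) (hL : ∀ X, L X = 0 → X = 0) :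
    W ≃L[ℝ] (W →L[ℝ] ℝ) :=
  (LinearMap.linearEquivOfInjective L ((injective_iff_map_eq_zero L).2 hL) (by
    rw [← (LinearMap.toContinuousLinearMap (𝕜 := ℝ) (E := W) (F' := ℝ)).finrank_eq]
    exact (Subspace.dual_finrank_eq (K := ℝ) (V := W)).symm)).toContinuousLinearEquiv

/-- The symplectic form of a finite-dimensional space `V × V*` is nondegenerate. -/
def symplEquiv (V : Type*) [NormedAddCommGroup V] [NormedSpace ℝ V] [FiniteDimensional ℝ V] :
    (V × (V →L[ℝ] ℝ)) ≃L[ℝ] ((V × (V →L[ℝ] ℝ)) →L[ℝ] ℝ) :=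
  dualEquivOfInjective (sympl V) fun _ => sympl_injective

lemma symplEquiv_apply [FiniteDimensional ℝ V] (X : V × (V →L[ℝ] ℝ)) :
    symplEquiv V X = sympl V X := rfl

/-- The cotangent lift of a local diffeomorphism preserves the symplectic form. -/
lemma sympl_cotangentLift {f : V → V'} {T : V × (V →L[ℝ] ℝ) → V' × (V' →L[ℝ] ℝ)}
    {L : V × (V →L[ℝ] ℝ) →L[ℝ] V' × (V' →L[ℝ] ℝ)} {P : V × (V →L[ℝ] ℝ)}
    (hf : ContDiffAt ℝ 2 f P.1) (hT : HasFDerivAt T L P) (h1 : ∀ᶠ Q in 𝓝 P, (T Q).1 = f Q.1)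
    (h2 : ∀ᶠ Q in 𝓝 P, (T Q).2 ∘L fderiv ℝ f Q.1 = Q.2) (X Y : V × (V →L[ℝ] ℝ)) :
    sympl V' (L X) (L Y) = sympl V X Y := by
  have hf1 : HasFDerivAt f (fderiv ℝ f P.1) P.1 := (hf.differentiableAt (by simp)).hasFDerivAt
  have hf2 : HasFDerivAt (fderiv ℝ f) (fderiv ℝ (fderiv ℝ f) P.1) P.1 :=
    ((hf.fderiv_right (m := 1) (by norm_num)).differentiableAt (by simp)).hasFDerivAt
  have hL1 : ∀ Z, (L Z).1 = fderiv ℝ f P.1 Z.1 := by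
    have := hT.fst.unique ((hf1.comp P (hasFDerivAt_fst (p := P))).congr_of_eventuallyEq h1)
    exact fun Z => congrArg (fun A => A Z) this
  have hL2 : ∀ Z, (L Z).2 ∘L fderiv ℝ f P.1 + (T P).2 ∘L (fderiv ℝ (fderiv ℝ f) P.1 Z.1) = Z.2 := by
    have h3 := (hT.snd.clm_comp (hf2.comp P (hasFDerivAt_fst (p := P)))).unique
      ((hasFDerivAt_snd (p := P)).congr_of_eventuallyEq h2)
    intro Z
    have h4 := congrArg (fun A => A Z) h3
    rw [add_comm]
    simpa using h4
  -- The derivative of the momentum part involves the second derivative of f. Its two contributions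
  -- to the form cancel by symmetry.
  have hs := hf.isSymmSndFDerivAt (by simp) X.1 Y.1
  have hX := congrArg (fun A => A Y.1) (hL2 X)
  have hY := congrArg (fun A => A X.1) (hL2 Y)
  simp only [add_apply, ContinuousLinearMap.comp_apply] at hX hY
  rw [sympl_apply, sympl_apply, hL1, hL1, ← hX, ← hY, hs]
  ring

end Symplectic

section Hamiltonian

variable {n : ℕ} {M : Type*} [TopologicalSpace M] [ChartedSpace (EuclideanSpace ℝ (Fin n)) M]
  [IsManifold (𝓡 n) ∞ M]
  {V : Type*} [NormedAddCommGroup V] [NormedSpace ℝ V]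

/-- The differential of the coordinates induced by a chart of the manifold. -/
def dCotCoord (κ : OpenPartialHomeomorph M V) (ξ : Cot n M) :
    (EuclideanSpace ℝ (Fin n) × (EuclideanSpace ℝ (Fin n) →L[ℝ] ℝ)) →L[ℝ] V × (V →L[ℝ] ℝ) :=
  mfderiv (cotModel n) 𝓘(ℝ, V × (V →L[ℝ] ℝ)) (cotCoord κ) ξ

/-- The tangent space at ξ is modelled through the preferred chart at ξ, whose differential there is
therefore the identity. This justifies reading `symplecticForm` componentwise. -/
lemma dCotCoord_chartAt (ξ : Cot n M) :
    dCotCoord (chartAt (EuclideanSpace ℝ (Fin n)) ξ.proj) ξ = ContinuousLinearMap.id ℝ _ := by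
  have h1 : cotCoord (chartAt (EuclideanSpace ℝ (Fin n)) ξ.proj) =ᶠ[𝓝 ξ]
      extChartAt (cotModel n) ξ := by
    filter_upwards [contMDiff_cot_proj.continuous.continuousAt.preimage_mem_nhds
      ((chartAt (EuclideanSpace ℝ (Fin n)) ξ.proj).open_source.mem_nhds (mem_chart_source _ _))]
      with η hη
    exact (extChartAt_cot hη).symm
  have h2 := mfderiv_extChartAt_self (𝕜 := ℝ) (I := cotModel n) (x := ξ)
  exact (h1.mfderiv_eq).trans h2

namespace IsSmoothChart

variable {κ : OpenPartialHomeomorph M V} (hκ : IsSmoothChart (𝓡 n) κ)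
include hκ

/-- The change of coordinates between the preferred chart and the chart induced by κ is the
cotangent lift of a transition map, and such lifts are symplectic. -/
lemma symplecticForm_eq {ξ : Cot n M} (hξ : ξ.proj ∈ κ.source)
    (X Y : EuclideanSpace ℝ (Fin n) × (EuclideanSpace ℝ (Fin n) →L[ℝ] ℝ)) :
    sympl V (dCotCoord κ ξ X) (dCotCoord κ ξ Y) = symplecticForm ξ X Y := by
  let c := chartAt (EuclideanSpace ℝ (Fin n)) ξ.proj
  have hc : IsSmoothChart (𝓡 n) c := isSmoothChart_chartAt _
  have hξc : ξ.proj ∈ c.source := mem_chart_source _ _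
  let T : EuclideanSpace ℝ (Fin n) × (EuclideanSpace ℝ (Fin n) →L[ℝ] ℝ) → V × (V →L[ℝ] ℝ) :=
    cotCoord κ ∘ cotCoordSymm n c
  have hP : cotCoord c ξ ∈ hc.cotLift.target := hc.cotLift.map_source hξc
  have hleft : cotCoordSymm n c (cotCoord c ξ) = ξ := hc.cotCoordSymm_cotCoord hξc
  have hκξ : MDifferentiableAt (cotModel n) 𝓘(ℝ, V × (V →L[ℝ] ℝ)) (cotCoord κ) ξ :=
    hκ.isSmoothChart_cotLift.mdifferentiableAt hξ
  have hcξ : MDifferentiableAt (cotModel n) 𝓘(ℝ, EuclideanSpace ℝ (Fin n) ×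
      (EuclideanSpace ℝ (Fin n) →L[ℝ] ℝ)) (cotCoord c) ξ :=
    hc.isSmoothChart_cotLift.mdifferentiableAt hξc
  have hTd : DifferentiableAt ℝ T (cotCoord c ξ) := by
    rw [← mdifferentiableAt_iff_differentiableAt]
    refine MDifferentiableAt.comp (I' := cotModel n) _ ?_
      (hc.isSmoothChart_cotLift.mdifferentiableAt_symm hP)
    change MDifferentiableAt (cotModel n) _ (cotCoord κ) (cotCoordSymm n c (cotCoord c ξ))
    rw [hleft]
    exact hκξ
  have hev : ∀ᶠ Q in 𝓝 (cotCoord c ξ), Q.1 ∈ c.target ∧ c.symm Q.1 ∈ κ.source := by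
    have h1 : IsOpen (c.target ∩ c.symm ⁻¹' κ.source) := c.symm.isOpen_inter_preimage κ.open_source
    refine continuous_fst.continuousAt.preimage_mem_nhds (h1.mem_nhds ⟨hP.1, ?_⟩)
    change c.symm (c ξ.proj) ∈ κ.source
    rwa [c.left_inv hξc]
  have hL : dCotCoord κ ξ = fderiv ℝ T (cotCoord c ξ) := by
    have h1 : cotCoord κ =ᶠ[𝓝 ξ] T ∘ cotCoord c := by
      filter_upwards [hc.cotLift.open_source.mem_nhds hξc] with η hη
      change _ = cotCoord κ (cotCoordSymm n c (cotCoord c η))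
      rw [hc.cotCoordSymm_cotCoord hη]
    have h2 := (hTd.hasFDerivAt.hasMFDerivAt.comp ξ hcξ.hasMFDerivAt).mfderiv
    have h3 := (h1.mfderiv_eq (I := cotModel n) (I' := 𝓘(ℝ, V × (V →L[ℝ] ℝ)))).trans h2
    have h4 : dCotCoord κ ξ = (fderiv ℝ T (cotCoord c ξ)).comp (dCotCoord c ξ) := h3
    rw [h4, dCotCoord_chartAt, ContinuousLinearMap.comp_id]
  rw [hL]
  refine sympl_cotangentLift (f := κ ∘ c.symm) (T := T) (P := cotCoord c ξ) ?_ hTd.hasFDerivAt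
    ?_ ?_ X Y
  · have h1 : IsOpen (c.target ∩ c.symm ⁻¹' κ.source) := c.symm.isOpen_inter_preimage κ.open_source
    exact ((hκ.contDiffOn_transition hc).contDiffAt (h1.mem_nhds hev.self_of_nhds)).of_le
      (WithTop.coe_le_coe.2 (le_top : (2 : ℕ∞) ≤ ⊤))
  · exact Filter.Eventually.of_forall fun Q => rfl
  · filter_upwards [hev] with Q hQ
    have h1 : (cotCoordSymm n c Q).proj ∈ c.source := c.map_target hQ.1
    have h2 := cotCoord_snd_transition hc hκ (ξ := cotCoordSymm n c Q) h1 hQ.2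
    rw [hc.cotCoord_cotCoordSymm hQ.1] at h2
    have h3 : c (cotCoordSymm n c Q).proj = Q.1 := c.right_inv hQ.1
    rw [h3] at h2
    exact h2.symm

/-- The hamiltonian vectors in induced coordinates. -/
lemma isHamiltonianVector_iff {h : Cot n M → ℝ} {ξ : Cot n M} (hξ : ξ.proj ∈ κ.source)
    (hh : MDifferentiableAt (cotModel n) 𝓘(ℝ, ℝ) h ξ)
    (X : EuclideanSpace ℝ (Fin n) × (EuclideanSpace ℝ (Fin n) →L[ℝ] ℝ)) :
    IsHamiltonianVector h ξ X ↔
      sympl V (dCotCoord κ ξ X) = fderiv ℝ (h ∘ cotCoordSymm n κ) (cotCoord κ ξ) := by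
  have hP : cotCoord κ ξ ∈ hκ.cotLift.target := hκ.cotLift.map_source hξ
  have hleft : cotCoordSymm n κ (cotCoord κ ξ) = ξ := hκ.cotCoordSymm_cotCoord hξ
  have hTd : DifferentiableAt ℝ (h ∘ cotCoordSymm n κ) (cotCoord κ ξ) := by
    rw [← mdifferentiableAt_iff_differentiableAt]
    refine MDifferentiableAt.comp (I' := cotModel n) _ ?_
      (hκ.isSmoothChart_cotLift.mdifferentiableAt_symm hP)
    change MDifferentiableAt (cotModel n) _ h (cotCoordSymm n κ (cotCoord κ ξ))
    rwa [hleft]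
  have hd : ∀ Y : EuclideanSpace ℝ (Fin n) × (EuclideanSpace ℝ (Fin n) →L[ℝ] ℝ),
      (mfderiv (cotModel n) 𝓘(ℝ, ℝ) h ξ Y : ℝ) =
        fderiv ℝ (h ∘ cotCoordSymm n κ) (cotCoord κ ξ) (dCotCoord κ ξ Y) := by
    intro Y
    have h1 : h =ᶠ[𝓝 ξ] (h ∘ cotCoordSymm n κ) ∘ cotCoord κ := by
      filter_upwards [hκ.cotLift.open_source.mem_nhds hξ] with η hη
      change _ = h (cotCoordSymm n κ (cotCoord κ η))
      rw [hκ.cotCoordSymm_cotCoord hη]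
    have hκξ : MDifferentiableAt (cotModel n) 𝓘(ℝ, V × (V →L[ℝ] ℝ)) (cotCoord κ) ξ :=
      hκ.isSmoothChart_cotLift.mdifferentiableAt hξ
    have h2 := (hTd.hasFDerivAt.hasMFDerivAt.comp ξ hκξ.hasMFDerivAt).mfderiv
    have h3 := (h1.mfderiv_eq (I := cotModel n) (I' := 𝓘(ℝ, ℝ))).trans h2
    exact congrArg (fun A => A Y) h3
  constructor
  · intro hX
    refine ContinuousLinearMap.ext fun Z => ?_
    obtain ⟨Y, hY⟩ := (hκ.isSmoothChart_cotLift.tangentEquiv hξ).surjective Z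
    have hY' : dCotCoord κ ξ Y = Z := hY
    rw [← hY']
    exact (hκ.symplecticForm_eq hξ X Y).trans ((hX Y).trans (hd Y))
  · intro hX Y
    exact (hκ.symplecticForm_eq hξ X Y).symm.trans
      ((congrArg (fun A => A (dCotCoord κ ξ Y)) hX).trans (hd Y).symm)

end IsSmoothChart

end Hamiltonian

/-! ### The energy of a covector -/

section Energy

variable {n : ℕ} {M : Type*} [TopologicalSpace M] [ChartedSpace (EuclideanSpace ℝ (Fin n)) M]
  [IsManifold (𝓡 n) ∞ M]
  (g : ContMDiffRiemannianMetric (𝓡 n) ∞ (EuclideanSpace ℝ (Fin n))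
    (fun x : M => TangentSpace (𝓡 n) x))
  {V : Type*} [NormedAddCommGroup V] [NormedSpace ℝ V]

/-- The metric at a point, as a bilinear form on the model space. -/
def metricForm (x : M) :
    EuclideanSpace ℝ (Fin n) →L[ℝ] EuclideanSpace ℝ (Fin n) →L[ℝ] ℝ := g.inner x

lemma metricForm_symm (x : M) (v w : EuclideanSpace ℝ (Fin n)) :
    metricForm g x v w = metricForm g x w v := g.symm x v w

lemma metricForm_pos (x : M) {v : EuclideanSpace ℝ (Fin n)} (hv : v ≠ 0) :
    0 < metricForm g x v v := g.pos x v hv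

lemma metricForm_nonneg (x : M) (v : EuclideanSpace ℝ (Fin n)) : 0 ≤ metricForm g x v v := by
  rcases eq_or_ne v 0 with rfl | hv
  · simp
  · exact (metricForm_pos g x hv).le

/-- The isomorphism between vectors and covectors defined by the metric. -/
def lower (x : M) : EuclideanSpace ℝ (Fin n) ≃L[ℝ] (EuclideanSpace ℝ (Fin n) →L[ℝ] ℝ) :=
  dualEquivOfInjective (metricForm g x).toLinearMap fun v hv => by
    by_contra h
    have h1 : metricForm g x v v = 0 := congrArg (fun A => A v) hv
    exact (metricForm_pos g x h).ne' h1

lemma lower_apply (x : M) (v : EuclideanSpace ℝ (Fin n)) : lower g x v = metricForm g x v := rfl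

/-- The vector dual to a covector. -/
def raise (ξ : Cot n M) : EuclideanSpace ℝ (Fin n) := (lower g ξ.proj).symm (covec ξ)

lemma metricForm_raise (ξ : Cot n M) : metricForm g ξ.proj (raise g ξ) = covec ξ := by
  rw [← lower_apply, raise, ContinuousLinearEquiv.apply_symm_apply]

lemma raise_eq_iff {ξ : Cot n M} {v : EuclideanSpace ℝ (Fin n)} :
    raise g ξ = v ↔ covec ξ = metricForm g ξ.proj v := by
  rw [raise, ContinuousLinearEquiv.symm_apply_eq, lower_apply]

/-- Half the square of the norm of a covector. -/
def energy (ξ : Cot n M) : ℝ := covec ξ (raise g ξ) / 2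

lemma energy_eq (ξ : Cot n M) :
    energy g ξ = metricForm g ξ.proj (raise g ξ) (raise g ξ) / 2 := by
  rw [metricForm_raise, energy]

lemma energy_nonneg (ξ : Cot n M) : 0 ≤ energy g ξ := by
  rw [energy_eq]
  exact div_nonneg (metricForm_nonneg g _ _) zero_le_two

lemma raise_eq_zero {ξ : Cot n M} : raise g ξ = 0 ↔ covec ξ = 0 := by
  rw [raise_eq_iff, map_zero]

lemma energy_pos {ξ : Cot n M} (hξ : covec ξ ≠ 0) : 0 < energy g ξ := by
  rw [energy_eq]
  exact div_pos (metricForm_pos g _ fun h => hξ ((raise_eq_zero g).1 h)) zero_lt_two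

lemma energy_eq_zero {ξ : Cot n M} : energy g ξ = 0 ↔ covec ξ = 0 := by
  refine ⟨fun h => ?_, fun h => ?_⟩
  · by_contra h'
    exact (energy_pos g h').ne' h
  · simp [energy, h]

/-- The Cauchy–Schwarz inequality, obtained by expanding the square of u - s v with u the vector
dual to ξ and s its length; the supremum is attained at u/s. -/
lemma conorm_eq (ξ : Cot n M) : conorm g ξ = √(2 * energy g ξ) := by
  set u := raise g ξ with hu
  set s := √(2 * energy g ξ) with hs
  have hs2 : metricForm g ξ.proj u u = s * s := by
    rw [hs, Real.mul_self_sqrt (by have := energy_nonneg g ξ; positivity), energy_eq]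
    ring
  have hset : {r | ∃ v : TangentSpace (𝓡 n) ξ.proj, g.inner ξ.proj v v ≤ 1 ∧ r = ξ.snd v} =
      {r | ∃ v : EuclideanSpace ℝ (Fin n), metricForm g ξ.proj v v ≤ 1 ∧
        r = metricForm g ξ.proj u v} := by
    rw [hu, metricForm_raise]
    rfl
  have hgr : IsGreatest {r | ∃ v : EuclideanSpace ℝ (Fin n), metricForm g ξ.proj v v ≤ 1 ∧
        r = metricForm g ξ.proj u v} s := by
    rcases eq_or_ne s 0 with h0 | h0
    · have hu0 : u = 0 := by
        by_contra h
        exact (metricForm_pos g ξ.proj h).ne' (by rw [hs2, h0, mul_zero])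
      refine ⟨⟨0, by simp, by simp [h0]⟩, ?_⟩
      rintro r ⟨v, -, rfl⟩
      simp [hu0, h0]
    · have hpos : 0 < s := lt_of_le_of_ne (Real.sqrt_nonneg _) h0.symm
      refine ⟨⟨s⁻¹ • u, ?_, ?_⟩, ?_⟩
      · simp only [map_smul, smul_apply, smul_eq_mul, hs2]
        field_simp
        exact le_refl _
      · simp only [map_smul, smul_eq_mul, hs2]
        field_simp
      · rintro r ⟨v, hv, rfl⟩
        have h1 := metricForm_nonneg g ξ.proj (u - s • v)
        simp only [map_sub, sub_apply, map_smul, smul_apply, smul_eq_mul,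
          hs2, metricForm_symm g ξ.proj v u] at h1
        have h2 : s * (s * metricForm g ξ.proj v v) ≤ s * (s * 1) := by gcongr
        have h3 : s * metricForm g ξ.proj u v ≤ s * s := by linarith
        exact le_of_mul_le_mul_left h3 hpos
  rw [conorm, hset]
  exact hgr.csSup_eq

lemma conorm_pos {ξ : Cot n M} (hξ : covec ξ ≠ 0) : 0 < conorm g ξ := by
  rw [conorm_eq]
  exact Real.sqrt_pos.2 (mul_pos two_pos (energy_pos g hξ))

/-- The matrix of the metric in a chart. -/
def chartMetric (κ : OpenPartialHomeomorph M V) (z : V) : V →L[ℝ] V →L[ℝ] ℝ :=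
  (metricForm g (κ.symm z)).bilinearComp (dChartSymm n κ z) (dChartSymm n κ z)

lemma chartMetric_apply (κ : OpenPartialHomeomorph M V) (z v w : V) : chartMetric g κ z v w =
    metricForm g (κ.symm z) (dChartSymm n κ z v) (dChartSymm n κ z w) := rfl

lemma contDiffOn_inverse {W F G : Type*} [NormedAddCommGroup W] [NormedSpace ℝ W]
    [NormedAddCommGroup F] [NormedSpace ℝ F] [CompleteSpace F] [NormedAddCommGroup G]
    [NormedSpace ℝ G] {A : W → F →L[ℝ] G} {s : Set W} (hA : ContDiffOn ℝ ∞ A s)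
    (h : ∀ z ∈ s, ∃ e : F ≃L[ℝ] G, (e : F →L[ℝ] G) = A z) :
    ContDiffOn ℝ ∞ (fun z => (A z).inverse) s := by
  intro z hz
  obtain ⟨e, he⟩ := h z hz
  have h1 : ContDiffAt ℝ ∞ (ContinuousLinearMap.inverse : (F →L[ℝ] G) → G →L[ℝ] F) (A z) :=
    he ▸ contDiffAt_map_inverse e
  exact h1.comp_contDiffWithinAt z (hA z hz)

namespace IsSmoothChart

variable {κ : OpenPartialHomeomorph M V} (hκ : IsSmoothChart (𝓡 n) κ)
include hκ

lemma contMDiffOn_dChartSymm (v : V) :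
    ContMDiffOn 𝓘(ℝ, V) (𝓡 n).tangent ∞
      (fun z => (⟨κ.symm z, dChartSymm n κ z v⟩ : TangentBundle (𝓡 n) M)) κ.target := by
  have h1 : ContMDiffOn 𝓘(ℝ, V).tangent (𝓡 n).tangent ∞
      (tangentMapWithin 𝓘(ℝ, V) (𝓡 n) κ.symm κ.target)
      (π V (TangentSpace 𝓘(ℝ, V)) ⁻¹' κ.target) :=
    hκ.smooth_symm.contMDiffOn_tangentMapWithin (by norm_num) κ.open_target.uniqueMDiffOn
  have h2 : ContMDiffOn 𝓘(ℝ, V) 𝓘(ℝ, V).tangent ∞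
      (fun z => (⟨z, v⟩ : TangentBundle 𝓘(ℝ, V) V)) κ.target :=
    contMDiffOn_vectorSpace_iff_contDiffOn.2 contDiffOn_const
  refine (h1.comp h2 fun z hz => hz).congr fun z hz => ?_
  refine Bundle.TotalSpace.ext rfl (heq_of_eq ?_)
  exact (congrArg (fun A => A v) (mfderivWithin_of_mem_nhds (I := 𝓘(ℝ, V)) (I' := 𝓡 n)
    (f := κ.symm) (κ.open_target.mem_nhds hz))).symm

set_option synthInstance.maxHeartbeats 200000 in
lemma contDiffOn_chartMetric_apply (v w : V) :
    ContDiffOn ℝ ∞ (fun z => chartMetric g κ z v w) κ.target := by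
  rw [← contMDiffOn_iff_contDiffOn]
  intro z hz
  have h1 : ContMDiffWithinAt 𝓘(ℝ, V) ((𝓡 n).prod 𝓘(ℝ)) ∞
      (fun z => TotalSpace.mk' ℝ (E := Bundle.Trivial M ℝ) (κ.symm z)
        (g.inner (κ.symm z) (dChartSymm n κ z v) (dChartSymm n κ z w))) κ.target z := by
    apply ContMDiffWithinAt.clm_bundle_apply₂ (F₁ := EuclideanSpace ℝ (Fin n))
      (F₂ := EuclideanSpace ℝ (Fin n)) (E₁ := fun x : M => TangentSpace (𝓡 n) x)
      (E₂ := fun x : M => TangentSpace (𝓡 n) x)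
    · exact ContMDiffAt.comp_contMDiffWithinAt z g.contMDiff.contMDiffAt (hκ.smooth_symm z hz)
    · exact hκ.contMDiffOn_dChartSymm v z hz
    · exact hκ.contMDiffOn_dChartSymm w z hz
  simp only [contMDiffWithinAt_totalSpace] at h1
  exact h1.2

variable [FiniteDimensional ℝ V]

lemma contDiffOn_chartMetric : ContDiffOn ℝ ∞ (chartMetric g κ) κ.target := by
  refine contDiffOn_clm_apply.2 fun v => ?_
  exact contDiffOn_clm_apply.2 fun w => hκ.contDiffOn_chartMetric_apply g v w

lemma chartMetric_pos {z : V} (hz : z ∈ κ.target) {v : V} (hv : v ≠ 0) :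
    0 < chartMetric g κ z v v := by
  refine metricForm_pos g _ fun h => hv ?_
  have h1 := hκ.dChart_dChartSymm (κ.map_target hz) v
  rw [κ.right_inv hz] at h1
  exact h1.symm.trans ((congrArg (dChart κ (κ.symm z)) h).trans (map_zero _))

/-- The isomorphism between `V` and its dual defined by the metric in a chart. -/
def chartLower {z : V} (hz : z ∈ κ.target) : V ≃L[ℝ] (V →L[ℝ] ℝ) :=
  dualEquivOfInjective (chartMetric g κ z).toLinearMap fun v hv => by
    by_contra h
    have h1 : chartMetric g κ z v v = 0 := congrArg (fun A => A v) hv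
    exact (hκ.chartMetric_pos g hz h).ne' h1

lemma coe_chartLower {z : V} (hz : z ∈ κ.target) :
    (hκ.chartLower g hz : V →L[ℝ] (V →L[ℝ] ℝ)) = chartMetric g κ z := rfl

lemma raise_cotCoordSymm {P : V × (V →L[ℝ] ℝ)} (hP : P.1 ∈ κ.target) :
    raise g (cotCoordSymm n κ P) =
      dChartSymm n κ P.1 ((chartMetric g κ P.1).inverse P.2) := by
  rw [raise_eq_iff]
  have h0 : chartMetric g κ P.1 ((chartMetric g κ P.1).inverse P.2) = P.2 := by
    rw [← hκ.coe_chartLower g hP, ContinuousLinearMap.inverse_equiv]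
    exact (hκ.chartLower g hP).apply_symm_apply P.2
  ext w
  have h1 : covec (cotCoordSymm n κ P) w = P.2 (dChart κ (κ.symm P.1) w) := rfl
  have h2 := congrArg (fun A => A (dChart κ (κ.symm P.1) w)) h0
  have h3 := hκ.dChartSymm_dChart (κ.map_target hP) w
  rw [κ.right_inv hP] at h3
  rw [h1, ← h2]
  simp only [chartMetric_apply, h3]
  rfl

lemma energy_cotCoordSymm {P : V × (V →L[ℝ] ℝ)} (hP : P.1 ∈ κ.target) :
    energy g (cotCoordSymm n κ P) = P.2 ((chartMetric g κ P.1).inverse P.2) / 2 := by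
  rw [energy, hκ.raise_cotCoordSymm g hP]
  have h3 := hκ.dChart_dChartSymm (κ.map_target hP) ((chartMetric g κ P.1).inverse P.2)
  rw [κ.right_inv hP] at h3
  exact congrArg (fun v => P.2 v / 2) h3

lemma contDiffOn_inverse_chartMetric :
    ContDiffOn ℝ ∞ (fun z => (chartMetric g κ z).inverse) κ.target :=
  contDiffOn_inverse (hκ.contDiffOn_chartMetric g) fun _ hz =>
    ⟨hκ.chartLower g hz, hκ.coe_chartLower g hz⟩

set_option synthInstance.maxHeartbeats 400000 in
lemma contDiffOn_energy :
    ContDiffOn ℝ ∞ (energy g ∘ cotCoordSymm n κ) (κ.target ×ˢ univ) := by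
  have h1 : ContDiffOn ℝ ∞ (fun P : V × (V →L[ℝ] ℝ) =>
      P.2 ((chartMetric g κ P.1).inverse P.2) / 2) (κ.target ×ˢ univ) := by
    have h2 : ContDiffOn ℝ ∞ (fun P : V × (V →L[ℝ] ℝ) => (chartMetric g κ P.1).inverse)
        (κ.target ×ˢ univ) :=
      (hκ.contDiffOn_inverse_chartMetric g).comp contDiff_fst.contDiffOn fun P hP => hP.1
    exact (contDiff_snd.contDiffOn.clm_apply (h2.clm_apply contDiff_snd.contDiffOn)).div_const 2
  exact h1.congr fun P hP => hκ.energy_cotCoordSymm g hP.1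

end IsSmoothChart

/-- Unlike the norm, the energy is smooth across the zero section, so its hamiltonian field lives on
the whole cotangent bundle and the completeness argument applies to it. -/
lemma contMDiff_energy : ContMDiff (cotModel n) 𝓘(ℝ, ℝ) ∞ (energy g) := by
  intro ξ
  let κ := chartAt (EuclideanSpace ℝ (Fin n)) ξ.proj
  have hκ : IsSmoothChart (𝓡 n) κ := isSmoothChart_chartAt _
  have h1 : ContMDiffOn (cotModel n) 𝓘(ℝ, ℝ) ∞ ((energy g ∘ cotCoordSymm n κ) ∘ cotCoord κ)
      ((fun ξ : Cot n M => ξ.proj) ⁻¹' κ.source) :=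
    (contMDiffOn_iff_contDiffOn.2 (hκ.contDiffOn_energy g)).comp hκ.contMDiffOn_cotCoord
      fun η hη => ⟨κ.map_source hη, mem_univ _⟩
  have hn : (fun ξ : Cot n M => ξ.proj) ⁻¹' κ.source ∈ 𝓝 ξ :=
    hκ.cotLift.open_source.mem_nhds (mem_chart_source (EuclideanSpace ℝ (Fin n)) ξ.proj)
  refine (h1.contMDiffAt hn).congr_of_eventuallyEq ?_
  filter_upwards [hn] with η hη
  change energy g η = energy g (cotCoordSymm n κ (cotCoord κ η))
  rw [hκ.cotCoordSymm_cotCoord hη]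

end Energy

/-! ### The hamiltonian field of the energy -/

section HamiltonianField

set_option synthInstance.maxHeartbeats 400000

variable {n : ℕ} {M : Type*} [TopologicalSpace M] [ChartedSpace (EuclideanSpace ℝ (Fin n)) M]
  [IsManifold (𝓡 n) ∞ M]
  (g : ContMDiffRiemannianMetric (𝓡 n) ∞ (EuclideanSpace ℝ (Fin n))
    (fun x : M => TangentSpace (𝓡 n) x))
  {V : Type*} [NormedAddCommGroup V] [NormedSpace ℝ V]

/-- The Cauchy–Schwarz inequality, from the nonnegativity of the square of g(v, v)u - g(u, v)v. -/
lemma covec_sq_le (ξ : Cot n M) (v : EuclideanSpace ℝ (Fin n)) :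
    covec ξ v ^ 2 ≤ 2 * energy g ξ * metricForm g ξ.proj v v := by
  rw [energy_eq, ← metricForm_raise g ξ]
  set u := raise g ξ
  rcases eq_or_ne v 0 with rfl | hv
  · simp
  have ha := metricForm_pos g ξ.proj hv
  have h1 := metricForm_nonneg g ξ.proj
    (metricForm g ξ.proj v v • u - metricForm g ξ.proj u v • v)
  simp only [map_sub, sub_apply, map_smul, smul_apply, smul_eq_mul,
    metricForm_symm g ξ.proj v u] at h1
  have h2 : 0 ≤ metricForm g ξ.proj v v *
      (metricForm g ξ.proj v v * metricForm g ξ.proj u u - metricForm g ξ.proj u v ^ 2) := by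
    linarith
  have h3 := nonneg_of_mul_nonneg_right h2 ha
  linarith

lemma hasDerivAt_line {W F : Type*} [NormedAddCommGroup W] [NormedSpace ℝ W]
    [NormedAddCommGroup F] [NormedSpace ℝ F] {B : W → F} {B' : W →L[ℝ] F} {a : W}
    (hB : HasFDerivAt B B' a) (y : W) : HasDerivAt (fun s : ℝ => B (a + s • y)) (B' y) 0 := by
  have hγ : HasDerivAt (fun s : ℝ => a + s • y) y 0 := by
    simpa using ((hasDerivAt_id (0 : ℝ)).smul_const y).const_add a
  exact hB.comp_hasDerivAt_of_eq (0 : ℝ) hγ (by simp)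

/-- The differential of a quadratic function of the momentum. -/
lemma hasFDerivAt_quadratic {B : V → (V →L[ℝ] ℝ) →L[ℝ] V}
    {B' : V →L[ℝ] ((V →L[ℝ] ℝ) →L[ℝ] V)} {P : V × (V →L[ℝ] ℝ)} (hB : HasFDerivAt B B' P.1)
    (hs : ∀ a b : V →L[ℝ] ℝ, a (B P.1 b) = b (B P.1 a)) {L : V × (V →L[ℝ] ℝ) →L[ℝ] ℝ}
    (hL : HasFDerivAt (fun Q : V × (V →L[ℝ] ℝ) => Q.2 (B Q.1 Q.2) / 2) L P)
    (Y : V × (V →L[ℝ] ℝ)) :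
    L Y = Y.2 (B P.1 P.2) + P.2 (B' Y.1 P.2) / 2 := by
  have e0 : P + (0 : ℝ) • Y = P := by simp
  have h1 : HasDerivAt (fun s : ℝ => (P + s • Y).2 (B (P + s • Y).1 (P + s • Y).2) / 2) (L Y) 0 :=
    hasDerivAt_line hL Y
  have h2 : HasDerivAt (fun s : ℝ => (P + s • Y).2) Y.2 0 := by
    simpa using ((hasDerivAt_id (0 : ℝ)).smul_const Y.2).const_add P.2
  have h4 : HasDerivAt (fun s : ℝ => B (P + s • Y).1) (B' Y.1) 0 :=
    hasDerivAt_line (F := (V →L[ℝ] ℝ) →L[ℝ] V) hB Y.1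
  have h5 := (h2.clm_apply (h4.clm_apply h2)).div_const 2
  have h6 := h1.unique h5
  simp only [e0] at h6
  rw [h6, map_add, hs P.2 Y.2]
  ring

/-- The hamiltonian vector field of the energy. -/
def hamField (ξ : Cot n M) :
    EuclideanSpace ℝ (Fin n) × (EuclideanSpace ℝ (Fin n) →L[ℝ] ℝ) :=
  (symplEquiv (EuclideanSpace ℝ (Fin n))).symm
    (mfderiv (cotModel n) 𝓘(ℝ, ℝ) (energy g) ξ)

lemma mdifferentiableAt_energy (ξ : Cot n M) :
    MDifferentiableAt (cotModel n) 𝓘(ℝ, ℝ) (energy g) ξ :=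
  (contMDiff_energy g).mdifferentiable (by simp) ξ

lemma isHamiltonianVector_iff_eq {h : Cot n M → ℝ} {ξ : Cot n M}
    {X : EuclideanSpace ℝ (Fin n) × (EuclideanSpace ℝ (Fin n) →L[ℝ] ℝ)} :
    IsHamiltonianVector h ξ X ↔ sympl (EuclideanSpace ℝ (Fin n)) X =
      mfderiv (cotModel n) 𝓘(ℝ, ℝ) h ξ :=
  ⟨fun hX => ContinuousLinearMap.ext hX, fun hX Y => congrArg (fun A => A Y) hX⟩

lemma isHamiltonianVector_energy_iff {ξ : Cot n M}
    {X : EuclideanSpace ℝ (Fin n) × (EuclideanSpace ℝ (Fin n) →L[ℝ] ℝ)} :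
    IsHamiltonianVector (energy g) ξ X ↔ X = hamField g ξ := by
  exact isHamiltonianVector_iff_eq.trans (symplEquiv _).eq_symm_apply.symm

lemma mfderiv_energy_hamField (ξ : Cot n M) :
    mfderiv (cotModel n) 𝓘(ℝ, ℝ) (energy g) ξ (hamField g ξ) = (0 : ℝ) := by
  have h1 := ((isHamiltonianVector_energy_iff g).2 rfl : IsHamiltonianVector (energy g) ξ _)
    (hamField g ξ)
  exact h1.symm.trans (sub_self _)

namespace IsSmoothChart

variable {κ : OpenPartialHomeomorph M V} (hκ : IsSmoothChart (𝓡 n) κ) [FiniteDimensional ℝ V]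
include hκ

lemma sympl_dCotCoord_hamField {ξ : Cot n M} (hξ : ξ.proj ∈ κ.source) :
    sympl V (dCotCoord κ ξ (hamField g ξ)) =
      fderiv ℝ (energy g ∘ cotCoordSymm n κ) (cotCoord κ ξ) :=
  (hκ.isHamiltonianVector_iff hξ (mdifferentiableAt_energy g ξ) _).1
    ((isHamiltonianVector_energy_iff g).2 rfl)

lemma chartMetric_inverse_symm {z : V} (hz : z ∈ κ.target) (a b : V →L[ℝ] ℝ) :
    a ((chartMetric g κ z).inverse b) = b ((chartMetric g κ z).inverse a) := by
  have h0 (c : V →L[ℝ] ℝ) : chartMetric g κ z ((chartMetric g κ z).inverse c) = c := by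
    rw [← hκ.coe_chartLower g hz, ContinuousLinearMap.inverse_equiv]
    exact (hκ.chartLower g hz).apply_symm_apply c
  conv_lhs => rw [← h0 a]
  conv_rhs => rw [← h0 b]
  rw [chartMetric_apply, chartMetric_apply, metricForm_symm]

/-- The hamiltonian equations in induced coordinates. -/
lemma dCotCoord_hamField {ξ : Cot n M} (hξ : ξ.proj ∈ κ.source) :
    (dCotCoord κ ξ (hamField g ξ)).1 =
        (chartMetric g κ (κ ξ.proj)).inverse (cotCoord κ ξ).2 ∧
      ∀ v, (dCotCoord κ ξ (hamField g ξ)).2 v = - ((cotCoord κ ξ).2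
        (fderiv ℝ (fun z => (chartMetric g κ z).inverse) (κ ξ.proj) v (cotCoord κ ξ).2) / 2) := by
  have hz : κ ξ.proj ∈ κ.target := κ.map_source hξ
  have h1 := hκ.sympl_dCotCoord_hamField g hξ
  have hB : HasFDerivAt (fun z => (chartMetric g κ z).inverse)
      (fderiv ℝ (fun z => (chartMetric g κ z).inverse) (κ ξ.proj)) (cotCoord κ ξ).1 :=
    (((hκ.contDiffOn_inverse_chartMetric g).contDiffAt
      (κ.open_target.mem_nhds hz)).differentiableAt (by simp)).hasFDerivAt
  have hP : κ.target ×ˢ univ ∈ 𝓝 (cotCoord κ ξ) :=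
    hκ.cotLift.open_target.mem_nhds (hκ.cotLift.map_source hξ)
  have hL : HasFDerivAt (fun Q : V × (V →L[ℝ] ℝ) => Q.2 ((chartMetric g κ Q.1).inverse Q.2) / 2)
      (fderiv ℝ (energy g ∘ cotCoordSymm n κ) (cotCoord κ ξ)) (cotCoord κ ξ) := by
    refine (((hκ.contDiffOn_energy g).contDiffAt hP).differentiableAt
      (by simp)).hasFDerivAt.congr_of_eventuallyEq ?_
    filter_upwards [hP] with Q hQ
    exact (hκ.energy_cotCoordSymm g hQ.1).symm
  have h2 (Y : V × (V →L[ℝ] ℝ)) := (congrArg (fun A => A Y) h1).trans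
    (hasFDerivAt_quadratic hB (hκ.chartMetric_inverse_symm g hz) hL Y)
  simp only [sympl_apply] at h2
  constructor
  · refine sub_eq_zero.1 (SeparatingDual.eq_zero_of_forall_dual_eq_zero (R := ℝ) fun a => ?_)
    have h3 := h2 (0, a)
    simp only [map_zero, sub_zero, zero_apply, zero_div, add_zero] at h3
    rw [map_sub, h3]
    exact sub_self _
  · intro v
    have h3 := h2 (v, 0)
    simp only [zero_apply, zero_sub, zero_add] at h3
    rw [← h3, neg_neg]

lemma dCotCoord_hamField_smooth : ∃ f : V × (V →L[ℝ] ℝ) → V × (V →L[ℝ] ℝ),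
    ContDiffOn ℝ ∞ f (κ.target ×ˢ univ) ∧
      ∀ ξ : Cot n M, ξ.proj ∈ κ.source → dCotCoord κ ξ (hamField g ξ) = f (cotCoord κ ξ) := by
  refine ⟨fun P => (symplEquiv V).symm (fderiv ℝ (energy g ∘ cotCoordSymm n κ) P), ?_, ?_⟩
  · have h1 : ContDiffOn ℝ ∞ (fderiv ℝ (energy g ∘ cotCoordSymm n κ)) (κ.target ×ˢ univ) :=
      (hκ.contDiffOn_energy g).fderiv_of_isOpen hκ.cotLift.open_target (by norm_num)
    exact (symplEquiv V).symm.contDiff.comp_contDiffOn h1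
  · intro ξ hξ
    rw [ContinuousLinearEquiv.eq_symm_apply]
    exact hκ.sympl_dCotCoord_hamField g hξ

end IsSmoothChart

/-- The hamiltonian vector field of the energy, as a section of the tangent bundle. -/
def hamSection (ξ : Cot n M) : TangentSpace (cotModel n) ξ := hamField g ξ

lemma isSmoothField_hamField : IsSmoothField (I := cotModel n) (N := Cot n M)
    (EuclideanSpace ℝ (Fin n) × (EuclideanSpace ℝ (Fin n) →L[ℝ] ℝ)) (hamSection g) := by
  intro ξ
  have hκ : IsSmoothChart (𝓡 n) (chartAt (EuclideanSpace ℝ (Fin n)) ξ.proj) :=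
    isSmoothChart_chartAt _
  obtain ⟨f, hf, hfX⟩ := hκ.dCotCoord_hamField_smooth g
  exact ⟨hκ.cotLift, mem_chart_source (EuclideanSpace ℝ (Fin n)) ξ.proj,
    hκ.isSmoothChart_cotLift, f, hf, hfX⟩

/-- Over a closed ball in a chart the coefficients of the metric are bounded by some C, so a
covector ξ of energy at most R satisfies |ξ(v)|² ≤ 2RC‖v‖² in coordinates. Finitely many such balls
cover M. -/
lemma isCompact_energy_le [T2Space M] [CompactSpace M] (R : ℝ) :
    IsCompact {ξ : Cot n M | |energy g ξ| ≤ R} := by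
  have hcl : IsClosed {ξ : Cot n M | |energy g ξ| ≤ R} :=
    isClosed_le (contMDiff_energy g).continuous.abs continuous_const
  have hloc : ∀ x : M, ∃ U : Set M, IsOpen U ∧ x ∈ U ∧ ∃ K : Set (Cot n M), IsCompact K ∧
      ∀ ξ : Cot n M, ξ.proj ∈ U → |energy g ξ| ≤ R → ξ ∈ K := by
    intro x
    let κ := chartAt (EuclideanSpace ℝ (Fin n)) x
    have hκ : IsSmoothChart (𝓡 n) κ := isSmoothChart_chartAt x
    have hx : x ∈ κ.source := mem_chart_source _ _
    obtain ⟨ε, hε, hB⟩ := Metric.isOpen_iff.1 κ.open_target (κ x) (κ.map_source hx)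
    have hB' : Metric.closedBall (κ x) (ε / 2) ⊆ κ.target :=
      (Metric.closedBall_subset_ball (by linarith)).trans hB
    obtain ⟨C, hC⟩ := IsCompact.exists_bound_of_continuousOn
      (E := EuclideanSpace ℝ (Fin n) →L[ℝ] EuclideanSpace ℝ (Fin n) →L[ℝ] ℝ)
      (isCompact_closedBall (κ x) (ε / 2)) ((hκ.contDiffOn_chartMetric g).continuousOn.mono hB')
    have hC0 : 0 ≤ C := (norm_nonneg _).trans (hC _ (Metric.mem_closedBall_self (by linarith)))
    refine ⟨κ.source ∩ κ ⁻¹' Metric.ball (κ x) (ε / 2),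
      κ.isOpen_inter_preimage Metric.isOpen_ball, ⟨hx, Metric.mem_ball_self (by linarith)⟩,
      cotCoordSymm n κ '' (Metric.closedBall (κ x) (ε / 2) ×ˢ
        Metric.closedBall 0 √(2 * R * C)), ?_, ?_⟩
    · exact ((isCompact_closedBall _ _).prod (isCompact_closedBall _ _)).image_of_continuousOn
        (hκ.contMDiffOn_cotCoordSymm.continuousOn.mono fun P hP => ⟨hB' hP.1, mem_univ _⟩)
    · intro ξ hξ hE
      have hz : κ ξ.proj ∈ Metric.closedBall (κ x) (ε / 2) := Metric.ball_subset_closedBall hξ.2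
      refine ⟨cotCoord κ ξ, ⟨hz, ?_⟩, hκ.cotCoordSymm_cotCoord hξ.1⟩
      rw [mem_closedBall_zero_iff]
      refine ContinuousLinearMap.opNorm_le_bound _ (Real.sqrt_nonneg _) fun v => ?_
      have h1 := covec_sq_le g ξ (dChartSymm n κ (κ ξ.proj) v)
      have h2 : metricForm g ξ.proj (dChartSymm n κ (κ ξ.proj) v)
          (dChartSymm n κ (κ ξ.proj) v) = chartMetric g κ (κ ξ.proj) v v := by
        rw [chartMetric_apply, κ.left_inv hξ.1]
      have h3 : chartMetric g κ (κ ξ.proj) v v ≤ C * ‖v‖ * ‖v‖ := by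
        refine (le_abs_self _).trans (((chartMetric g κ (κ ξ.proj)).le_opNorm₂ v v).trans ?_)
        gcongr
        exact hC _ hz
      have hR : 0 ≤ R := (abs_nonneg _).trans hE
      have hER : energy g ξ ≤ R := (le_abs_self _).trans hE
      have h4 : covec ξ (dChartSymm n κ (κ ξ.proj) v) ^ 2 ≤ 2 * R * (C * ‖v‖ * ‖v‖) := by
        have h5 := h2 ▸ metricForm_nonneg g ξ.proj (dChartSymm n κ (κ ξ.proj) v)
        rw [h2] at h1
        refine h1.trans ?_
        gcongr
      refine abs_le_of_sq_le_sq' ?_ (by positivity) |> abs_le.2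
      rw [mul_pow, Real.sq_sqrt (by positivity)]
      calc _ ≤ _ := h4
        _ = _ := by ring
  choose U hU hxU K hK hUK using hloc
  obtain ⟨t, ht⟩ := isCompact_univ.elim_finite_subcover U hU fun x _ => mem_iUnion.2 ⟨x, hxU x⟩
  refine (t.isCompact_biUnion fun i _ => hK i).of_isClosed_subset hcl fun ξ hξ => ?_
  obtain ⟨i, hi, hi'⟩ := mem_iUnion₂.1 (ht (mem_univ ξ.proj))
  exact mem_iUnion₂.2 ⟨i, hi, hUK i ξ hi' hξ⟩

/-! ### The cogeodesic flow -/

section Flow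

variable [T2Space M] [CompactSpace M]

lemma exists_geoFlow (ξ : Cot n M) : ∃ γ : ℝ → Cot n M, γ 0 = ξ ∧
    IsMIntegralCurve (I := cotModel n) γ (hamSection g) :=
  exists_isMIntegralCurve_of_firstIntegral (isSmoothField_hamField g) (contMDiff_energy g)
    (mfderiv_energy_hamField g) (isCompact_energy_le g) ξ

/-- The flow of the hamiltonian field of the energy (the cogeodesic flow). -/
def geoFlow (t : ℝ) (ξ : Cot n M) : Cot n M := (exists_geoFlow g ξ).choose t

@[simp] lemma geoFlow_zero (ξ : Cot n M) : geoFlow g 0 ξ = ξ := (exists_geoFlow g ξ).choose_spec.1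

lemma isMIntegralCurve_geoFlow (ξ : Cot n M) : IsMIntegralCurve (I := cotModel n)
    (fun t => geoFlow g t ξ) (hamSection g) :=
  (exists_geoFlow g ξ).choose_spec.2

lemma geoFlow_add (s t : ℝ) (ξ : Cot n M) : geoFlow g (s + t) ξ = geoFlow g s (geoFlow g t ξ) :=
  flow_add (isSmoothField_hamField g) (geoFlow_zero g) (isMIntegralCurve_geoFlow g) s t ξ

lemma contMDiff_geoFlow : ContMDiff (𝓘(ℝ, ℝ).prod (cotModel n)) (cotModel n) ∞
    (fun P : ℝ × Cot n M => geoFlow g P.1 P.2) :=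
  contMDiff_flow (isSmoothField_hamField g) (geoFlow_zero g) (isMIntegralCurve_geoFlow g)

@[simp] lemma energy_geoFlow (t : ℝ) (ξ : Cot n M) : energy g (geoFlow g t ξ) = energy g ξ := by
  have := eq_of_isMIntegralCurve (contMDiff_energy g) (mfderiv_energy_hamField g)
    (isMIntegralCurve_geoFlow g ξ) t
  simpa using this

lemma eq_geoFlow {γ : ℝ → Cot n M} (hγ : IsMIntegralCurve (I := cotModel n) γ
    (hamSection g)) (t : ℝ) :
    γ t = geoFlow g t (γ 0) := by
  have : IsManifold (cotModel n) 1 (Cot n M) :=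
    IsManifold.of_le (n := ∞) (by exact_mod_cast le_top)
  exact congrFun (isMIntegralCurve_Ioo_eq_of_contMDiff_boundaryless (t₀ := (0 : ℝ))
    (isSmoothField_hamField g).contMDiff hγ (isMIntegralCurve_geoFlow g (γ 0)) (by simp)) t

lemma conorm_geoFlow (t : ℝ) (ξ : Cot n M) : conorm g (geoFlow g t ξ) = conorm g ξ := by
  rw [conorm_eq, conorm_eq, energy_geoFlow]

lemma covec_geoFlow_ne_zero {t : ℝ} {ξ : Cot n M} (hξ : covec ξ ≠ 0) :
    covec (geoFlow g t ξ) ≠ 0 := by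
  rw [Ne, ← energy_eq_zero g, energy_geoFlow, energy_eq_zero]
  exact hξ

end Flow

end HamiltonianField

/-! ### Velocities of curves in charts -/

section Curves

variable {V : Type*} [NormedAddCommGroup V] [NormedSpace ℝ V]
  {W : Type*} [NormedAddCommGroup W] [NormedSpace ℝ W] {H : Type*} [TopologicalSpace H]
  {I : ModelWithCorners ℝ W H} {N : Type*} [TopologicalSpace N] [ChartedSpace H N]

/-- A curve is differentiable if it is so in a chart. -/
lemma IsSmoothChart.hasMFDerivAt_curve {κ : OpenPartialHomeomorph N V} (hκ : IsSmoothChart I κ)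
    {γ : ℝ → N} {t : ℝ} {X : TangentSpace I (γ t)} (hev : ∀ᶠ s in 𝓝 t, γ s ∈ κ.source)
    (h : HasDerivAt (κ ∘ γ) (mfderiv I 𝓘(ℝ, V) κ (γ t) X : V) t) :
    HasMFDerivAt 𝓘(ℝ, ℝ) I γ t ((1 : ℝ →L[ℝ] ℝ).smulRight X) := by
  have ht := hev.self_of_nhds
  have h1 := (hκ.mdifferentiableAt_symm (κ.map_source ht)).hasMFDerivAt.comp t
    h.hasFDerivAt.hasMFDerivAt
  have h2 : γ =ᶠ[𝓝 t] κ.symm ∘ (κ ∘ γ) := by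
    filter_upwards [hev] with s hs
    exact (κ.left_inv hs).symm
  have h3 := h1.congr_of_eventuallyEq h2
  have h4 : (mfderiv 𝓘(ℝ, V) I κ.symm (κ (γ t))).comp
      (ContinuousLinearMap.toSpanSingleton ℝ (mfderiv I 𝓘(ℝ, V) κ (γ t) X : V)) =
      (1 : ℝ →L[ℝ] ℝ).smulRight X := by
    refine ContinuousLinearMap.ext fun r => ?_
    have e1 : (mfderiv 𝓘(ℝ, V) I κ.symm (κ (γ t)))
      (r • (mfderiv I 𝓘(ℝ, V) κ (γ t) X : V)) = r • X :=
      ((mfderiv 𝓘(ℝ, V) I κ.symm (κ (γ t))).map_smul r _).trans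
        (congrArg (fun v => r • v) (hκ.mfderiv_symm_mfderiv ht X))
    exact e1
  exact ⟨h3.1, by rw [← h4]; exact h3.2⟩

lemma IsSmoothChart.hasDerivAt_curve {κ : OpenPartialHomeomorph N V} (hκ : IsSmoothChart I κ)
    {γ : ℝ → N} {t : ℝ} {X : TangentSpace I (γ t)} (ht : γ t ∈ κ.source)
    (h : HasMFDerivAt 𝓘(ℝ, ℝ) I γ t ((1 : ℝ →L[ℝ] ℝ).smulRight X)) :
    HasDerivAt (κ ∘ γ) (mfderiv I 𝓘(ℝ, V) κ (γ t) X : V) t := by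
  let L : ℝ →L[ℝ] V := (mfderiv I 𝓘(ℝ, V) κ (γ t)).comp ((1 : ℝ →L[ℝ] ℝ).smulRight X)
  have h1 : HasFDerivAt (κ ∘ γ) L t :=
    ((hκ.mdifferentiableAt ht).hasMFDerivAt.comp t h).hasFDerivAt
  have h3 : L 1 = (mfderiv I 𝓘(ℝ, V) κ (γ t) X : V) :=
    congrArg (mfderiv I 𝓘(ℝ, V) κ (γ t)) (one_smul ℝ X)
  exact h3 ▸ h1.hasDerivAt

end Curves

/-! ### Hamiltonian equations in coordinates and homogeneity of the flow -/

section GeoFlow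

set_option synthInstance.maxHeartbeats 400000

variable {n : ℕ} {M : Type*} [TopologicalSpace M] [ChartedSpace (EuclideanSpace ℝ (Fin n)) M]
  [IsManifold (𝓡 n) ∞ M]
  (g : ContMDiffRiemannianMetric (𝓡 n) ∞ (EuclideanSpace ℝ (Fin n))
    (fun x : M => TangentSpace (𝓡 n) x))
  {V : Type*} [NormedAddCommGroup V] [NormedSpace ℝ V] [FiniteDimensional ℝ V]

/-- The hamiltonian field of the energy in induced coordinates. -/
def hamCoord (κ : OpenPartialHomeomorph M V) (P : V × (V →L[ℝ] ℝ)) : V × (V →L[ℝ] ℝ) :=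
  (symplEquiv V).symm (fderiv ℝ (energy g ∘ cotCoordSymm n κ) P)

/-- Multiplication by scalars in the fibres of the cotangent bundle. -/
def scale (r : ℝ) (ξ : Cot n M) : Cot n M := ⟨ξ.proj, r • covec ξ⟩

@[simp] lemma proj_scale (r : ℝ) (ξ : Cot n M) : (scale r ξ).proj = ξ.proj := rfl

lemma cotCoord_scale (κ : OpenPartialHomeomorph M V) (r : ℝ) (ξ : Cot n M) :
    cotCoord κ (scale r ξ) = ((cotCoord κ ξ).1, r • (cotCoord κ ξ).2) :=
  Prod.ext rfl rfl

namespace IsSmoothChart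

variable {κ : OpenPartialHomeomorph M V} (hκ : IsSmoothChart (𝓡 n) κ)
include hκ

lemma dCotCoord_hamField_eq {ξ : Cot n M} (hξ : ξ.proj ∈ κ.source) :
    dCotCoord κ ξ (hamField g ξ) = hamCoord g κ (cotCoord κ ξ) := by
  rw [hamCoord, ContinuousLinearEquiv.eq_symm_apply]
  exact hκ.sympl_dCotCoord_hamField g hξ

lemma contDiffOn_hamCoord : ContDiffOn ℝ ∞ (hamCoord g κ) (κ.target ×ˢ univ) := by
  have h1 : ContDiffOn ℝ ∞ (fderiv ℝ (energy g ∘ cotCoordSymm n κ)) (κ.target ×ˢ univ) :=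
    (hκ.contDiffOn_energy g).fderiv_of_isOpen hκ.cotLift.open_target (by norm_num)
  exact (symplEquiv V).symm.contDiff.comp_contDiffOn h1

lemma hamCoord_fst {P : V × (V →L[ℝ] ℝ)} (hP : P.1 ∈ κ.target) :
    (hamCoord g κ P).1 = (chartMetric g κ P.1).inverse P.2 := by
  have h1 : (cotCoordSymm n κ P).proj ∈ κ.source := κ.map_target hP
  have h2 := (hκ.dCotCoord_hamField g h1).1
  rw [hκ.dCotCoord_hamField_eq g h1, hκ.cotCoord_cotCoordSymm hP] at h2
  have h3 : κ (cotCoordSymm n κ P).proj = P.1 := κ.right_inv hP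
  rwa [h3] at h2

lemma hamCoord_snd {P : V × (V →L[ℝ] ℝ)} (hP : P.1 ∈ κ.target) (v : V) :
    (hamCoord g κ P).2 v =
      - (P.2 (fderiv ℝ (fun z => (chartMetric g κ z).inverse) P.1 v P.2) / 2) := by
  have h1 : (cotCoordSymm n κ P).proj ∈ κ.source := κ.map_target hP
  have h2 := (hκ.dCotCoord_hamField g h1).2 v
  rw [hκ.dCotCoord_hamField_eq g h1, hκ.cotCoord_cotCoordSymm hP] at h2
  have h3 : κ (cotCoordSymm n κ P).proj = P.1 := κ.right_inv hP
  rwa [h3] at h2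

lemma hamCoord_scale {P : V × (V →L[ℝ] ℝ)} (hP : P.1 ∈ κ.target) (r : ℝ) :
    hamCoord g κ (P.1, r • P.2) = (r • (hamCoord g κ P).1, r • r • (hamCoord g κ P).2) := by
  refine Prod.ext ?_ (ContinuousLinearMap.ext fun v => ?_)
  · have h1 := hκ.hamCoord_fst g (P := (P.1, r • P.2)) hP
    rw [map_smul, ← hκ.hamCoord_fst g hP] at h1
    exact h1
  · have h1 := hκ.hamCoord_snd g (P := (P.1, r • P.2)) hP v
    have h2 := hκ.hamCoord_snd g hP v
    change _ = r * (r * (hamCoord g κ P).2 v)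
    rw [h1, h2]
    simp only [map_smul, smul_apply, smul_eq_mul]
    ring

lemma hamCoord_fst_eq_raise {ξ : Cot n M} (hξ : ξ.proj ∈ κ.source) :
    (hamCoord g κ (cotCoord κ ξ)).1 = dChart κ ξ.proj (raise g ξ) := by
  have hP : (cotCoord κ ξ).1 ∈ κ.target := κ.map_source hξ
  have h1 := hκ.raise_cotCoordSymm g hP
  rw [hκ.cotCoordSymm_cotCoord hξ] at h1
  rw [hκ.hamCoord_fst g hP, h1]
  exact (hκ.dChart_dChartSymm hξ _).symm

lemma hasDerivAt_cotCoord {γ : ℝ → Cot n M} {t : ℝ} (ht : (γ t).proj ∈ κ.source)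
    (hγ : HasMFDerivAt 𝓘(ℝ, ℝ) (cotModel n) γ t
      ((1 : ℝ →L[ℝ] ℝ).smulRight (hamSection g (γ t)))) :
    HasDerivAt (cotCoord κ ∘ γ) (hamCoord g κ (cotCoord κ (γ t))) t := by
  rw [← hκ.dCotCoord_hamField_eq g ht]
  exact hκ.isSmoothChart_cotLift.hasDerivAt_curve ht hγ

lemma hasMFDerivAt_of_cotCoord {γ : ℝ → Cot n M} {t : ℝ}
    (ht : ∀ᶠ s in 𝓝 t, (γ s).proj ∈ κ.source)
    (hγ : HasDerivAt (cotCoord κ ∘ γ) (hamCoord g κ (cotCoord κ (γ t))) t) :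
    HasMFDerivAt 𝓘(ℝ, ℝ) (cotModel n) γ t
      ((1 : ℝ →L[ℝ] ℝ).smulRight (hamSection g (γ t))) := by
  refine hκ.isSmoothChart_cotLift.hasMFDerivAt_curve ht ?_
  rw [← hκ.dCotCoord_hamField_eq g ht.self_of_nhds] at hγ
  exact hγ

end IsSmoothChart

variable [T2Space M] [CompactSpace M]

lemma continuous_geoFlow : Continuous (fun P : ℝ × Cot n M => geoFlow g P.1 P.2) :=
  (contMDiff_geoFlow g).continuous

/-- The flow of the energy is homogeneous. -/
lemma geoFlow_scale (r t : ℝ) (ξ : Cot n M) :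
    geoFlow g t (scale r ξ) = scale r (geoFlow g (r * t) ξ) := by
  have h1 : IsMIntegralCurve (I := cotModel n) (fun s => scale r (geoFlow g (r * s) ξ))
      (hamSection g) := by
    intro s
    let κ := chartAt (EuclideanSpace ℝ (Fin n)) (geoFlow g (r * s) ξ).proj
    have hκ : IsSmoothChart (𝓡 n) κ := isSmoothChart_chartAt _
    have hs : (geoFlow g (r * s) ξ).proj ∈ κ.source := mem_chart_source _ _
    refine hκ.hasMFDerivAt_of_cotCoord g ?_ ?_
    · have hc : Continuous (fun s => (geoFlow g (r * s) ξ).proj) :=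
        contMDiff_cot_proj.continuous.comp ((continuous_geoFlow g).comp
          ((continuous_const.mul continuous_id).prodMk continuous_const))
      exact hc.continuousAt.preimage_mem_nhds (κ.open_source.mem_nhds hs)
    · have h2 := hκ.hasDerivAt_cotCoord g hs (isMIntegralCurve_geoFlow g ξ (r * s))
      have h3 : HasDerivAt (fun s => r * s) r s := by simpa using (hasDerivAt_id s).const_mul r
      have h4 := HasDerivAt.scomp s h2 h3
      let A : (EuclideanSpace ℝ (Fin n) × (EuclideanSpace ℝ (Fin n) →L[ℝ] ℝ)) →L[ℝ]
          EuclideanSpace ℝ (Fin n) × (EuclideanSpace ℝ (Fin n) →L[ℝ] ℝ) :=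
        (ContinuousLinearMap.fst ℝ _ _).prod (r • ContinuousLinearMap.snd ℝ _ _)
      have h5 := A.hasFDerivAt.comp_hasDerivAt s h4
      have h6 := hκ.hamCoord_scale g (P := cotCoord κ (geoFlow g (r * s) ξ)) (κ.map_source hs) r
      rw [cotCoord_scale, h6]
      exact h5
  have h2 := eq_geoFlow g h1 t
  simp only [mul_zero, geoFlow_zero] at h2
  exact h2.symm

end GeoFlow

/-! ### Tangent spaces and retractions -/

section Retraction

variable {V : Type*} [NormedAddCommGroup V] [NormedSpace ℝ V] {H : Type*} [TopologicalSpace H]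
  {I : ModelWithCorners ℝ V H} {X : Type*} [TopologicalSpace X] [ChartedSpace H X]

lemma tangentSet_mono {S T : Set X} {x : X} (h : S ⊆ T) : tangentSet I S x ⊆ tangentSet I T x := by
  rintro v ⟨c, h0, hS, hc, hv⟩
  exact ⟨c, h0, hS.mono fun s hs => h hs, hc, hv⟩

/-- A smooth self-map that fixes `x` and maps `S` to `T` maps tangent vectors to tangent vectors. -/
lemma mfderiv_mem_tangentSet {S T : Set X} {x : X} {D : X → X} (hD : ContMDiffAt I I ∞ D x)
    (hx : D x = x) (hST : ∀ z ∈ S, D z ∈ T) {v : V} (hv : v ∈ tangentSet I S x) {L : V →L[ℝ] V}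
    (hL : L = mfderiv I I D x) : L v ∈ tangentSet I T x := by
  obtain ⟨c, rfl, hS, hc, rfl⟩ := hv
  refine ⟨D ∘ c, hx, hS.mono fun s hs => hST _ hs, hD.comp (0 : ℝ) hc, ?_⟩
  have h1 := ((hD.mdifferentiableAt (by simp)).hasMFDerivAt.comp (0 : ℝ)
    (hc.mdifferentiableAt (by simp)).hasMFDerivAt).mfderiv
  rw [hL]
  exact congrArg (fun A => A (1 : ℝ)) h1

/-- A curve that stays in S is not changed by R, so neither is its velocity. -/
lemma mfderiv_tangentSet_of_eq_id {S : Set X} {x : X} {R : X → X} (hR : MDifferentiableAt I I R x)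
    (hRS : ∀ z ∈ S, R z = z) {v : V} (hv : v ∈ tangentSet I S x) {L : V →L[ℝ] V}
    (hL : L = mfderiv I I R x) : L v = v := by
  obtain ⟨c, rfl, hS, hc, rfl⟩ := hv
  have h0 := (hc.mdifferentiableAt (by simp)).hasMFDerivAt
  have h1 : HasMFDerivAt 𝓘(ℝ, ℝ) I (R ∘ c) 0 _ := hR.hasMFDerivAt.comp (0 : ℝ) h0
  have h2 : R ∘ c =ᶠ[𝓝 0] c := hS.mono fun s hs => hRS _ hs
  have h3 := (h2.mfderiv_eq (I := 𝓘(ℝ, ℝ)) (I' := I)).symm.trans h1.mfderiv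
  rw [hL]
  exact (congrArg (fun A => A (1 : ℝ)) h3).symm

/-- The tangent spaces of two sets intersect in the tangent space of the intersection if the
sets are fixed by maps whose composition maps the first to the intersection. -/
lemma tangentSet_inter_of_retractions {S T : Set X} {x : X} (hx : x ∈ S ∩ T) {R Q : X → X}
    (hR : ContMDiffAt I I ∞ R x) (hQ : ContMDiffAt I I ∞ Q x) (hRS : ∀ z ∈ S, R z = z)
    (hQT : ∀ z ∈ T, Q z = z) (hRQ : ∀ z ∈ S, R (Q z) ∈ S ∩ T) :
    tangentSet I (S ∩ T) x = tangentSet I S x ∩ tangentSet I T x := by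
  refine Subset.antisymm (subset_inter (tangentSet_mono inter_subset_left)
    (tangentSet_mono inter_subset_right)) ?_
  rintro v ⟨hvS, hvT⟩
  have hQx : Q x = x := hQT x hx.2
  have hRx : R x = x := hRS x hx.1
  let LR : V →L[ℝ] V := mfderiv I I R x
  let LQ : V →L[ℝ] V := mfderiv I I Q x
  have h1 : LR v = v := mfderiv_tangentSet_of_eq_id (hR.mdifferentiableAt (by simp)) hRS hvS rfl
  have h2 : LQ v = v := mfderiv_tangentSet_of_eq_id (hQ.mdifferentiableAt (by simp)) hQT hvT rfl
  have hR' : ContMDiffAt I I ∞ R (Q x) := by rwa [hQx]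
  have hD : ContMDiffAt I I ∞ (R ∘ Q) x := hR'.comp x hQ
  have h3 : LR ∘L LQ = mfderiv I I (R ∘ Q) x := by
    have h4 := mfderiv_comp x (hR'.mdifferentiableAt (by simp)) (hQ.mdifferentiableAt (by simp))
    have h5 : (mfderiv I I R (Q x) : V →L[ℝ] V) = LR := by
      change (fun y => (mfderiv I I R y : V →L[ℝ] V)) (Q x) = _
      rw [hQx]
    rw [← h5]
    exact h4.symm
  -- The differential of R ∘ Q maps vectors tangent to S to vectors tangent to S ∩ T. As v is fixed
  -- by both differentials, it is its own image.
  have h6 := mfderiv_mem_tangentSet hD (by simp [hQx, hRx]) (T := S ∩ T) hRQ hvS h3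
  have h7 : LR (LQ v) = v := (congrArg LR h2).trans h1
  exact h7 ▸ h6

end Retraction

/-! ### The half-wave canonical relation -/

section Wave

variable {n : ℕ} {M : Type*} [TopologicalSpace M] [ChartedSpace (EuclideanSpace ℝ (Fin n)) M]
  [IsManifold (𝓡 n) ∞ M]
  (g : ContMDiffRiemannianMetric (𝓡 n) ∞ (EuclideanSpace ℝ (Fin n))
    (fun x : M => TangentSpace (𝓡 n) x))

lemma contMDiffAt_conorm {ξ : Cot n M} (hξ : covec ξ ≠ 0) :
    ContMDiffAt (cotModel n) 𝓘(ℝ, ℝ) ∞ (conorm g) ξ := by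
  have h1 : ContDiffAt ℝ ∞ (fun x : ℝ => √(2 * x)) (energy g ξ) :=
    (contDiffAt_const.mul contDiffAt_id).sqrt (mul_pos two_pos (energy_pos g hξ)).ne'
  have h2 := h1.contMDiffAt.comp ξ (contMDiff_energy g).contMDiffAt
  exact h2.congr_of_eventuallyEq (Filter.Eventually.of_forall fun η => conorm_eq g η)

/-- The differential of a function on the cotangent bundle. -/
def dCot (h : Cot n M → ℝ) (ξ : Cot n M) :
    (EuclideanSpace ℝ (Fin n) × (EuclideanSpace ℝ (Fin n) →L[ℝ] ℝ)) →L[ℝ] ℝ :=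
  mfderiv (cotModel n) 𝓘(ℝ, ℝ) h ξ

lemma dCot_conorm {ξ : Cot n M} (hξ : covec ξ ≠ 0)
    (Y : EuclideanSpace ℝ (Fin n) × (EuclideanSpace ℝ (Fin n) →L[ℝ] ℝ)) :
    dCot (conorm g) ξ Y = (conorm g ξ)⁻¹ * dCot (energy g) ξ Y := by
  have hE := energy_pos g hξ
  have h1 : HasDerivAt (fun x : ℝ => √(2 * x)) ((conorm g ξ)⁻¹) (energy g ξ) := by
    have := ((hasDerivAt_id (energy g ξ)).const_mul 2).sqrt (mul_pos two_pos hE).ne'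
    refine this.congr_deriv ?_
    rw [conorm_eq, mul_one, id, div_mul_eq_div_div, div_self two_ne_zero, one_div]
  have h2 := (h1.hasFDerivAt.hasMFDerivAt.comp ξ
    (mdifferentiableAt_energy g ξ).hasMFDerivAt).mfderiv
  have h3 : conorm g = (fun x : ℝ => √(2 * x)) ∘ energy g := funext (conorm_eq g)
  have h4 : dCot (conorm g) ξ Y = dCot ((fun x : ℝ => √(2 * x)) ∘ energy g) ξ Y := by rw [← h3]
  refine h4.trans ((congrArg (fun A => A Y) h2).trans ?_)
  exact mul_comm (dCot (energy g) ξ Y) (conorm g ξ)⁻¹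

/-- The norm is √(2E), so its differential is that of the energy E divided by the norm. Since the
norm is constant along trajectories, the two flows differ by a change of time that is linear on each
trajectory. -/
lemma isHamiltonianVector_conorm_iff {ξ : Cot n M} (hξ : covec ξ ≠ 0)
    {X : EuclideanSpace ℝ (Fin n) × (EuclideanSpace ℝ (Fin n) →L[ℝ] ℝ)} :
    IsHamiltonianVector (conorm g) ξ X ↔ X = (conorm g ξ)⁻¹ • hamField g ξ := by
  have hc := (conorm_pos g hξ).ne'
  have h1 : IsHamiltonianVector (conorm g) ξ X ↔
      IsHamiltonianVector (energy g) ξ (conorm g ξ • X) := by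
    have h2 (Y : EuclideanSpace ℝ (Fin n) × (EuclideanSpace ℝ (Fin n) →L[ℝ] ℝ)) :
        symplecticForm ξ (conorm g ξ • X) Y = conorm g ξ * symplecticForm ξ X Y :=
      congrArg (fun A => A Y) ((sympl (EuclideanSpace ℝ (Fin n))).map_smul (conorm g ξ) X)
    constructor
    · intro h Y
      refine (h2 Y).trans ?_
      refine (congrArg (fun r => conorm g ξ * r) ((h Y).trans (dCot_conorm g hξ Y))).trans ?_
      exact mul_inv_cancel_left₀ hc _
    · intro h Y
      refine Eq.trans ?_ (dCot_conorm g hξ Y).symm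
      refine Eq.trans ?_ (congrArg (fun r => (conorm g ξ)⁻¹ * r) ((h2 Y).symm.trans (h Y)))
      exact (inv_mul_cancel_left₀ hc _).symm
  rw [h1, isHamiltonianVector_energy_iff, eq_inv_smul_iff₀ hc]

include g in
lemma isOpen_covec_ne_zero : IsOpen {ξ : Cot n M | covec ξ ≠ 0} := by
  have h : {ξ : Cot n M | covec ξ ≠ 0} = {ξ | energy g ξ ≠ 0} := by
    ext ξ
    exact (not_congr (energy_eq_zero g)).symm
  rw [h]
  exact isOpen_ne_fun (contMDiff_energy g).continuous continuous_const

variable [T2Space M] [CompactSpace M]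

/-- The hamiltonian flow of the norm. -/
def waveFlow (t : ℝ) (ξ : Cot n M) : Cot n M := geoFlow g (t / conorm g ξ) ξ

/-- The energy is constant along a trajectory c, so with r = |c(0)| the curve s ↦ c(rs) is an
integral curve of the hamiltonian field of the energy, and uniqueness applies. The converse is the
same computation backwards. -/
lemma isHamiltonianTrajectory_conorm_iff {c : ℝ → Cot n M} :
    IsHamiltonianTrajectory (conorm g) c ↔ covec (c 0) ≠ 0 ∧ ∀ t, c t = waveFlow g t (c 0) := by
  constructor
  · intro hc
    have hne : ∀ s, covec (c s) ≠ 0 := fun s => (hc s).1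
    refine ⟨hne 0, ?_⟩
    have hv : ∀ s, (mfderiv 𝓘(ℝ, ℝ) (cotModel n) c s (1 : ℝ) :
        EuclideanSpace ℝ (Fin n) × (EuclideanSpace ℝ (Fin n) →L[ℝ] ℝ)) =
        (conorm g (c s))⁻¹ • hamField g (c s) := fun s =>
      (isHamiltonianVector_conorm_iff g (hne s)).1 (hc s).2.2
    have hE : ∀ s, energy g (c s) = energy g (c 0) := by
      have hd : ∀ s, HasDerivAt (energy g ∘ c) 0 s := by
        intro s
        let L : ℝ →L[ℝ] ℝ := (mfderiv (cotModel n) 𝓘(ℝ, ℝ) (energy g) (c s)).comp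
          (mfderiv 𝓘(ℝ, ℝ) (cotModel n) c s)
        have h1 : HasFDerivAt (energy g ∘ c) L s :=
          ((mdifferentiableAt_energy g (c s)).hasMFDerivAt.comp s
            (hc s).2.1.hasMFDerivAt).hasFDerivAt
        have h2 : L 1 = 0 := by
          refine (congrArg (mfderiv (cotModel n) 𝓘(ℝ, ℝ) (energy g) (c s)) (hv s)).trans ?_
          refine ((mfderiv (cotModel n) 𝓘(ℝ, ℝ) (energy g) (c s)).map_smul _ _).trans ?_
          refine (congrArg (fun r : ℝ => (conorm g (c s))⁻¹ • r)
            (mfderiv_energy_hamField g (c s))).trans (smul_zero _)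
        exact h2 ▸ h1.hasDerivAt
      intro s
      exact is_const_of_deriv_eq_zero (fun x => (hd x).differentiableAt) (fun x => (hd x).deriv) s 0
    have hr : ∀ s, conorm g (c s) = conorm g (c 0) := fun s => by
      rw [conorm_eq, conorm_eq, hE]
    set r := conorm g (c 0) with hrdef
    have hr0 : r ≠ 0 := (conorm_pos g (hne 0)).ne'
    have hγ : IsMIntegralCurve (I := cotModel n) (fun s => c (r * s)) (hamSection g) := by
      intro s
      have h3 : HasDerivAt (fun s => r * s) r s := by simpa using (hasDerivAt_id s).const_mul r
      have h4 := (hc (r * s)).2.1.hasMFDerivAt.comp s h3.hasFDerivAt.hasMFDerivAt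
      refine ⟨h4.1, ?_⟩
      have h5 : (mfderiv 𝓘(ℝ, ℝ) (cotModel n) c (r * s)).comp
          (ContinuousLinearMap.toSpanSingleton ℝ r) =
          (1 : ℝ →L[ℝ] ℝ).smulRight (hamSection g (c (r * s))) := by
        refine ContinuousLinearMap.ext fun x => ?_
        have e1 : (mfderiv 𝓘(ℝ, ℝ) (cotModel n) c (r * s)) ((x * r) • (1 : ℝ)) =
            x • hamField g (c (r * s)) := by
          refine ((mfderiv 𝓘(ℝ, ℝ) (cotModel n) c (r * s)).map_smul _ _).trans ?_
          refine (congrArg (fun v : EuclideanSpace ℝ (Fin n) × (EuclideanSpace ℝ (Fin n) →L[ℝ] ℝ)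
            => (x * r) • v) (hv (r * s))).trans ?_
          rw [hr, smul_smul, mul_assoc, mul_inv_cancel₀ hr0, mul_one]
        refine Eq.trans ?_ e1
        refine congrArg (mfderiv 𝓘(ℝ, ℝ) (cotModel n) c (r * s)) ?_
        exact (mul_one (x * r)).symm
      rw [← h5]
      exact h4.2
    intro t
    have h6 := eq_geoFlow g hγ (t / r)
    simp only [mul_zero, mul_div_cancel₀ t hr0] at h6
    exact h6
  · rintro ⟨h0, hc⟩ s
    set r := conorm g (c 0) with hrdef
    have hr0 : r ≠ 0 := (conorm_pos g h0).ne'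
    have hce : c = fun s => geoFlow g (s / r) (c 0) := funext hc
    have hne : covec (c s) ≠ 0 := by
      rw [hc s]
      exact covec_geoFlow_ne_zero g h0
    have h3 : HasDerivAt (fun s => s / r) r⁻¹ s := by
      simpa using (hasDerivAt_id s).div_const r
    have h4 := (isMIntegralCurve_geoFlow g (c 0) (s / r)).comp s h3.hasFDerivAt.hasMFDerivAt
    have h4' : HasMFDerivAt 𝓘(ℝ, ℝ) (cotModel n) c s _ :=
      h4.congr_of_eventuallyEq (Filter.Eventually.of_forall fun s => congrFun hce s)
    refine ⟨hne, h4'.mdifferentiableAt, (isHamiltonianVector_conorm_iff g hne).2 ?_⟩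
    have h5 : conorm g (c s) = r := by rw [hc s]; exact conorm_geoFlow g _ _
    have h6 : c s = geoFlow g (s / r) (c 0) := hc s
    have h7 : hamField g (c s) = hamField g (geoFlow g (s / r) (c 0)) := by rw [← h6]
    rw [h5, h7]
    refine (congrArg (fun A => A (1 : ℝ)) h4'.mfderiv).trans ?_
    have h8 : ((1 : ℝ →L[ℝ] ℝ).smulRight (hamField g (geoFlow g (s / r) (c 0))))
        ((1 : ℝ) • r⁻¹) = r⁻¹ • hamField g (geoFlow g (s / r) (c 0)) := by simp
    exact h8

lemma covec_waveFlow_ne_zero {t : ℝ} {ξ : Cot n M} (hξ : covec ξ ≠ 0) :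
    covec (waveFlow g t ξ) ≠ 0 := covec_geoFlow_ne_zero g hξ

lemma conorm_waveFlow (t : ℝ) (ξ : Cot n M) : conorm g (waveFlow g t ξ) = conorm g ξ :=
  conorm_geoFlow g _ _

lemma waveFlow_add (s t : ℝ) (ξ : Cot n M) :
    waveFlow g (s + t) ξ = waveFlow g s (waveFlow g t ξ) := by
  rw [waveFlow, waveFlow, conorm_waveFlow, waveFlow, ← geoFlow_add, add_div]

@[simp] lemma waveFlow_zero (ξ : Cot n M) : waveFlow g 0 ξ = ξ := by simp [waveFlow]

lemma mem_waveRelation_iff {σ : ℝ} {P : Cot n M × Cot n M × (ℝ × ℝ)} :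
    P ∈ waveRelation g σ ↔
      covec P.2.1 ≠ 0 ∧ P.1 = waveFlow g P.2.2.1 P.2.1 ∧ P.2.2.2 = σ * conorm g P.2.1 := by
  constructor
  · rintro ⟨c, hc, h0, h1, h2⟩
    obtain ⟨h3, h4⟩ := (isHamiltonianTrajectory_conorm_iff g).1 hc
    rw [h0] at h3 h4
    exact ⟨h3, by rw [← h1, h4], h2⟩
  · rintro ⟨h0, h1, h2⟩
    refine ⟨fun t => waveFlow g t P.2.1, (isHamiltonianTrajectory_conorm_iff g).2 ?_, ?_, h1.symm, h2⟩
    · simpa using h0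
    · simp

lemma contMDiffOn_waveFlow : ContMDiffOn (𝓘(ℝ, ℝ).prod (cotModel n)) (cotModel n) ∞
    (fun P : ℝ × Cot n M => waveFlow g P.1 P.2) {P | covec P.2 ≠ 0} := by
  intro P hP
  refine ContMDiffAt.contMDiffWithinAt ?_
  have h1 : ContMDiffAt (𝓘(ℝ, ℝ).prod (cotModel n)) 𝓘(ℝ, ℝ) ∞
      (fun P : ℝ × Cot n M => conorm g P.2) P :=
    (contMDiffAt_conorm g hP).comp P contMDiffAt_snd
  have h2 : ContMDiffAt (𝓘(ℝ, ℝ).prod (cotModel n)) 𝓘(ℝ, ℝ) ∞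
      (fun P : ℝ × Cot n M => P.1 / conorm g P.2) P :=
    contMDiffAt_fst.div₀ h1 (conorm_pos g hP).ne'
  exact (contMDiff_geoFlow g).contMDiffAt.comp P (h2.prodMk contMDiffAt_snd)

/-- With (η, t) as free coordinates, the remaining ones are the smooth functions ξ = Φᵗ(η) and τ =
σ|η| on the open set η ≠ 0. -/
lemma isSubmanifold_waveRelation (σ : ℝ) :
    IsSubmanifold ((cotModel n).prod ((cotModel n).prod 𝓘(ℝ, ℝ × ℝ))) (waveRelation g (M := M) σ) := by
  intro P hP
  have hP' := (mem_waveRelation_iff g).1 hP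
  refine exists_isSubmanifoldAt_of_graph (I' := (cotModel n).prod 𝓘(ℝ, ℝ))
    (J := (cotModel n).prod 𝓘(ℝ, ℝ)) (hasSmoothCharts_cot.prod hasSmoothCharts_self)
    (g := fun P : Cot n M × Cot n M × (ℝ × ℝ) => (P.2.1, P.2.2.1))
    (A := fun P : Cot n M × Cot n M × (ℝ × ℝ) => (P.1, P.2.2.2))
    (s := fun Q : (Cot n M × ℝ) × (Cot n M × ℝ) => (Q.2.1, Q.1.1, (Q.1.2, Q.2.2)))
    (B := fun Q : Cot n M × ℝ => (waveFlow g Q.2 Q.1, σ * conorm g Q.1))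
    (S' := {Q | covec Q.1 ≠ 0}) (O := {Q | covec Q.1 ≠ 0}) ?_ ?_ ?_ (fun _ => rfl) (fun _ => rfl)
    ((isOpen_covec_ne_zero g).preimage continuous_fst) hP'.1 ?_ ?_
    (exists_isSubmanifoldAt_of_isOpen ((isOpen_covec_ne_zero g).preimage continuous_fst) hP'.1) ?_
  · exact contMDiff_fst.comp contMDiff_snd |>.prodMk
      (contDiff_fst.contMDiff.comp (contMDiff_snd.comp contMDiff_snd))
  · exact contMDiff_fst.prodMk (contDiff_snd.contMDiff.comp (contMDiff_snd.comp contMDiff_snd))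
  · exact (contMDiff_fst.comp contMDiff_snd).prodMk ((contMDiff_fst.comp contMDiff_fst).prodMk
      ((contMDiff_snd.comp contMDiff_fst).prodMk_space (contMDiff_snd.comp contMDiff_snd)))
  · refine ContMDiffOn.prodMk ?_ ?_
    · exact (contMDiffOn_waveFlow g).comp (contMDiff_snd.prodMk contMDiff_fst).contMDiffOn
        fun Q hQ => hQ
    · intro Q hQ
      exact (contMDiffAt_const.mul
        ((contMDiffAt_conorm g hQ).comp Q contMDiffAt_fst)).contMDiffWithinAt
  · exact Prod.ext hP'.2.1 hP'.2.2
  · intro z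
    rw [mem_waveRelation_iff]
    exact and_congr_right fun _ => ⟨fun h => Prod.ext h.1 h.2,
      fun h => ⟨congrArg Prod.fst h, congrArg Prod.snd h⟩⟩

/-- A submanifold of pairs of covectors, the second of which does not vanish, meets the canonical
relation of the half-wave group cleanly. -/
theorem cleanIntersection_waveRelation {σ : ℝ} {S : Set (Cot n M × Cot n M)}
    (hS : IsSubmanifold ((cotModel n).prod (cotModel n)) S) (hS0 : ∀ P ∈ S, covec P.2 ≠ 0) :
    CleanIntersection (ambientModel n) (S ×ˢ waveRelation g σ) (diagonalY n M) := by
  -- On the intersection everything is determined by the pair (η, ξ) in S and by t: the relation ξ =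
  -- Φᵗ(θ) is solved for θ by reversing time, and θ has the same norm as ξ. This exhibits a graph
  -- over S × ℝ.
  have hmem : ∀ z : (Cot n M × Cot n M) × (Cot n M × Cot n M × (ℝ × ℝ)),
      z ∈ S ×ˢ waveRelation g σ ∩ diagonalY n M ↔ z.1 ∈ S ∧ z.2.1 = z.1.2 ∧
        z.2.2.1 = waveFlow g (-z.2.2.2.1) z.1.2 ∧ z.2.2.2.2 = σ * conorm g z.1.2 := by
    rintro ⟨⟨η, ξ⟩, Ξ, θ, t, τ⟩
    simp only [mem_inter_iff, mem_prod, mem_waveRelation_iff]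
    constructor
    · rintro ⟨⟨h1, h2, h3, h4⟩, h5⟩
      have h6 : ξ = Ξ := h5
      subst h6
      refine ⟨h1, rfl, ?_, ?_⟩
      · rw [h3, ← waveFlow_add, neg_add_cancel, waveFlow_zero]
      · rw [h4, h3, conorm_waveFlow]
    · rintro ⟨h1, rfl, rfl, rfl⟩
      refine ⟨⟨h1, covec_waveFlow_ne_zero g (hS0 _ h1), ?_, ?_⟩, rfl⟩
      · rw [← waveFlow_add, add_neg_cancel, waveFlow_zero]
      · rw [conorm_waveFlow]
  have hflow : ∀ {ξ : Cot n M} {t : ℝ}, covec ξ ≠ 0 →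
      ContMDiffAt (𝓘(ℝ, ℝ).prod (cotModel n)) (cotModel n) ∞
        (fun P : ℝ × Cot n M => waveFlow g P.1 P.2) (t, ξ) := fun {ξ t} h =>
    (contMDiffOn_waveFlow g).contMDiffAt
      (((isOpen_covec_ne_zero g).preimage continuous_snd).mem_nhds h)
  refine ⟨fun x hx => exists_isSubmanifoldAt_prod (hS x.1 hx.1)
    (isSubmanifold_waveRelation g σ x.2 hx.2), ?_, ?_, ?_⟩
  · intro x hx
    refine exists_isSubmanifoldAt_of_graph
      (I' := (cotModel n).prod ((cotModel n).prod ((cotModel n).prod 𝓘(ℝ, ℝ × ℝ))))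
      (J := cotModel n) hasSmoothCharts_cot
      (g := fun z : (Cot n M × Cot n M) × (Cot n M × Cot n M × (ℝ × ℝ)) => (z.1.1, z.2))
      (A := fun z : (Cot n M × Cot n M) × (Cot n M × Cot n M × (ℝ × ℝ)) => z.1.2)
      (s := fun w : (Cot n M × (Cot n M × Cot n M × (ℝ × ℝ))) × Cot n M => ((w.1.1, w.2), w.1.2))
      (B := fun w : Cot n M × (Cot n M × Cot n M × (ℝ × ℝ)) => w.2.1)
      (S' := univ) (O := univ) ?_ ?_ ?_ (fun _ => rfl) (fun _ => rfl) isOpen_univ (mem_univ _) ?_ hx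
      (exists_isSubmanifoldAt_of_isOpen isOpen_univ (mem_univ _)) ?_
    · exact (contMDiff_fst.comp contMDiff_fst).prodMk contMDiff_snd
    · exact contMDiff_snd.comp contMDiff_fst
    · exact ((contMDiff_fst.comp contMDiff_fst).prodMk contMDiff_snd).prodMk
        (contMDiff_snd.comp contMDiff_fst)
    · exact (contMDiff_fst.comp contMDiff_snd).contMDiffOn
    · intro z
      exact ⟨fun h => ⟨mem_univ _, h⟩, fun h => h.2⟩
  · intro x hx
    have hx' := (hmem x).1 hx
    refine exists_isSubmanifoldAt_of_graph
      (I' := ((cotModel n).prod (cotModel n)).prod 𝓘(ℝ, ℝ))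
      (J := (cotModel n).prod ((cotModel n).prod 𝓘(ℝ, ℝ)))
      (hasSmoothCharts_cot.prod (hasSmoothCharts_cot.prod hasSmoothCharts_self))
      (g := fun z : (Cot n M × Cot n M) × (Cot n M × Cot n M × (ℝ × ℝ)) => (z.1, z.2.2.2.1))
      (A := fun z : (Cot n M × Cot n M) × (Cot n M × Cot n M × (ℝ × ℝ)) =>
        (z.2.1, z.2.2.1, z.2.2.2.2))
      (s := fun w : ((Cot n M × Cot n M) × ℝ) × (Cot n M × Cot n M × ℝ) =>
        (w.1.1, w.2.1, w.2.2.1, (w.1.2, w.2.2.2)))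
      (B := fun w : (Cot n M × Cot n M) × ℝ =>
        (w.1.2, waveFlow g (-w.2) w.1.2, σ * conorm g w.1.2))
      (S' := S ×ˢ univ) (O := {w | covec w.1.2 ≠ 0}) ?_ ?_ ?_ (fun _ => rfl) (fun _ => rfl)
      ((isOpen_covec_ne_zero g).preimage (continuous_snd.comp continuous_fst)) (hS0 _ hx'.1) ?_ ?_
      (exists_isSubmanifoldAt_prod (hS x.1 hx'.1)
        (exists_isSubmanifoldAt_of_isOpen (I := 𝓘(ℝ, ℝ)) isOpen_univ (mem_univ _))) ?_
    · exact contMDiff_fst.prodMk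
        (contDiff_fst.contMDiff.comp (contMDiff_snd.comp (contMDiff_snd.comp contMDiff_snd)))
    · exact (contMDiff_fst.comp contMDiff_snd).prodMk
        ((contMDiff_fst.comp (contMDiff_snd.comp contMDiff_snd)).prodMk
        (contDiff_snd.contMDiff.comp (contMDiff_snd.comp (contMDiff_snd.comp contMDiff_snd))))
    · exact (contMDiff_fst.comp contMDiff_fst).prodMk ((contMDiff_fst.comp contMDiff_snd).prodMk
        ((contMDiff_fst.comp (contMDiff_snd.comp contMDiff_snd)).prodMk
          ((contMDiff_snd.comp contMDiff_fst).prodMk_space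
            (contMDiff_snd.comp (contMDiff_snd.comp contMDiff_snd)))))
    · refine (contMDiff_snd.comp contMDiff_fst).contMDiffOn.prodMk (ContMDiffOn.prodMk ?_ ?_)
      · have e1 : ContMDiff (((cotModel n).prod (cotModel n)).prod 𝓘(ℝ, ℝ)) 𝓘(ℝ, ℝ) ∞
            (fun w : (Cot n M × Cot n M) × ℝ => -w.2) :=
          contDiff_neg.contMDiff.comp contMDiff_snd
        exact (contMDiffOn_waveFlow g).comp
          (e1.prodMk (contMDiff_snd.comp contMDiff_fst)).contMDiffOn fun Q hQ => hQ
      · intro Q hQ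
        have e1 : ContMDiffAt (((cotModel n).prod (cotModel n)).prod 𝓘(ℝ, ℝ)) (cotModel n) ∞
            (fun w : (Cot n M × Cot n M) × ℝ => w.1.2) Q :=
          (contMDiff_snd.comp contMDiff_fst).contMDiffAt
        have hQ' : covec Q.1.2 ≠ 0 := hQ
        exact (contMDiffAt_const.mul (ContMDiffAt.comp (g := conorm g) (I' := cotModel n) Q
          (contMDiffAt_conorm g hQ') e1)).contMDiffWithinAt
    · exact Prod.ext hx'.2.1 (Prod.ext hx'.2.2.1 hx'.2.2.2)
    · intro z
      rw [hmem]
      constructor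
      · rintro ⟨h1, h2, h3, h4⟩
        exact ⟨⟨h1, mem_univ _⟩, Prod.ext h2 (Prod.ext h3 h4)⟩
      · rintro ⟨⟨h1, -⟩, h2⟩
        have h3 := Prod.ext_iff.1 h2
        have h4 := Prod.ext_iff.1 h3.2
        exact ⟨h1, h3.1, h4.1, h4.2⟩
  · intro x hx
    have hx' := (hmem x).1 hx
    have h0 : covec x.1.2 ≠ 0 := hS0 _ hx'.1
    have h0' : covec x.2.1 ≠ 0 := by rw [hx'.2.1]; exact h0
    -- R recomputes the point of `Λ` from its first covector and the time, hence fixes S × Λ. Q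
    -- replaces that first covector by the second covector of the pair in S, hence fixes Y. Applying
    -- Q and then R to a point of S × Λ produces a point of the intersection.
    refine tangentSet_inter_of_retractions hx
      (R := fun z => (z.1, z.2.1, waveFlow g (-z.2.2.2.1) z.2.1,
        (z.2.2.2.1, σ * conorm g z.2.1)))
      (Q := fun z => (z.1, z.1.2, z.2.2)) ?_ ?_ ?_ ?_ ?_
    · have e1 : ContMDiff (ambientModel n) (cotModel n) ∞
          (fun z : (Cot n M × Cot n M) × (Cot n M × Cot n M × (ℝ × ℝ)) => z.2.1) :=
        contMDiff_fst.comp contMDiff_snd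
      have e2 : ContMDiff (ambientModel n) 𝓘(ℝ, ℝ) ∞
          (fun z : (Cot n M × Cot n M) × (Cot n M × Cot n M × (ℝ × ℝ)) => z.2.2.2.1) :=
        contDiff_fst.contMDiff.comp (contMDiff_snd.comp (contMDiff_snd.comp contMDiff_snd))
      have e3 : ContMDiffAt (ambientModel n) (cotModel n) ∞
          (fun z : (Cot n M × Cot n M) × (Cot n M × Cot n M × (ℝ × ℝ)) =>
            waveFlow g (-z.2.2.2.1) z.2.1) x :=
        (hflow h0').comp x ((contDiff_neg.contMDiff.comp e2).prodMk e1).contMDiffAt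
      have e4 : ContMDiffAt (ambientModel n) 𝓘(ℝ, ℝ) ∞
          (fun z : (Cot n M × Cot n M) × (Cot n M × Cot n M × (ℝ × ℝ)) =>
            σ * conorm g z.2.1) x :=
        contMDiffAt_const.mul (ContMDiffAt.comp (g := conorm g) (I' := cotModel n) x
          (contMDiffAt_conorm g h0') e1.contMDiffAt)
      exact contMDiffAt_fst.prodMk (e1.contMDiffAt.prodMk (e3.prodMk
        (e2.contMDiffAt.prodMk_space e4)))
    · exact (contMDiff_fst.prodMk ((contMDiff_snd.comp contMDiff_fst).prodMk
        (contMDiff_snd.comp contMDiff_snd))).contMDiffAt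
    · rintro ⟨⟨η, ξ⟩, Ξ, θ, t, τ⟩ ⟨h1, h2⟩
      obtain ⟨h3, h4, h5⟩ := (mem_waveRelation_iff g).1 h2
      have h4' : Ξ = waveFlow g t θ := h4
      have h5' : τ = σ * conorm g θ := h5
      simp only [h4', h5', ← waveFlow_add, neg_add_cancel, waveFlow_zero, conorm_waveFlow]
    · rintro ⟨⟨η, ξ⟩, Ξ, θ, t, τ⟩ h1
      have h2 : ξ = Ξ := h1
      simp only [h2]
    · rintro ⟨⟨η, ξ⟩, Ξ, θ, t, τ⟩ ⟨h1, h2⟩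
      exact (hmem _).2 ⟨h1, rfl, rfl, rfl⟩

end Wave

/-! ### Distinguished charts, plaques, and sheets in coordinates -/

section Boxes

variable {n : ℕ} {M : Type*} [TopologicalSpace M] [ChartedSpace (EuclideanSpace ℝ (Fin n)) M]
  [IsManifold (𝓡 n) ∞ M] {a b : ℕ}

lemma IsSmoothBox.isSmoothChart {φ : FolChart M a b} (hφ : IsSmoothBox n φ) :
    IsSmoothChart (𝓡 n) φ := ⟨hφ.2.1, hφ.2.2⟩

lemma IsSmoothChart.dTransverse_eq {φ : FolChart M a b} (hφ : IsSmoothChart (𝓡 n) φ) {x : M}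
    (hx : x ∈ φ.source) (w : EuclideanSpace ℝ (Fin n)) :
    dTransverse n φ x w = (dChart φ x w).2 := by
  have h1 : HasMFDerivAt (𝓡 n) 𝓘(ℝ, EuclideanSpace ℝ (Fin b)) (Prod.snd ∘ φ) x _ :=
    (ContinuousLinearMap.snd ℝ (EuclideanSpace ℝ (Fin a))
      (EuclideanSpace ℝ (Fin b))).hasFDerivAt.hasMFDerivAt.comp x
      (hφ.mdifferentiableAt hx).hasMFDerivAt
  exact congrArg (fun A => A w) h1.mfderiv

lemma IsSmoothChart.contMDiffAt_transverse {φ : FolChart M a b} (hφ : IsSmoothChart (𝓡 n) φ)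
    {x : M} (hx : x ∈ φ.source) :
    ContMDiffAt (𝓡 n) 𝓘(ℝ, EuclideanSpace ℝ (Fin b)) ∞ (transverse φ) x :=
  (ContinuousLinearMap.snd ℝ (EuclideanSpace ℝ (Fin a))
    (EuclideanSpace ℝ (Fin b))).contDiff.contMDiff.contMDiffAt.comp x (hφ.contMDiffAt hx)

lemma IsSmoothChart.finrank_eq {φ : FolChart M a b} (hφ : IsSmoothChart (𝓡 n) φ) {x : M}
    (hx : x ∈ φ.source) : a + b = n := by
  let e : EuclideanSpace ℝ (Fin n) ≃L[ℝ] EuclideanSpace ℝ (Fin a) × EuclideanSpace ℝ (Fin b) :=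
    hφ.tangentEquiv hx
  have h := e.toLinearEquiv.finrank_eq
  simpa using h.symm

/-- A submanifold of dimension `a` that contains an `a`-dimensional plaque is equal to it near
each of its points. -/
lemma IsSmoothChart.eventually_transverse_eq {φ : FolChart M a b} (hφ : IsSmoothChart (𝓡 n) φ)
    {x : M} (hx : x ∈ φ.source) {K : Set M} (hK : IsSubmanifoldAt (𝓡 n) K a x)
    (hplaque : ∀ y, SamePlaque φ x y → y ∈ K) :
    ∀ᶠ y in 𝓝 x, y ∈ K → transverse φ y = transverse φ x := by
  obtain ⟨U, hU, hxU, c, hc, f, hf, hfK, hfs⟩ := hK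
  have hcb : c = b := by
    have h1 := hφ.finrank_eq hx
    rw [finrank_euclideanSpace_fin] at hc
    omega
  subst hcb
  let W := EuclideanSpace ℝ (Fin a) × EuclideanSpace ℝ (Fin c)
  let O : Set W := φ.target ∩ φ.symm ⁻¹' U
  have hO : IsOpen O := φ.symm.isOpen_inter_preimage hU
  have hxO : φ x ∈ O := ⟨φ.map_source hx, by rwa [mem_preimage, φ.left_inv hx]⟩
  have hf' : ContDiffOn ℝ ∞ (f ∘ φ.symm) O :=
    contMDiffOn_iff_contDiffOn.1 (hf.comp (hφ.smooth_symm.mono inter_subset_left) fun z hz => hz.2)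
  let L : W →L[ℝ] EuclideanSpace ℝ (Fin c) := fderiv ℝ (f ∘ φ.symm) (φ x)
  have hL : HasFDerivAt (f ∘ φ.symm) L (φ x) :=
    ((hf'.contDiffAt (hO.mem_nhds hxO)).differentiableAt (by simp)).hasFDerivAt
  have hzero : ∀ᶠ u in 𝓝 (φ x).1, (f ∘ φ.symm) (u, (φ x).2) = 0 := by
    have hcont : ContinuousAt (fun u => (u, (φ x).2)) (φ x).1 := by fun_prop
    filter_upwards [hcont.preimage_mem_nhds (hO.mem_nhds hxO)] with u hu
    have h1 : φ.symm (u, (φ x).2) ∈ K := hplaque _ ⟨hx, φ.map_target hu.1, by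
      simp only [transverse, φ.right_inv hu.1]⟩
    have h2 : φ.symm (u, (φ x).2) ∈ K ∩ U := ⟨h1, hu.2⟩
    rw [hfK] at h2
    exact h2.2
  -- The equation f of K vanishes along the plaque, so its derivative kills the leaf directions. By
  -- the equality of dimensions the derivative is then invertible on the transverse directions.
  have hL0 : ∀ u, L (u, 0) = 0 := by
    intro u
    have h1 : HasFDerivAt (fun u => (f ∘ φ.symm) (u, (φ x).2))
        (L ∘L ContinuousLinearMap.inl ℝ _ _) (φ x).1 :=
      HasFDerivAt.comp (φ x).1 (g := f ∘ φ.symm) hL (hasFDerivAt_prodMk_left _ _)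
    have h2 : HasFDerivAt (fun u => (f ∘ φ.symm) (u, (φ x).2))
        (0 : EuclideanSpace ℝ (Fin a) →L[ℝ] EuclideanSpace ℝ (Fin c)) (φ x).1 :=
      (hasFDerivAt_const (0 : EuclideanSpace ℝ (Fin c)) (φ x).1).congr_of_eventuallyEq hzero
    exact congrArg (fun A => A u) (h1.unique h2)
  have hLs : Function.Surjective L := by
    have h1 : HasMFDerivAt (𝓡 n) 𝓘(ℝ, EuclideanSpace ℝ (Fin c)) ((f ∘ φ.symm) ∘ φ) x _ :=
      hL.hasMFDerivAt.comp x (hφ.mdifferentiableAt hx).hasMFDerivAt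
    have h2 : f =ᶠ[𝓝 x] (f ∘ φ.symm) ∘ φ := by
      filter_upwards [φ.open_source.mem_nhds hx] with y hy
      simp only [Function.comp_apply, φ.left_inv hy]
    have h3 := (h1.congr_of_eventuallyEq h2).mfderiv
    intro w
    obtain ⟨v, hv⟩ := hfs x hxU w
    rw [h3] at hv
    exact ⟨_, hv⟩
  let L2 : EuclideanSpace ℝ (Fin c) →ₗ[ℝ] EuclideanSpace ℝ (Fin c) :=
    (L ∘L ContinuousLinearMap.inr ℝ _ _ : EuclideanSpace ℝ (Fin c) →L[ℝ] EuclideanSpace ℝ (Fin c))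
  have hL2s : Function.Surjective L2 := by
    intro w
    obtain ⟨⟨u, v⟩, huv⟩ := hLs w
    refine ⟨v, ?_⟩
    have h1 : L (u, v) = L (u, 0) + L (0, v) :=
      (congrArg L (Prod.ext (add_zero u).symm (zero_add v).symm)).trans (map_add L (u, 0) (0, v))
    rw [hL0, zero_add] at h1
    exact h1.symm.trans huv
  have hL2i : Function.Injective L2 := LinearMap.injective_iff_surjective.2 hL2s
  -- Adjoining the leaf coordinates to f gives a local diffeomorphism. A point of K near x and the
  -- point of the plaque with the same leaf coordinates have the same image (u, 0), so they
  -- coincide.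
  let G : W → W := fun z => (z.1, (f ∘ φ.symm) z)
  let G' : W →L[ℝ] W := (ContinuousLinearMap.fst ℝ _ _).prod L
  have hG : HasFDerivAt G G' (φ x) := hasFDerivAt_fst.prodMk hL
  have hGs : ContDiffOn ℝ ∞ G O := contDiff_fst.contDiffOn.prodMk hf'
  have hGi : Function.Injective (G' : W →ₗ[ℝ] W) := by
    refine (injective_iff_map_eq_zero _).2 ?_
    rintro ⟨u, v⟩ huv
    have h1 : u = 0 := congrArg Prod.fst huv
    have h2 : L (u, v) = 0 := congrArg Prod.snd huv
    subst h1
    have h3 : v = 0 := (injective_iff_map_eq_zero L2).1 hL2i v h2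
    rw [h3]
    rfl
  let e' : W ≃L[ℝ] W := (LinearEquiv.ofInjectiveEndo (G' : W →ₗ[ℝ] W) hGi).toContinuousLinearEquiv
  obtain ⟨e, hae, heO, hef, -, -⟩ := exists_smooth_localInverse (f' := e') hO hxO hGs hG
  have hc1 : ContinuousAt (fun y => ((φ y).1, (φ x).2)) x :=
    (continuous_fst.continuousAt.comp (φ.continuousAt hx)).prodMk continuousAt_const
  filter_upwards [(φ.continuousAt hx).preimage_mem_nhds (e.open_source.mem_nhds hae),
    hc1.preimage_mem_nhds (e.open_source.mem_nhds hae), φ.open_source.mem_nhds hx,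
    hU.mem_nhds hxU, (continuous_fst.continuousAt.comp (φ.continuousAt hx)).preimage_mem_nhds hzero]
    with y h1 h2 h3 h4 h5 hyK
  have h6 : f y = 0 := by
    have h7 : y ∈ K ∩ U := ⟨hyK, h4⟩
    rw [hfK] at h7
    exact h7.2
  have h8 : φ y = ((φ y).1, (φ x).2) := by
    refine e.injOn h1 h2 ?_
    rw [hef]
    refine Prod.ext rfl ?_
    change f (φ.symm (φ y)) = (f ∘ φ.symm) ((φ y).1, (φ x).2)
    rw [φ.left_inv h3, h6]
    exact h5.symm
  exact (Prod.ext_iff.1 h8).2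

/-- A submanifold of dimension `a` that contains an `a`-dimensional plaque is tangent to it. -/
lemma IsSmoothChart.dTransverse_eq_zero {φ : FolChart M a b} (hφ : IsSmoothChart (𝓡 n) φ)
    {x : M} (hx : x ∈ φ.source) {K : Set M} (hK : IsSubmanifoldAt (𝓡 n) K a x)
    (hplaque : ∀ y, SamePlaque φ x y → y ∈ K) {v : TangentSpace (𝓡 n) x}
    (hv : v ∈ tangentSet (𝓡 n) K x) : dTransverse n φ x v = 0 := by
  have h0 := hφ.eventually_transverse_eq hx hK hplaque
  obtain ⟨c, rfl, hS, hc, rfl⟩ := hv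
  have h1 : HasMFDerivAt 𝓘(ℝ, ℝ) 𝓘(ℝ, EuclideanSpace ℝ (Fin b)) (transverse φ ∘ c) 0 _ :=
    ((hφ.contMDiffAt_transverse hx).mdifferentiableAt (by simp)).hasMFDerivAt.comp (0 : ℝ)
      (hc.mdifferentiableAt (by simp)).hasMFDerivAt
  have h2 : transverse φ ∘ c =ᶠ[𝓝 0] fun _ => transverse φ (c 0) := by
    filter_upwards [hS, hc.continuousAt.eventually h0] with s h3 h4
    exact h4 h3
  have h3 : HasMFDerivAt 𝓘(ℝ, ℝ) 𝓘(ℝ, EuclideanSpace ℝ (Fin b)) (transverse φ ∘ c) 0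
      (0 : ℝ →L[ℝ] EuclideanSpace ℝ (Fin b)) :=
    ((hasFDerivAt_const (transverse φ (c 0)) (0 : ℝ)).hasMFDerivAt).congr_of_eventuallyEq h2
  exact congrArg (fun A => A (1 : ℝ)) (hasMFDerivAt_unique h1 h3)

/-- The charts of an atlas whose holonomy is considered. -/
lemma Holonomy.mem {𝒜 : Set (FolChart M a b)} {φ ψ : FolChart M a b}
    {h : OpenPartialHomeomorph (EuclideanSpace ℝ (Fin b)) (EuclideanSpace ℝ (Fin b))}
    (hh : Holonomy 𝒜 φ ψ h) : φ ∈ 𝒜 ∧ ψ ∈ 𝒜 := by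
  induction hh with
  | step φ ψ τ hφ hψ _ _ _ => exact ⟨hφ, hψ⟩
  | comp φ ψ χ h h' _ _ ih ih' => exact ⟨ih.1, ih'.2⟩

lemma Holonomy.contDiffOn {𝒜 : Set (FolChart M a b)} {φ ψ : FolChart M a b}
    {h : OpenPartialHomeomorph (EuclideanSpace ℝ (Fin b)) (EuclideanSpace ℝ (Fin b))}
    (hh : Holonomy 𝒜 φ ψ h) : ContDiffOn ℝ ∞ h h.source := by
  induction hh with
  | step φ ψ τ _ _ hs _ _ => exact hs
  | comp φ ψ χ h h' _ _ ih ih' =>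
    rw [OpenPartialHomeomorph.coe_trans, OpenPartialHomeomorph.trans_source]
    exact ih'.comp (ih.mono inter_subset_left) fun z hz => hz.2

lemma IsSmoothChart.prod {V V' V₁ V₂ H H' : Type*} [NormedAddCommGroup V] [NormedSpace ℝ V]
    [NormedAddCommGroup V'] [NormedSpace ℝ V'] [NormedAddCommGroup V₁] [NormedSpace ℝ V₁]
    [NormedAddCommGroup V₂] [NormedSpace ℝ V₂] [TopologicalSpace H] [TopologicalSpace H']
    {I : ModelWithCorners ℝ V₁ H} {I' : ModelWithCorners ℝ V₂ H'} {X X' : Type*}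
    [TopologicalSpace X] [TopologicalSpace X'] [ChartedSpace H X] [ChartedSpace H' X']
    {κ : OpenPartialHomeomorph X V} {κ' : OpenPartialHomeomorph X' V'} (hκ : IsSmoothChart I κ)
    (hκ' : IsSmoothChart I' κ') : IsSmoothChart (I.prod I') (κ.prod κ') := by
  constructor
  · rw [modelWithCornersSelf_prod, ← chartedSpaceSelf_prod]
    exact hκ.smooth.prodMap hκ'.smooth
  · rw [modelWithCornersSelf_prod, ← chartedSpaceSelf_prod]
    exact hκ.smooth_symm.prodMap hκ'.smooth_symm

/-- Submanifolds are determined by their germs. -/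
lemma exists_isSubmanifoldAt_congr {V H : Type*} [NormedAddCommGroup V] [NormedSpace ℝ V]
    [FiniteDimensional ℝ V] [TopologicalSpace H] {I : ModelWithCorners ℝ V H} {X : Type*}
    [TopologicalSpace X] [ChartedSpace H X] {S S' : Set X} {x : X}
    (h : ∀ᶠ z in 𝓝 x, z ∈ S ↔ z ∈ S') (hS' : ∃ d, IsSubmanifoldAt I S' d x) :
    ∃ d, IsSubmanifoldAt I S d x := by
  obtain ⟨O, hO, hOo, hxO⟩ := eventually_nhds_iff.1 h
  obtain ⟨d, U, hU, hxU, c, hc, f, hf, hfS, hfs⟩ := hS'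
  refine ⟨d, U ∩ O, hU.inter hOo, ⟨hxU, hxO⟩, c, hc, f, hf.mono inter_subset_left, ?_,
    fun z hz => hfs z hz.1⟩
  ext z
  have h1 := Set.ext_iff.1 hfS z
  constructor
  · rintro ⟨h2, h3, h4⟩
    exact ⟨⟨h3, h4⟩, (h1.1 ⟨(hO z h4).1 h2, h3⟩).2⟩
  · rintro ⟨⟨h3, h4⟩, h5⟩
    exact ⟨(hO z h4).2 (h1.2 ⟨h3, h5⟩).1, h3, h4⟩

/-- The equations of a sheet in coordinates define a submanifold. -/
lemma exists_isSubmanifoldAt_sheetCoord {A B : Type*} [NormedAddCommGroup A] [NormedSpace ℝ A]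
    [FiniteDimensional ℝ A] [NormedAddCommGroup B] [NormedSpace ℝ B] [FiniteDimensional ℝ B]
    {O T : Set B} {h : B → B} (hO : IsOpen O) (hh : ContDiffOn ℝ ∞ h O)
    {P : ((A × B) × (A × B →L[ℝ] ℝ)) × ((A × B) × (A × B →L[ℝ] ℝ))}
    (hT : ∃ d, IsSubmanifoldAt 𝓘(ℝ, B) T d P.2.1.2) {S : Set (((A × B) × (A × B →L[ℝ] ℝ)) ×
      ((A × B) × (A × B →L[ℝ] ℝ)))} (hP : P ∈ S)
    (hS : ∀ Q, Q ∈ S ↔ Q.2.1.2 ∈ O ∧ Q.2.1.2 ∈ T ∧ Q.1.1.2 = h Q.2.1.2 ∧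
      ∃ ζ : B →L[ℝ] ℝ, Q.1.2 = ζ ∘L ContinuousLinearMap.snd ℝ A B ∧
        Q.2.2 = ζ ∘L fderiv ℝ h Q.2.1.2 ∘L ContinuousLinearMap.snd ℝ A B) :
    ∃ d, IsSubmanifoldAt 𝓘(ℝ, ((A × B) × (A × B →L[ℝ] ℝ)) × ((A × B) × (A × B →L[ℝ] ℝ))) S d P := by
  have hfd : ContDiffOn ℝ ∞ (fderiv ℝ h) O := hh.fderiv_of_isOpen hO (by norm_num)
  have hcharts : HasSmoothCharts 𝓘(ℝ, B × (A →L[ℝ] ℝ) × (A × B →L[ℝ] ℝ))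
    (B × (A →L[ℝ] ℝ) × (A × B →L[ℝ] ℝ)) (B × (A →L[ℝ] ℝ) × (A × B →L[ℝ] ℝ)) := hasSmoothCharts_self
  have hT' : ∃ d, IsSubmanifoldAt 𝓘(ℝ, B × A × A × (B →L[ℝ] ℝ))
      {w : B × A × A × (B →L[ℝ] ℝ) | w.1 ∈ O ∩ T} d (P.2.1.2, P.2.1.1, P.1.1.1,
        P.1.2 ∘L ContinuousLinearMap.inr ℝ A B) := by
    have hPS := (hS P).1 hP
    refine exists_isSubmanifoldAt_preimage (I' := 𝓘(ℝ, B)) (g := Prod.fst) (S' := T)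
      (hO.preimage continuous_fst) hPS.1 contDiff_fst.contMDiff.contMDiffOn ?_ ?_ hT
    · intro z _ w
      refine ⟨(w, 0), ?_⟩
      rw [mfderiv_eq_fderiv, fderiv_fst]
      rfl
    · exact fun z hz => ⟨fun h => h.2, fun h => ⟨hz, h⟩⟩
  -- Free coordinates on the sheet: v in the slice T, the two leaf coordinates u and u', and ζ,
  -- which is the transverse part of η. The point v' = h(v), the leaf part 0 of η, and ξ are smooth
  -- functions of these.
  refine exists_isSubmanifoldAt_of_graph (I' := 𝓘(ℝ, B × A × A × (B →L[ℝ] ℝ)))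
    (J := 𝓘(ℝ, B × (A →L[ℝ] ℝ) × (A × B →L[ℝ] ℝ))) hcharts
    (g := fun Q : ((A × B) × (A × B →L[ℝ] ℝ)) × ((A × B) × (A × B →L[ℝ] ℝ)) =>
      (Q.2.1.2, Q.2.1.1, Q.1.1.1, Q.1.2 ∘L ContinuousLinearMap.inr ℝ A B))
    (A := fun Q : ((A × B) × (A × B →L[ℝ] ℝ)) × ((A × B) × (A × B →L[ℝ] ℝ)) =>
      (Q.1.1.2, Q.1.2 ∘L ContinuousLinearMap.inl ℝ A B, Q.2.2))
    (s := fun w : (B × A × A × (B →L[ℝ] ℝ)) × (B × (A →L[ℝ] ℝ) × (A × B →L[ℝ] ℝ)) =>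
      (((w.1.2.2.1, w.2.1), w.2.2.1 ∘L ContinuousLinearMap.fst ℝ A B +
        w.1.2.2.2 ∘L ContinuousLinearMap.snd ℝ A B), ((w.1.2.1, w.1.1), w.2.2.2)))
    (B := fun w : B × A × A × (B →L[ℝ] ℝ) =>
      (h w.1, 0, w.2.2.2 ∘L fderiv ℝ h w.1 ∘L ContinuousLinearMap.snd ℝ A B))
    (S' := {w | w.1 ∈ O ∩ T}) (O := {w | w.1 ∈ O}) ?_ ?_ ?_ ?_ ?_ (hO.preimage continuous_fst)
    ((hS P).1 hP).1 ?_ ?_ hT' ?_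
  · refine ContDiff.contMDiff ?_
    fun_prop
  · refine ContDiff.contMDiff ?_
    fun_prop
  · rw [← modelWithCornersSelf_prod, chartedSpaceSelf_prod]
    refine ContDiff.contMDiff ?_
    fun_prop
  · rintro ⟨⟨⟨u', v'⟩, μ'⟩, ⟨u, v⟩, μ⟩
    refine Prod.ext (Prod.ext rfl ?_) rfl
    have h0 : μ' (0, 0) = 0 := map_zero μ'
    ext w <;> simp [h0]
  · rintro ⟨⟨v, u, u', ζ⟩, v', α, μ⟩
    refine Prod.ext (Prod.ext rfl (Prod.ext rfl (Prod.ext rfl ?_))) (Prod.ext rfl (Prod.ext ?_ rfl))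
    · ext w; simp
    · ext w; simp
  · refine ContDiffOn.contMDiffOn ?_
    have e1 : ContDiffOn ℝ ∞ (fun w : B × A × A × (B →L[ℝ] ℝ) => h w.1) {w | w.1 ∈ O} :=
      hh.comp contDiff_fst.contDiffOn fun w hw => hw
    have e2 : ContDiffOn ℝ ∞ (fun w : B × A × A × (B →L[ℝ] ℝ) => fderiv ℝ h w.1) {w | w.1 ∈ O} :=
      hfd.comp contDiff_fst.contDiffOn fun w hw => hw
    have e3 : ContDiffOn ℝ ∞ (fun w : B × A × A × (B →L[ℝ] ℝ) => w.2.2.2) {w | w.1 ∈ O} :=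
      contDiff_snd.snd.snd.contDiffOn
    exact e1.prodMk (contDiffOn_const.prodMk (e3.clm_comp (e2.clm_comp contDiffOn_const)))
  · obtain ⟨-, -, h1, ζ, h2, h3⟩ := (hS P).1 hP
    refine Prod.ext h1 (Prod.ext ?_ ?_)
    · simp only [h2]
      ext w; simp
    · simp only [h2, h3]
      ext w <;> simp
  · intro Q
    rw [hS]
    constructor
    · rintro ⟨hO, hT, h1, ζ, h2, h3⟩
      refine ⟨⟨hO, hT⟩, Prod.ext h1 (Prod.ext ?_ ?_)⟩
      · simp only [h2]
        ext w; simp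
      · simp only [h2, h3]
        ext w <;> simp
    · rintro ⟨⟨hO, hT⟩, h1⟩
      have h2 : Q.1.2 ∘L ContinuousLinearMap.inl ℝ A B = 0 := congrArg (fun w => w.2.1) h1
      refine ⟨hO, hT, congrArg Prod.fst h1, Q.1.2 ∘L ContinuousLinearMap.inr ℝ A B, ?_,
        congrArg (fun w => w.2.2) h1⟩
      have h0 : Q.1.2 (0, 0) = 0 := map_zero Q.1.2
      ext w
      · simpa [h0] using congrArg (fun A => A w) h2
      · simp

end Boxes

/-! ### Leaves, and the sheets of the relations as submanifolds -/

section Sheets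

variable {n : ℕ} {M : Type*} [TopologicalSpace M] [ChartedSpace (EuclideanSpace ℝ (Fin n)) M]
  [IsManifold (𝓡 n) ∞ M] {p q : ℕ} (F : Foliation n M p q)

namespace Foliation

lemma mem_leaf_self (x : M) : x ∈ F.leaf x := Relation.ReflTransGen.refl

lemma leaf_eq_of_mem {x y : M} (h : y ∈ F.leaf x) : F.leaf y = F.leaf x := by
  have hs : ∀ {z w}, Relation.ReflTransGen (fun z w => ∃ φ ∈ F.atlas, SamePlaque φ z w) z w →
      Relation.ReflTransGen (fun z w => ∃ φ ∈ F.atlas, SamePlaque φ z w) w z := by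
    intro z w hzw
    induction hzw with
    | refl => exact .refl
    | tail _ h ih =>
      obtain ⟨φ, hφ, h1, h2, h3⟩ := h
      exact .head ⟨φ, hφ, h2, h1, h3.symm⟩ ih
  ext z
  exact ⟨fun hz => Relation.ReflTransGen.trans h hz, fun hz =>
    Relation.ReflTransGen.trans (hs h) hz⟩

lemma mem_leaf_of_samePlaque {φ : FolChart M p q} (hφ : φ ∈ F.atlas) {x y : M}
    (h : SamePlaque φ x y) : y ∈ F.leaf x := Relation.ReflTransGen.single ⟨φ, hφ, h⟩

lemma mem_stratum_iff_of_mem_leaf {x y : M} (h : y ∈ F.leaf x) {k : ℕ} :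
    y ∈ F.stratum k ↔ x ∈ F.stratum k := by
  simp only [stratum, mem_ofPred_eq, F.leaf_eq_of_mem h]

lemma sUnion_sheets (k : ℕ) {a b : ℕ} (𝒜 : Set (FolChart M a b)) :
    ⋃₀ F.sheets k 𝒜 = F.conormalRelation k 𝒜 := by
  ext P
  constructor
  · rintro ⟨S, ⟨φ, ψ, h, hh, rfl⟩, hP⟩
    exact hP.2
  · intro hP
    obtain ⟨φ, ψ, h, hh, hP'⟩ := hP.2
    exact ⟨_, ⟨φ, ψ, h, hh, rfl⟩, hP', hP⟩

variable {F}

/-- Conormality costs nothing: the leaf closure has dimension p + k and contains the plaque of that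
dimension, so its tangent vectors have no transverse component, and covectors in a holonomy sheet
see only that component. -/
lemma mem_sheet_iff {k b : ℕ} {𝒜 : Set (FolChart M (p + k) b)}
    (hbox : ∀ φ ∈ 𝒜, IsSmoothBox n φ)
    (hplaque : ∀ φ ∈ 𝒜, ∀ x y, SamePlaque φ x y → y ∈ closure (F.leaf x))
    {φ ψ : FolChart M (p + k) b}
    {h : OpenPartialHomeomorph (EuclideanSpace ℝ (Fin b)) (EuclideanSpace ℝ (Fin b))}
    (hh : Holonomy 𝒜 φ ψ h) {P : Cot n M × Cot n M} :
    P ∈ holonomySheet φ ψ h ∩ F.conormalRelation k 𝒜 ↔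
      P ∈ holonomySheet φ ψ h ∧ P.2.proj ∈ F.stratum k ∧ covec P.2 ≠ 0 := by
  constructor
  · rintro ⟨h1, ⟨h2, h3, h4⟩, h5⟩
    exact ⟨h1, h2, h3⟩
  · rintro ⟨h1, h2, h3⟩
    refine ⟨h1, ⟨h2, h3, fun v hv => ?_⟩, φ, ψ, h, hh, h1⟩
    obtain ⟨h4, h5, h6, h7, ζ, h8, h9⟩ := h1
    rw [h9, (hbox φ hh.mem.1).isSmoothChart.dTransverse_eq_zero h4
      (h2 _ (subset_closure (F.mem_leaf_self _))) (hplaque φ hh.mem.1 _) hv, map_zero, map_zero]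

end Foliation

lemma IsSmoothChart.mem_holonomySheet_iff {a b : ℕ} {φ ψ : FolChart M a b}
    (hφ : IsSmoothChart (𝓡 n) φ) (hψ : IsSmoothChart (𝓡 n) ψ)
    {h : OpenPartialHomeomorph (EuclideanSpace ℝ (Fin b)) (EuclideanSpace ℝ (Fin b))}
    {P : Cot n M × Cot n M} (h1 : P.1.proj ∈ ψ.source) (h2 : P.2.proj ∈ φ.source) :
    P ∈ holonomySheet φ ψ h ↔ (cotCoord φ P.2).1.2 ∈ h.source ∧
      (cotCoord ψ P.1).1.2 = h (cotCoord φ P.2).1.2 ∧ ∃ ζ : EuclideanSpace ℝ (Fin b) →L[ℝ] ℝ,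
        (cotCoord ψ P.1).2 = ζ ∘L ContinuousLinearMap.snd ℝ (EuclideanSpace ℝ (Fin a)) _ ∧
        (cotCoord φ P.2).2 = ζ ∘L fderiv ℝ h (cotCoord φ P.2).1.2 ∘L
          ContinuousLinearMap.snd ℝ (EuclideanSpace ℝ (Fin a)) _ := by
  have key : ∀ {χ : FolChart M a b} (_ : IsSmoothChart (𝓡 n) χ) {ξ : Cot n M}
      (_ : ξ.proj ∈ χ.source) (ζ : EuclideanSpace ℝ (Fin b) →L[ℝ] ℝ),
      (∀ w, ξ.snd w = ζ (dTransverse n χ ξ.proj w)) ↔ (cotCoord χ ξ).2 =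
        ζ ∘L ContinuousLinearMap.snd ℝ (EuclideanSpace ℝ (Fin a)) _ := by
    intro χ hχ ξ hξ ζ
    constructor
    · intro h3
      refine ContinuousLinearMap.ext fun v => ?_
      have h4 := h3 (dChartSymm n χ (χ ξ.proj) v)
      rw [hχ.dTransverse_eq hξ, hχ.dChart_dChartSymm hξ] at h4
      exact h4
    · intro h3 w
      have h4 := congrArg (fun A => A (dChart χ ξ.proj w)) h3
      have h5 : (cotCoord χ ξ).2 (dChart χ ξ.proj w) = covec ξ w :=
        congrArg (covec ξ) (hχ.dChartSymm_dChart hξ w)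
      rw [hχ.dTransverse_eq hξ w]
      exact h5.symm.trans h4
  constructor
  · rintro ⟨-, -, h3, h4, ζ, h5, h6⟩
    exact ⟨h3, h4, ζ, (key hψ h1 ζ).1 h5, (key hφ h2 (ζ ∘L fderiv ℝ h _)).1 h6⟩
  · rintro ⟨h3, h4, ζ, h5, h6⟩
    exact ⟨h2, h1, h3, h4, ζ, (key hψ h1 ζ).2 h5, (key hφ h2 (ζ ∘L fderiv ℝ h _)).2 h6⟩

variable {F}
  (g : ContMDiffRiemannianMetric (𝓡 n) ∞ (EuclideanSpace ℝ (Fin n))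
    (fun x : M => TangentSpace (𝓡 n) x))
include g

/-- A stratum that is cut out, in each chart, by a submanifold of the local transversal leads to
a relation whose sheets are submanifolds. -/
lemma isSubmanifold_sheet {k b : ℕ} {𝒜 : Set (FolChart M (p + k) b)}
    (hbox : ∀ φ ∈ 𝒜, IsSmoothBox n φ)
    (hplaque : ∀ φ ∈ 𝒜, ∀ x y, SamePlaque φ x y → y ∈ closure (F.leaf x))
    (hslice : ∀ φ ∈ 𝒜, ∀ x ∈ φ.source, x ∈ F.stratum k → ∃ T : Set (EuclideanSpace ℝ (Fin b)),
      (∃ d, IsSubmanifoldAt 𝓘(ℝ, EuclideanSpace ℝ (Fin b)) T d (transverse φ x)) ∧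
        ∀ y ∈ φ.source, y ∈ F.stratum k ↔ transverse φ y ∈ T)
    {S : Set (Cot n M × Cot n M)} (hS : S ∈ F.sheets k 𝒜) :
    IsSubmanifold ((cotModel n).prod (cotModel n)) S ∧ ∀ P ∈ S, covec P.2 ≠ 0 := by
  obtain ⟨φ, ψ, h, hh, rfl⟩ := hS
  refine ⟨fun P hP => ?_, fun P hP => ((Foliation.mem_sheet_iff hbox hplaque hh).1 hP).2.2⟩
  obtain ⟨hP1, hP2, hP3⟩ := (Foliation.mem_sheet_iff hbox hplaque hh).1 hP
  have hφ := (hbox φ hh.mem.1).isSmoothChart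
  have hψ := (hbox ψ hh.mem.2).isSmoothChart
  have hs1 : P.1.proj ∈ ψ.source := hP1.2.1
  have hs2 : P.2.proj ∈ φ.source := hP1.1
  obtain ⟨T, hT, hT'⟩ := hslice φ hh.mem.1 _ hs2 hP2
  -- Nonvanishing of the covector is an open condition and can be dropped near P.
  let S₁ : Set (Cot n M × Cot n M) := {Q | Q ∈ holonomySheet φ ψ h ∧ Q.2.proj ∈ F.stratum k}
  refine exists_isSubmanifoldAt_congr (S' := S₁) ?_ ?_
  · have hne : ∀ᶠ Q in 𝓝 P, covec Q.2 ≠ 0 :=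
      ((isOpen_covec_ne_zero g).preimage continuous_snd).mem_nhds hP3
    filter_upwards [hne] with Q hQ
    rw [Foliation.mem_sheet_iff hbox hplaque hh]
    exact ⟨fun h1 => ⟨h1.1, h1.2.1⟩, fun h1 => ⟨h1.1, h1.2, hQ⟩⟩
  · have hκ := hψ.isSmoothChart_cotLift.prod hφ.isSmoothChart_cotLift
    let S₂ := {Q : ((EuclideanSpace ℝ (Fin (p + k)) × EuclideanSpace ℝ (Fin b)) × (_ →L[ℝ] ℝ)) ×
      ((EuclideanSpace ℝ (Fin (p + k)) × EuclideanSpace ℝ (Fin b)) × (_ →L[ℝ] ℝ)) |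
        Q.2.1.2 ∈ h.source ∧ Q.2.1.2 ∈ T ∧ Q.1.1.2 = h Q.2.1.2 ∧
      ∃ ζ : EuclideanSpace ℝ (Fin b) →L[ℝ] ℝ,
        Q.1.2 = ζ ∘L ContinuousLinearMap.snd ℝ (EuclideanSpace ℝ (Fin (p + k))) _ ∧
        Q.2.2 = ζ ∘L fderiv ℝ h Q.2.1.2 ∘L
          ContinuousLinearMap.snd ℝ (EuclideanSpace ℝ (Fin (p + k))) _}
    have hmem : ∀ Q ∈ (hψ.cotLift.prod hφ.cotLift).source,
        Q ∈ S₁ ↔ (hψ.cotLift.prod hφ.cotLift) Q ∈ S₂ := by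
      rintro Q ⟨hQ1, hQ2⟩
      have h1 := hφ.mem_holonomySheet_iff hψ (h := h) hQ1 hQ2
      have h2 := hT' Q.2.proj hQ2
      constructor
      · rintro ⟨h3, h4⟩
        have h5 := h1.1 h3
        exact ⟨h5.1, h2.1 h4, h5.2⟩
      · rintro ⟨h3, h4, h5⟩
        exact ⟨h1.2 ⟨h3, h5⟩, h2.2 h4⟩
    refine hκ.exists_isSubmanifoldAt (S' := S₂) ⟨hs1, hs2⟩ hmem ?_
    exact exists_isSubmanifoldAt_sheetCoord h.open_source hh.contDiffOn hT
      ((hmem P ⟨hs1, hs2⟩).1 ⟨hP1, hP2⟩) fun Q => Iff.rfl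

variable [T2Space M] [CompactSpace M]

/-- Since clean intersection with `Λ` holds for every submanifold of pairs with nonzero second
covector, the only thing left to verify for either relation is that the stratum is cut out of the
local transversals by submanifolds. -/
theorem intersectsCleanly_of_slices {σ : ℝ} {k b : ℕ} {𝒜 : Set (FolChart M (p + k) b)}
    (hbox : ∀ φ ∈ 𝒜, IsSmoothBox n φ)
    (hplaque : ∀ φ ∈ 𝒜, ∀ x y, SamePlaque φ x y → y ∈ closure (F.leaf x))
    (hslice : ∀ φ ∈ 𝒜, ∀ x ∈ φ.source, x ∈ F.stratum k → ∃ T : Set (EuclideanSpace ℝ (Fin b)),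
      (∃ d, IsSubmanifoldAt 𝓘(ℝ, EuclideanSpace ℝ (Fin b)) T d (transverse φ x)) ∧
        ∀ y ∈ φ.source, y ∈ F.stratum k ↔ transverse φ y ∈ T) :
    IntersectsCleanly (F.conormalRelation k 𝒜) (F.sheets k 𝒜) (waveRelation g σ) := by
  refine ⟨F.sUnion_sheets k 𝒜, isSubmanifold_waveRelation g σ, fun S hS => ?_⟩
  obtain ⟨h1, h2⟩ := isSubmanifold_sheet g hbox hplaque hslice hS
  exact ⟨h1, cleanIntersection_waveRelation g h1 h2⟩

/-- The charts of `closureAtlas` lie inside the stratum, so each slice is the entire transversal. -/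
theorem intersectsCleanly_Cmax (F : Foliation n M p q) (σ : ℝ) (k : ℕ) :
    IntersectsCleanly (F.Cmax k) (F.sheets k (F.closureAtlas k)) (waveRelation g σ) := by
  refine intersectsCleanly_of_slices g (fun φ hφ => hφ.1) (fun φ hφ => hφ.2.2) ?_
  intro φ hφ x hx _
  exact ⟨univ, exists_isSubmanifoldAt_of_isOpen isOpen_univ (mem_univ _),
    fun y hy => ⟨fun _ => mem_univ _, fun _ => hφ.2.1 hy⟩⟩

end Sheets

/-! ### Conormal covectors in distinguished charts -/

section LiftedPlaques

variable {n : ℕ} {M : Type*} [TopologicalSpace M] [ChartedSpace (EuclideanSpace ℝ (Fin n)) M]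
  [IsManifold (𝓡 n) ∞ M] {a b : ℕ}

/-- The conormal covector with given coordinates in a distinguished chart. -/
def liftPt (n : ℕ) {M : Type*} [TopologicalSpace M]
    [ChartedSpace (EuclideanSpace ℝ (Fin n)) M] [IsManifold (𝓡 n) ∞ M] {a b : ℕ}
    (φ : FolChart M a b) (u : EuclideanSpace ℝ (Fin a)) (v : EuclideanSpace ℝ (Fin b))
    (ζ : EuclideanSpace ℝ (Fin b) →L[ℝ] ℝ) : Cot n M :=
  cotCoordSymm n φ ((u, v), ζ ∘L ContinuousLinearMap.snd ℝ (EuclideanSpace ℝ (Fin a)) _)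

/-- The covectors `ξ` and `ξ'` lie in the same plaque of the lifted foliation. -/
def SameLift (φ : FolChart M a b) (ξ ξ' : Cot n M) : Prop :=
  ∃ u u' v ζ, (u, v) ∈ φ.target ∧ (u', v) ∈ φ.target ∧ ξ = liftPt n φ u v ζ ∧
    ξ' = liftPt n φ u' v ζ

lemma SameLift.symm {φ : FolChart M a b} {ξ ξ' : Cot n M} (h : SameLift φ ξ ξ') :
    SameLift φ ξ' ξ := by
  obtain ⟨u, u', v, ζ, h1, h2, h3, h4⟩ := h
  exact ⟨u', u, v, ζ, h2, h1, h4, h3⟩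

lemma SameLift.left {φ : FolChart M a b} {ξ ξ' : Cot n M} (h : SameLift φ ξ ξ') :
    SameLift φ ξ ξ := by
  obtain ⟨u, u', v, ζ, h1, h2, h3, h4⟩ := h
  exact ⟨u, u, v, ζ, h1, h1, h3, h3⟩

@[simp] lemma proj_liftPt (φ : FolChart M a b) (u : EuclideanSpace ℝ (Fin a))
    (v : EuclideanSpace ℝ (Fin b)) (ζ : EuclideanSpace ℝ (Fin b) →L[ℝ] ℝ) :
    (liftPt n φ u v ζ).proj = φ.symm (u, v) := rfl

lemma scale_liftPt (φ : FolChart M a b) (r : ℝ) (u : EuclideanSpace ℝ (Fin a))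
    (v : EuclideanSpace ℝ (Fin b)) (ζ : EuclideanSpace ℝ (Fin b) →L[ℝ] ℝ) :
    scale r (liftPt n φ u v ζ) = liftPt n φ u v (r • ζ) := rfl

lemma SameLift.samePlaque {φ : FolChart M a b} {ξ ξ' : Cot n M} (h : SameLift φ ξ ξ') :
    SamePlaque φ ξ.proj ξ'.proj := by
  obtain ⟨u, u', v, ζ, h1, h2, rfl, rfl⟩ := h
  refine ⟨φ.map_target h1, φ.map_target h2, ?_⟩
  simp only [transverse, proj_liftPt, φ.right_inv h1, φ.right_inv h2]

namespace IsSmoothChart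

variable {φ : FolChart M a b} (hφ : IsSmoothChart (𝓡 n) φ)
include hφ

lemma covec_liftPt {u : EuclideanSpace ℝ (Fin a)} {v : EuclideanSpace ℝ (Fin b)}
    (h : (u, v) ∈ φ.target) (ζ : EuclideanSpace ℝ (Fin b) →L[ℝ] ℝ)
    (w : EuclideanSpace ℝ (Fin n)) :
    covec (liftPt n φ u v ζ) w = ζ (dTransverse n φ (φ.symm (u, v)) w) := by
  rw [hφ.dTransverse_eq (φ.map_target h)]
  rfl

lemma cotCoord_liftPt {u : EuclideanSpace ℝ (Fin a)} {v : EuclideanSpace ℝ (Fin b)}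
    (h : (u, v) ∈ φ.target) (ζ : EuclideanSpace ℝ (Fin b) →L[ℝ] ℝ) :
    cotCoord φ (liftPt n φ u v ζ) =
      ((u, v), ζ ∘L ContinuousLinearMap.snd ℝ (EuclideanSpace ℝ (Fin a)) _) :=
  hφ.cotCoord_cotCoordSymm (P := ((u, v), _)) h

lemma liftPt_injective {u : EuclideanSpace ℝ (Fin a)} {v : EuclideanSpace ℝ (Fin b)}
    (h : (u, v) ∈ φ.target) {ζ ζ' : EuclideanSpace ℝ (Fin b) →L[ℝ] ℝ}
    (h' : liftPt n φ u v ζ = liftPt n φ u v ζ') : ζ = ζ' := by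
  have h1 := congrArg (fun ξ => (cotCoord φ ξ).2 ∘L ContinuousLinearMap.inr ℝ _ _) h'
  simp only [hφ.cotCoord_liftPt h] at h1
  ext w
  have h2 := congrArg (fun A => A w) h1
  simpa using h2

lemma surjective_dTransverse {x : M} (hx : x ∈ φ.source) :
    Function.Surjective (dTransverse n φ x) := by
  intro w
  refine ⟨dChartSymm n φ (φ x) (0, w), ?_⟩
  rw [hφ.dTransverse_eq hx, hφ.dChart_dChartSymm hx]

lemma eq_liftPt {ξ : Cot n M} (hξ : ξ.proj ∈ φ.source) {ζ : EuclideanSpace ℝ (Fin b) →L[ℝ] ℝ}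
    (h : ∀ w, covec ξ w = ζ (dTransverse n φ ξ.proj w)) :
    ξ = liftPt n φ (φ ξ.proj).1 (φ ξ.proj).2 ζ := by
  have h1 : ((φ ξ.proj).1, (φ ξ.proj).2) = φ ξ.proj := rfl
  refine (hφ.cotCoordSymm_cotCoord hξ).symm.trans ?_
  rw [liftPt, h1]
  refine congrArg (cotCoordSymm n φ) (Prod.ext rfl ?_)
  refine ContinuousLinearMap.ext fun v => ?_
  change covec ξ (dChartSymm n φ (φ ξ.proj) v) = ζ v.2
  rw [h, hφ.dTransverse_eq hξ, hφ.dChart_dChartSymm hξ]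

lemma eq_liftPt_cotCoord {ξ : Cot n M} (hξ : ξ.proj ∈ φ.source)
    (h : (cotCoord φ ξ).2 ∘L ContinuousLinearMap.inl ℝ _ _ = 0) :
    ξ = liftPt n φ (φ ξ.proj).1 (φ ξ.proj).2
      ((cotCoord φ ξ).2 ∘L ContinuousLinearMap.inr ℝ _ _) := by
  refine (hφ.cotCoordSymm_cotCoord hξ).symm.trans ?_
  refine congrArg (cotCoordSymm n φ) (Prod.ext rfl ?_)
  have h0 : (cotCoord φ ξ).2 (0, 0) = 0 := map_zero _
  ext w
  · simpa [h0] using congrArg (fun A => A w) h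
  · simp

lemma continuousOn_liftPt : ContinuousOn (fun w : EuclideanSpace ℝ (Fin a) ×
    EuclideanSpace ℝ (Fin b) × (EuclideanSpace ℝ (Fin b) →L[ℝ] ℝ) =>
      liftPt n φ w.1 w.2.1 w.2.2) {w | (w.1, w.2.1) ∈ φ.target} := by
  refine hφ.contMDiffOn_cotCoordSymm.continuousOn.comp ?_ fun w hw => ⟨hw, mem_univ _⟩
  exact Continuous.continuousOn (by fun_prop)

end IsSmoothChart

lemma IsSmoothBox.mem_target {φ : FolChart M a b} (hφ : IsSmoothBox n φ)
    {u : EuclideanSpace ℝ (Fin a)} {v : EuclideanSpace ℝ (Fin b)} :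
    (u, v) ∈ φ.target ↔ u ∈ Metric.ball 0 1 ∧ v ∈ Metric.ball 0 1 := by
  rw [hφ.1]
  exact Iff.rfl

/-! ### The energy of conormal covectors -/

variable (g : ContMDiffRiemannianMetric (𝓡 n) ∞ (EuclideanSpace ℝ (Fin n))
    (fun x : M => TangentSpace (𝓡 n) x))

lemma metricForm_sq_le (x : M) (u v : EuclideanSpace ℝ (Fin n)) :
    metricForm g x u v ^ 2 ≤ metricForm g x u u * metricForm g x v v := by
  let ξ : Cot n M := ⟨x, metricForm g x u⟩
  have h1 : raise g ξ = u := (raise_eq_iff g).2 rfl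
  have h2 := covec_sq_le g ξ v
  rw [energy_eq, h1, mul_div_cancel₀ _ two_ne_zero] at h2
  exact h2

/-- Lift a covector ζ of the transversal to M, take its dual vector X, and project X back to the
transversal. This linear map is injective: if X projects to 0, then g(X, X) = ζ(0) = 0. By equality
of dimensions it is surjective, and every such X is orthogonal to the plaque. -/
lemma IsSmoothChart.exists_orthogonal {φ : FolChart M a b} (hφ : IsSmoothChart (𝓡 n) φ) {x : M}
    (hx : x ∈ φ.source) (w : EuclideanSpace ℝ (Fin b)) : ∃ X : EuclideanSpace ℝ (Fin n),
      dTransverse n φ x X = w ∧ ∀ Y, dTransverse n φ x Y = 0 → metricForm g x X Y = 0 := by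
  let dT : EuclideanSpace ℝ (Fin n) →L[ℝ] EuclideanSpace ℝ (Fin b) := dTransverse n φ x
  let R : (EuclideanSpace ℝ (Fin b) →L[ℝ] ℝ) →ₗ[ℝ] EuclideanSpace ℝ (Fin b) :=
    { toFun := fun ζ => dT ((lower g x).symm (ζ ∘L dT))
      map_add' := fun ζ ζ' => by rw [ContinuousLinearMap.add_comp, map_add, map_add]
      map_smul' := fun r ζ => by
        rw [ContinuousLinearMap.smul_comp, map_smul, map_smul, RingHom.id_apply] }
  have hR : ∀ ζ, metricForm g x ((lower g x).symm (ζ ∘L dT)) = ζ ∘L dT := fun ζ => by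
    rw [← lower_apply, ContinuousLinearEquiv.apply_symm_apply]
  have hinj : Function.Injective R := by
    refine (injective_iff_map_eq_zero R).2 fun ζ hζ => ?_
    have h1 : dT ((lower g x).symm (ζ ∘L dT)) = 0 := hζ
    have h2 : (lower g x).symm (ζ ∘L dT) = 0 := by
      by_contra h
      have h3 := metricForm_pos g x h
      rw [hR, ContinuousLinearMap.comp_apply, h1, map_zero] at h3
      exact lt_irrefl _ h3
    have h3 := hR ζ
    rw [h2, map_zero] at h3
    ext w
    obtain ⟨X, rfl⟩ := hφ.surjective_dTransverse hx w
    exact (congrArg (fun A => A X) h3).symm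
  have hsurj : Function.Surjective R := by
    refine (LinearMap.injective_iff_surjective_of_finrank_eq_finrank ?_).1 hinj
    rw [← (LinearMap.toContinuousLinearMap (𝕜 := ℝ) (E := EuclideanSpace ℝ (Fin b))
      (F' := ℝ)).finrank_eq]
    exact Subspace.dual_finrank_eq
  obtain ⟨ζ, hζ⟩ := hsurj w
  refine ⟨(lower g x).symm (ζ ∘L dT), hζ, fun Y hY => ?_⟩
  have h1 := congrArg (fun A => A Y) (hR ζ)
  exact h1.trans ((congrArg ζ hY).trans (map_zero ζ))

variable {g} {p q : ℕ} {F : Foliation n M p q} (hg : F.IsBundleLike g)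
include hg

/-- Let X and X' be the vectors dual to the two covectors. X' is orthogonal to the leaf; let Z be
the orthogonal vector at the other point with the same transverse component. The bundle-like
condition gives |Z| = |X'|, while g(X, Z) = |X'|² because both equal ζ of that component. The
Cauchy–Schwarz inequality yields |X'| ≤ |X|. -/
lemma energy_liftPt_le {φ : FolChart M p q} (hφ : φ ∈ F.atlas) {u u' : EuclideanSpace ℝ (Fin p)}
    {v : EuclideanSpace ℝ (Fin q)} (h : (u, v) ∈ φ.target) (h' : (u', v) ∈ φ.target)
    (ζ : EuclideanSpace ℝ (Fin q) →L[ℝ] ℝ) :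
    energy g (liftPt n φ u' v ζ) ≤ energy g (liftPt n φ u v ζ) := by
  have hs := (F.smoothBox φ hφ).isSmoothChart
  let ξ := liftPt n φ u v ζ
  let ξ' := liftPt n φ u' v ζ
  let x := φ.symm (u, v)
  let y := φ.symm (u', v)
  have hx : x ∈ φ.source := φ.map_target h
  let X := raise g ξ
  let X' := raise g ξ'
  have hX : ∀ w, metricForm g x X w = ζ (dTransverse n φ x w) := fun w =>
    (congrArg (fun A => A w) (metricForm_raise g ξ)).trans (hs.covec_liftPt h ζ w)
  have hX' : ∀ w, metricForm g y X' w = ζ (dTransverse n φ y w) := fun w =>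
    (congrArg (fun A => A w) (metricForm_raise g ξ')).trans (hs.covec_liftPt h' ζ w)
  obtain ⟨Z, hZ1, hZ2⟩ := hs.exists_orthogonal g hx (dTransverse n φ y X')
  have hpl : SamePlaque φ x y := ⟨hx, φ.map_target h', by
    simp only [transverse, x, y, φ.right_inv h, φ.right_inv h']⟩
  have h1 : metricForm g x Z Z = metricForm g y X' X' := by
    refine hg φ hφ x y hpl Z X' hZ2 (fun w hw => ?_) hZ1
    exact (hX' w).trans ((congrArg ζ hw).trans (map_zero ζ))
  have h2 : metricForm g x X Z = metricForm g y X' X' := by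
    rw [hX, hX']
    exact congrArg ζ hZ1
  have h3 := metricForm_sq_le g x X Z
  rw [h1, h2, sq] at h3
  have h4 : metricForm g y X' X' ≤ metricForm g x X X := by
    rcases (metricForm_nonneg g y X').eq_or_lt with h5 | h5
    · rw [← h5]
      exact metricForm_nonneg g x X
    · exact le_of_mul_le_mul_right h3 h5
  rw [energy_eq, energy_eq]
  exact div_le_div_of_nonneg_right h4 zero_le_two

/-- The energy is constant on the plaques of the lifted foliation. -/
lemma energy_liftPt_eq {φ : FolChart M p q} (hφ : φ ∈ F.atlas) {u u' : EuclideanSpace ℝ (Fin p)}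
    {v : EuclideanSpace ℝ (Fin q)} (h : (u, v) ∈ φ.target) (h' : (u', v) ∈ φ.target)
    (ζ : EuclideanSpace ℝ (Fin q) →L[ℝ] ℝ) :
    energy g (liftPt n φ u v ζ) = energy g (liftPt n φ u' v ζ) :=
  (energy_liftPt_le hg hφ h' h ζ).antisymm (energy_liftPt_le hg hφ h h' ζ)

lemma SameLift.energy_eq {φ : FolChart M p q} (hφ : φ ∈ F.atlas) {ξ ξ' : Cot n M}
    (h : SameLift φ ξ ξ') : energy g ξ = energy g ξ' := by
  obtain ⟨u, u', v, ζ, h1, h2, rfl, rfl⟩ := h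
  exact energy_liftPt_eq hg hφ h1 h2 ζ

end LiftedPlaques

/-! ### The flow of the energy on conormal covectors -/

section ReducedFlow

set_option synthInstance.maxHeartbeats 400000

variable {n : ℕ} {M : Type*} [TopologicalSpace M] [ChartedSpace (EuclideanSpace ℝ (Fin n)) M]
  [IsManifold (𝓡 n) ∞ M]
  (g : ContMDiffRiemannianMetric (𝓡 n) ∞ (EuclideanSpace ℝ (Fin n))
    (fun x : M => TangentSpace (𝓡 n) x))

section General

variable [T2Space M] [CompactSpace M] {V : Type*} [NormedAddCommGroup V] [NormedSpace ℝ V]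
  [FiniteDimensional ℝ V]

/-- Solutions of the hamiltonian equations in a chart are parts of the flow lines. -/
lemma IsSmoothChart.geoFlow_eq_of_hasDerivAt {κ : OpenPartialHomeomorph M V}
    (hκ : IsSmoothChart (𝓡 n) κ) {P : ℝ → V × (V →L[ℝ] ℝ)} {ε : ℝ}
    (hP : ∀ s ∈ Ioo (-ε) ε, (P s).1 ∈ κ.target ∧ HasDerivAt P (hamCoord g κ (P s)) s)
    {s : ℝ} (hs : s ∈ Ioo (-ε) ε) :
    geoFlow g s (cotCoordSymm n κ (P 0)) = cotCoordSymm n κ (P s) := by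
  have : IsManifold (cotModel n) 1 (Cot n M) :=
    IsManifold.of_le (n := ∞) (by exact_mod_cast le_top)
  have h0 : (0 : ℝ) ∈ Ioo (-ε) ε := by
    have := hs.1.trans hs.2
    exact ⟨by linarith, by linarith⟩
  have h1 : IsMIntegralCurveOn (I := cotModel n) (fun s => cotCoordSymm n κ (P s)) (hamSection g)
      (Ioo (-ε) ε) := by
    intro t ht
    refine (hκ.hasMFDerivAt_of_cotCoord g (γ := fun s => cotCoordSymm n κ (P s))
      ?_ ?_).hasMFDerivWithinAt
    · filter_upwards [isOpen_Ioo.mem_nhds ht] with r hr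
      exact κ.map_target (hP r hr).1
    · rw [hκ.cotCoord_cotCoordSymm (hP t ht).1]
      refine (hP t ht).2.congr_of_eventuallyEq ?_
      filter_upwards [isOpen_Ioo.mem_nhds ht] with r hr
      exact hκ.cotCoord_cotCoordSymm (hP r hr).1
  exact isMIntegralCurveOn_Ioo_eqOn_of_contMDiff_boundaryless (t₀ := 0) h0
    (isSmoothField_hamField g).contMDiff
    ((isMIntegralCurve_geoFlow g _).isMIntegralCurveOn _) h1 (by simp) hs

end General

variable {p q : ℕ} {F : Foliation n M p q}

/-- The coordinates of a conormal covector. -/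
def liftCoord {a b : ℕ} (u : EuclideanSpace ℝ (Fin a))
    (w : EuclideanSpace ℝ (Fin b) × (EuclideanSpace ℝ (Fin b) →L[ℝ] ℝ)) :
    (EuclideanSpace ℝ (Fin a) × EuclideanSpace ℝ (Fin b)) ×
      (EuclideanSpace ℝ (Fin a) × EuclideanSpace ℝ (Fin b) →L[ℝ] ℝ) :=
  ((u, w.1), w.2 ∘L ContinuousLinearMap.snd ℝ (EuclideanSpace ℝ (Fin a)) _)

lemma contDiff_liftCoord {a b : ℕ} : ContDiff ℝ ∞ (fun z : EuclideanSpace ℝ (Fin a) ×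
    (EuclideanSpace ℝ (Fin b) × (EuclideanSpace ℝ (Fin b) →L[ℝ] ℝ)) => liftCoord z.1 z.2) := by
  unfold liftCoord
  fun_prop

lemma cotCoordSymm_liftCoord {a b : ℕ} (φ : FolChart M a b) (u : EuclideanSpace ℝ (Fin a))
    (w : EuclideanSpace ℝ (Fin b) × (EuclideanSpace ℝ (Fin b) →L[ℝ] ℝ)) :
    cotCoordSymm n φ (liftCoord u w) = liftPt n φ u w.1 w.2 := rfl

/-- The components of the hamiltonian field transverse to the leaves. -/
def transversePart {a b : ℕ}
    (X : (EuclideanSpace ℝ (Fin a) × EuclideanSpace ℝ (Fin b)) ×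
      (EuclideanSpace ℝ (Fin a) × EuclideanSpace ℝ (Fin b) →L[ℝ] ℝ)) :
    EuclideanSpace ℝ (Fin b) × (EuclideanSpace ℝ (Fin b) →L[ℝ] ℝ) :=
  (X.1.2, X.2 ∘L ContinuousLinearMap.inr ℝ _ _)

lemma contDiff_transversePart {a b : ℕ} : ContDiff ℝ ∞ (transversePart (a := a) (b := b)) := by
  unfold transversePart
  fun_prop

lemma sympl_hamCoord {V : Type*} [NormedAddCommGroup V] [NormedSpace ℝ V]
    [FiniteDimensional ℝ V] (κ : OpenPartialHomeomorph M V) (P : V × (V →L[ℝ] ℝ)) :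
    sympl V (hamCoord g κ P) = fderiv ℝ (energy g ∘ cotCoordSymm n κ) P := by
  rw [← symplEquiv_apply, hamCoord, ContinuousLinearEquiv.apply_symm_apply]

variable {g} (hg : F.IsBundleLike g) {φ : FolChart M p q} (hφ : φ ∈ F.atlas)
  {u u' : EuclideanSpace ℝ (Fin p)}
  {w : EuclideanSpace ℝ (Fin q) × (EuclideanSpace ℝ (Fin q) →L[ℝ] ℝ)}
include hg hφ

lemma hasFDerivAt_energy_liftCoord (hu : (u, w.1) ∈ φ.target) :
    HasFDerivAt (energy g ∘ cotCoordSymm n φ)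
      (fderiv ℝ (energy g ∘ cotCoordSymm n φ) (liftCoord u w)) (liftCoord u w) := by
  have hs := (F.smoothBox φ hφ).isSmoothChart
  refine (((hs.contDiffOn_energy g).contDiffAt (hs.cotLift.open_target.mem_nhds
    ?_)).differentiableAt (by simp)).hasFDerivAt
  exact ⟨hu, mem_univ _⟩

/-- The hamiltonian field is tangent to the conormal bundle. -/
lemma hamCoord_liftCoord_inl (hu : (u, w.1) ∈ φ.target) :
    (hamCoord g φ (liftCoord u w)).2 ∘L ContinuousLinearMap.inl ℝ _ _ = 0 := by
  refine ContinuousLinearMap.ext fun c => ?_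
  have h1 := hasDerivAt_line (hasFDerivAt_energy_liftCoord hg hφ hu) ((c, 0), 0)
  have hc : ContinuousAt (fun s : ℝ => (u + s • c, w.1)) 0 := by fun_prop
  have h0 : φ.target ∈ 𝓝 ((fun s : ℝ => (u + s • c, w.1)) 0) := by
    simpa using φ.open_target.mem_nhds hu
  -- Moving only the leaf coordinate does not change the energy, so its derivative in that direction
  -- vanishes. Up to sign this is the leaf component of the momentum velocity.
  have h2 : (fun s : ℝ => (energy g ∘ cotCoordSymm n φ) (liftCoord u w + s • ((c, 0), 0)))
      =ᶠ[𝓝 0] fun _ => energy g (liftPt n φ u w.1 w.2) := by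
    filter_upwards [hc.preimage_mem_nhds h0] with s hs
    have e1 : liftCoord u w + s • (((c, 0), 0) : (EuclideanSpace ℝ (Fin p) ×
        EuclideanSpace ℝ (Fin q)) × (EuclideanSpace ℝ (Fin p) × EuclideanSpace ℝ (Fin q) →L[ℝ] ℝ))
        = liftCoord (u + s • c) w := by
      simp [liftCoord]
    rw [Function.comp_apply, e1, cotCoordSymm_liftCoord]
    exact energy_liftPt_eq hg hφ hs hu w.2
  have h3 := h1.unique ((hasDerivAt_const (0 : ℝ) _).congr_of_eventuallyEq h2)
  rw [← sympl_hamCoord, sympl_apply] at h3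
  simpa using h3

/-- The transverse part of the hamiltonian field depends only on the transverse coordinates. -/
lemma transversePart_hamCoord_eq (hu : (u, w.1) ∈ φ.target) (hu' : (u', w.1) ∈ φ.target) :
    transversePart (hamCoord g φ (liftCoord u w)) =
      transversePart (hamCoord g φ (liftCoord u' w)) := by
  -- Paired with Y by the symplectic form, the transverse part of the field gives the derivative of
  -- the energy in the transverse direction Y. That derivative is the same at u and u', and the form
  -- is nondegenerate.
  have key : ∀ {u : EuclideanSpace ℝ (Fin p)}, (u, w.1) ∈ φ.target → ∀ Y,
      HasDerivAt (fun s : ℝ => energy g (liftPt n φ u (w.1 + s • Y.1) (w.2 + s • Y.2)))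
        (sympl (EuclideanSpace ℝ (Fin q)) (transversePart (hamCoord g φ (liftCoord u w))) Y)
        0 := by
    intro u hu Y
    have h1 := hasDerivAt_line (hasFDerivAt_energy_liftCoord hg hφ hu)
      ((0, Y.1), Y.2 ∘L ContinuousLinearMap.snd ℝ (EuclideanSpace ℝ (Fin p)) _)
    rw [← sympl_hamCoord, sympl_apply] at h1
    refine (h1.congr_of_eventuallyEq (Filter.Eventually.of_forall fun s => ?_)).congr_deriv rfl
    have e1 : liftCoord u w + s • (((0, Y.1),
        Y.2 ∘L ContinuousLinearMap.snd ℝ (EuclideanSpace ℝ (Fin p)) _) : (EuclideanSpace ℝ (Fin p) ×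
        EuclideanSpace ℝ (Fin q)) × (EuclideanSpace ℝ (Fin p) × EuclideanSpace ℝ (Fin q) →L[ℝ] ℝ))
        = liftCoord u (w + s • Y) := by
      simp [liftCoord, ContinuousLinearMap.add_comp, ContinuousLinearMap.smul_comp]
    change _ = (energy g ∘ cotCoordSymm n φ) _
    rw [Function.comp_apply, e1]
    rfl
  refine sub_eq_zero.1 (sympl_injective ?_)
  rw [map_sub, sub_eq_zero]
  refine ContinuousLinearMap.ext fun Y => ?_
  refine (key hu Y).unique ((key hu' Y).congr_of_eventuallyEq ?_)
  have hc : ∀ c : EuclideanSpace ℝ (Fin p), (c, w.1) ∈ φ.target →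
      ∀ᶠ s : ℝ in 𝓝 0, (c, w.1 + s • Y.1) ∈ φ.target := by
    intro c hc
    have hc1 : ContinuousAt (fun s : ℝ => (c, w.1 + s • Y.1)) 0 := by fun_prop
    exact hc1.preimage_mem_nhds (by simpa using φ.open_target.mem_nhds hc)
  filter_upwards [hc u hu, hc u' hu'] with s h1 h2
  exact energy_liftPt_eq hg hφ h1 h2 _

omit hg hφ in
lemma eq_liftPt_of_sameLift (hs : IsSmoothChart (𝓡 n) φ) {ξ ξ' : Cot n M} (h : SameLift φ ξ ξ') :
    ((cotCoord φ ξ).1.1, (cotCoord φ ξ).1.2) ∈ φ.target ∧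
    ((cotCoord φ ξ').1.1, (cotCoord φ ξ).1.2) ∈ φ.target ∧
    ξ = cotCoordSymm n φ (liftCoord (cotCoord φ ξ).1.1 (transversePart (cotCoord φ ξ))) ∧
    ξ' = cotCoordSymm n φ (liftCoord (cotCoord φ ξ').1.1 (transversePart (cotCoord φ ξ))) := by
  obtain ⟨u, u', v, ζ, h1, h2, rfl, rfl⟩ := h
  have e1 := hs.cotCoord_liftPt h1 ζ
  have e2 := hs.cotCoord_liftPt h2 ζ
  have e3 : transversePart (cotCoord φ (liftPt n φ u v ζ)) = (v, ζ) := by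
    rw [e1]
    refine Prod.ext rfl ?_
    ext c
    simp [transversePart]
  rw [e3, e1, e2]
  exact ⟨h1, h2, rfl, rfl⟩

variable [T2Space M] [CompactSpace M]

/-- Locally, the flow maps plaques of the lifted foliation to plaques. -/
lemma exists_sameLift_geoFlow {ξ₀ : Cot n M} (h₀ : SameLift φ ξ₀ ξ₀) :
    ∃ ε > 0, ∀ᶠ P : Cot n M × Cot n M in 𝓝 (ξ₀, ξ₀), SameLift φ P.1 P.2 →
      ∀ s ∈ Ioo (-ε) ε, SameLift φ (geoFlow g s P.1) (geoFlow g s P.2) := by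
  have hs := (F.smoothBox φ hφ).isSmoothChart
  let A := EuclideanSpace ℝ (Fin p)
  let W := EuclideanSpace ℝ (Fin q) × (EuclideanSpace ℝ (Fin q) →L[ℝ] ℝ)
  let N : A → W → (A × EuclideanSpace ℝ (Fin q)) × (A × EuclideanSpace ℝ (Fin q) →L[ℝ] ℝ) :=
    fun u w => hamCoord g φ (liftCoord u w)
  -- A coupled system: two leaf coordinates driven by one common transverse pair (v, ζ). Since the
  -- transverse part of the field is independent of the leaf coordinate, each half solves the full
  -- hamiltonian equations, and the two flow lines share their transverse coordinates.
  let f : A × A × W → A × A × W := fun z =>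
    ((N z.1 z.2.2).1.1, (N z.2.1 z.2.2).1.1, transversePart (N z.1 z.2.2))
  let O : Set (A × A × W) := {z | (z.1, z.2.2.1) ∈ φ.target ∧ (z.2.1, z.2.2.1) ∈ φ.target}
  have hO : IsOpen O := by
    refine IsOpen.inter ?_ ?_
    · exact φ.open_target.preimage 
        (continuous_fst.prodMk (continuous_fst.comp (continuous_snd.comp continuous_snd)))
    · exact φ.open_target.preimage ((continuous_fst.comp
        continuous_snd).prodMk (continuous_fst.comp (continuous_snd.comp continuous_snd)))
  have hf : ContDiffOn ℝ ∞ f O := by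
    have e1 : ContDiffOn ℝ ∞ (fun z : A × A × W => N z.1 z.2.2) O :=
      (hs.contDiffOn_hamCoord g).comp (contDiff_liftCoord.comp
        (contDiff_fst.prodMk contDiff_snd.snd)).contDiffOn fun z hz => ⟨hz.1, mem_univ _⟩
    have e2 : ContDiffOn ℝ ∞ (fun z : A × A × W => N z.2.1 z.2.2) O :=
      (hs.contDiffOn_hamCoord g).comp (contDiff_liftCoord.comp
        (contDiff_snd.fst.prodMk contDiff_snd.snd)).contDiffOn fun z hz => ⟨hz.2, mem_univ _⟩
    exact e1.fst.fst.prodMk (e2.fst.fst.prodMk (contDiff_transversePart.comp_contDiffOn e1))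
  let c : Cot n M × Cot n M → A × A × W := fun P =>
    ((cotCoord φ P.1).1.1, (cotCoord φ P.2).1.1, transversePart (cotCoord φ P.1))
  have hξ₀ : ξ₀.proj ∈ φ.source := h₀.samePlaque.1
  have hcc : ContinuousAt (cotCoord φ) ξ₀ := hs.cotLift.continuousAt hξ₀
  have hc : ContinuousAt c (ξ₀, ξ₀) := by
    have e1 : ContinuousAt (fun P : Cot n M × Cot n M => cotCoord φ P.1) (ξ₀, ξ₀) :=
      ContinuousAt.comp (g := cotCoord φ) (f := Prod.fst) (x := (ξ₀, ξ₀)) hcc continuousAt_fst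
    have e2 : ContinuousAt (fun P : Cot n M × Cot n M => cotCoord φ P.2) (ξ₀, ξ₀) :=
      ContinuousAt.comp (g := cotCoord φ) (f := Prod.snd) (x := (ξ₀, ξ₀)) hcc continuousAt_snd
    exact e1.fst.fst.prodMk (e2.fst.fst.prodMk
      (contDiff_transversePart.continuous.continuousAt.comp e1))
  have hc₀ : c (ξ₀, ξ₀) ∈ O := by
    obtain ⟨h1, h2, -⟩ := eq_liftPt_of_sameLift hs h₀
    exact ⟨h1, h1⟩
  obtain ⟨ε, hε, U, hU, hcU, Φ, hΦ0, hΦ, -⟩ := exists_smooth_local_flow (hO.mem_nhds hc₀) hf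
  refine ⟨ε, hε, ?_⟩
  filter_upwards [hc.preimage_mem_nhds (hU.mem_nhds hcU)] with P hPU hP s hs'
  obtain ⟨h1, h2, h3, h4⟩ := eq_liftPt_of_sameLift hs hP
  let Z : ℝ → A × A × W := fun s => Φ (s, c P)
  have hZ0 : Z 0 = c P := hΦ0 _ hPU
  let L : A →L[ℝ] A × EuclideanSpace ℝ (Fin q) := ContinuousLinearMap.inl ℝ _ _
  have hcurve : ∀ s ∈ Ioo (-ε) ε, HasDerivAt (fun s => liftCoord (Z s).1 (Z s).2.2)
      (hamCoord g φ (liftCoord (Z s).1 (Z s).2.2)) s ∧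
      HasDerivAt (fun s => liftCoord (Z s).2.1 (Z s).2.2)
        (hamCoord g φ (liftCoord (Z s).2.1 (Z s).2.2)) s := by
    intro s hs'
    obtain ⟨hZO, hZd⟩ := hΦ s hs' _ hPU
    -- At a conormal point the field has no leaf component in the momentum, so it is recovered from
    -- its leaf velocity and its transverse part.
    have hlin : ∀ {u : A} {w : W}, (u, w.1) ∈ φ.target → liftCoord (hamCoord g φ
        (liftCoord u w)).1.1 (transversePart (hamCoord g φ (liftCoord u w))) =
        hamCoord g φ (liftCoord u w) := by
      intro u w huw
      refine Prod.ext rfl ?_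
      have e0 := hamCoord_liftCoord_inl hg hφ huw
      have e1 : (hamCoord g φ (liftCoord u w)).2 (0, 0) = 0 := map_zero _
      ext c
      · exact e1.trans (congrArg (fun A => A c) e0).symm
      · simp [liftCoord, transversePart]
    let Λ : A × W →L[ℝ] (A × EuclideanSpace ℝ (Fin q)) × (A × EuclideanSpace ℝ (Fin q) →L[ℝ] ℝ) :=
      (((ContinuousLinearMap.fst ℝ A W)).prod ((ContinuousLinearMap.fst ℝ _ _) ∘L
        (ContinuousLinearMap.snd ℝ A W))).prod
        (((ContinuousLinearMap.compL ℝ (A × EuclideanSpace ℝ (Fin q)) (EuclideanSpace ℝ (Fin q))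
          ℝ).flip (ContinuousLinearMap.snd ℝ A _)) ∘L (ContinuousLinearMap.snd ℝ _ _) ∘L
          (ContinuousLinearMap.snd ℝ A W))
    have hΛ : ∀ z : A × W, Λ z = liftCoord z.1 z.2 := fun z => rfl
    let p1 : A × A × W →L[ℝ] A × W := (ContinuousLinearMap.fst ℝ A (A × W)).prod
      ((ContinuousLinearMap.snd ℝ A W) ∘L (ContinuousLinearMap.snd ℝ A (A × W)))
    let p2 : A × A × W →L[ℝ] A × W := ContinuousLinearMap.snd ℝ A (A × W)
    have e1 := (Λ ∘L p1).hasFDerivAt.comp_hasDerivAt s hZd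
    have e2 := (Λ ∘L p2).hasFDerivAt.comp_hasDerivAt s hZd
    refine ⟨?_, ?_⟩
    · rw [← hlin hZO.1]
      exact e1
    · rw [← hlin hZO.2, ← transversePart_hamCoord_eq hg hφ hZO.1 hZO.2]
      exact e2
  have e1 := hs.geoFlow_eq_of_hasDerivAt g (P := fun s => liftCoord (Z s).1 (Z s).2.2)
    (fun s hs' => ⟨(hΦ s hs' _ hPU).1.1, (hcurve s hs').1⟩) hs'
  have e2 := hs.geoFlow_eq_of_hasDerivAt g (P := fun s => liftCoord (Z s).2.1 (Z s).2.2)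
    (fun s hs' => ⟨(hΦ s hs' _ hPU).1.2, (hcurve s hs').2⟩) hs'
  simp only [hZ0] at e1 e2
  rw [← h3] at e1
  rw [← h4] at e2
  exact ⟨_, _, _, _, (hΦ s hs' _ hPU).1.1, (hΦ s hs' _ hPU).1.2, e1, e2⟩

end ReducedFlow

/-! ### The lifted foliation of the conormal bundle -/

section LiftedFoliation

variable {n : ℕ} {M : Type*} [TopologicalSpace M] [ChartedSpace (EuclideanSpace ℝ (Fin n)) M]
  [IsManifold (𝓡 n) ∞ M] {p q : ℕ} (F : Foliation n M p q)

lemma sameLift_iff {φ : FolChart M p q} (hφ : IsSmoothChart (𝓡 n) φ) {ξ ξ' : Cot n M} :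
    SameLift φ ξ ξ' ↔ SamePlaque φ ξ.proj ξ'.proj ∧ ∃ ζ : EuclideanSpace ℝ (Fin q) →L[ℝ] ℝ,
      (∀ w, covec ξ w = ζ (dTransverse n φ ξ.proj w)) ∧
      ∀ w, covec ξ' w = ζ (dTransverse n φ ξ'.proj w) := by
  constructor
  · intro h
    refine ⟨h.samePlaque, ?_⟩
    obtain ⟨u, u', v, ζ, h1, h2, rfl, rfl⟩ := h
    exact ⟨ζ, hφ.covec_liftPt h1 ζ, hφ.covec_liftPt h2 ζ⟩
  · rintro ⟨⟨h1, h2, h3⟩, ζ, h4, h5⟩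
    have h6 : (φ ξ'.proj).2 = (φ ξ.proj).2 := h3.symm
    refine ⟨(φ ξ.proj).1, (φ ξ'.proj).1, (φ ξ.proj).2, ζ, φ.map_source h1, ?_,
      hφ.eq_liftPt h1 h4, ?_⟩
    · rw [← h6]
      exact φ.map_source h2
    · rw [← h6]
      exact hφ.eq_liftPt h2 h5

namespace Foliation

variable {F}

/-- Compatibility gives τ only as a function. It is differentiable at the point in question because
it agrees nearby with the ψ-coordinates restricted to the local transversal v ↦ φ⁻¹(u, v). The map D
is its derivative there, and it serves for all nearby points of the plaque. -/
lemma exists_dTransverse_eq {φ ψ : FolChart M p q} (hφ : φ ∈ F.atlas) (hψ : ψ ∈ F.atlas) {x : M}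
    (hx : x ∈ φ.source) (hx' : x ∈ ψ.source) :
    ∃ D : EuclideanSpace ℝ (Fin q) →L[ℝ] EuclideanSpace ℝ (Fin q), ∀ᶠ z in 𝓝 x,
      transverse φ z = transverse φ x → transverse ψ z = transverse ψ x ∧
        ∀ w, dTransverse n ψ z w = D (dTransverse n φ z w) := by
  have hs := (F.smoothBox φ hφ).isSmoothChart
  have hs' := (F.smoothBox ψ hψ).isSmoothChart
  obtain ⟨τ, hτ⟩ := F.compatible φ hφ ψ hψ x ⟨hx, hx'⟩
  let j : EuclideanSpace ℝ (Fin q) → M := fun v => φ.symm ((φ x).1, v)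
  have hjx : j (φ x).2 = x := φ.left_inv hx
  have hj : ContMDiffAt 𝓘(ℝ, EuclideanSpace ℝ (Fin q)) (𝓡 n) ∞ j (φ x).2 := by
    have h1 : ContMDiffAt 𝓘(ℝ, EuclideanSpace ℝ (Fin p) × EuclideanSpace ℝ (Fin q)) (𝓡 n) ∞
        φ.symm ((φ x).1, (φ x).2) :=
      (hs.smooth_symm _ (φ.map_source hx)).contMDiffAt
        (φ.open_target.mem_nhds (φ.map_source hx))
    refine h1.comp (φ x).2 (f := fun v => ((φ x).1, v)) ?_
    exact (contDiff_const.prodMk contDiff_id).contMDiff.contMDiffAt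
  have hψx : ContMDiffAt (𝓡 n) 𝓘(ℝ, EuclideanSpace ℝ (Fin q)) ∞ (transverse ψ) (j (φ x).2) := by
    rw [hjx]
    exact hs'.contMDiffAt_transverse hx'
  have hdiff : DifferentiableAt ℝ τ (φ x).2 := by
    have h1 : ContDiffAt ℝ ∞ (transverse ψ ∘ j) (φ x).2 :=
      contMDiffAt_iff_contDiffAt.1 (hψx.comp _ hj)
    refine (h1.differentiableAt (by simp)).congr_of_eventuallyEq ?_
    have hjc : Filter.Tendsto j (𝓝 (φ x).2) (𝓝 x) := by
      have := hj.continuousAt.tendsto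
      rwa [hjx] at this
    have ht : ∀ᶠ v in 𝓝 (φ x).2, ((φ x).1, v) ∈ φ.target :=
      (ContinuousAt.preimage_mem_nhds (f := fun v => ((φ x).1, v)) (by fun_prop)
        (φ.open_target.mem_nhds (φ.map_source hx)))
    filter_upwards [hjc.eventually hτ, ht] with v hv hv'
    have h2 : transverse φ (j v) = v := by
      simp only [transverse, j, φ.right_inv hv']
    rw [h2] at hv
    exact hv.symm
  refine ⟨fderiv ℝ τ (φ x).2, ?_⟩
  filter_upwards [eventually_eventually_nhds.2 hτ, φ.open_source.mem_nhds hx] with z hz hzs hzx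
  refine ⟨?_, fun w => ?_⟩
  · rw [hz.self_of_nhds, hzx, hτ.self_of_nhds]
  · have h1 : HasMFDerivAt (𝓡 n) 𝓘(ℝ, EuclideanSpace ℝ (Fin q)) (τ ∘ transverse φ) z
        (fderiv ℝ τ (φ x).2 ∘L dTransverse n φ z) := by
      have h2 : HasFDerivAt τ (fderiv ℝ τ (φ x).2) (transverse φ z) := by
        rw [hzx]
        exact hdiff.hasFDerivAt
      exact h2.hasMFDerivAt.comp z
        ((hs.contMDiffAt_transverse hzs).mdifferentiableAt (by simp)).hasMFDerivAt
    exact congrArg (fun A => A w) (h1.congr_of_eventuallyEq hz).mfderiv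

/-- Two points of one φ-plaque may lie in different ψ-plaques, so the statement is local. For ξ'
near ξ the same linear change of transverse coordinates applies at both base points, and it converts
ζ into the common transverse part for ψ. -/
lemma eventually_sameLift {φ ψ : FolChart M p q} (hφ : φ ∈ F.atlas) (hψ : ψ ∈ F.atlas)
    {ξ : Cot n M} (hx' : ξ.proj ∈ ψ.source) :
    ∀ᶠ ξ' in 𝓝 ξ, SameLift φ ξ ξ' → SameLift ψ ξ ξ' := by
  have hs := (F.smoothBox φ hφ).isSmoothChart
  have hs' := (F.smoothBox ψ hψ).isSmoothChart
  have hπ : Continuous (fun ξ : Cot n M => ξ.proj) := contMDiff_cot_proj.continuous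
  by_cases hx : ξ.proj ∈ φ.source
  swap
  · exact Filter.Eventually.of_forall fun ξ' h => absurd h.samePlaque.1 hx
  obtain ⟨D, hD⟩ := exists_dTransverse_eq hφ hψ hx hx'
  obtain ⟨D', hD'⟩ := exists_dTransverse_eq hψ hφ hx' hx
  filter_upwards [(hπ.tendsto ξ).eventually hD, (hπ.tendsto ξ).eventually hD',
    (hπ.tendsto ξ).eventually (ψ.open_source.mem_nhds hx')] with ξ' h1 h2 h3 h
  obtain ⟨⟨h4, h5, h6⟩, ζ, h7, h8⟩ := (sameLift_iff hs).1 h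
  have h9 := (h1 h6.symm).1
  refine (sameLift_iff hs').2 ⟨⟨hx', h3, h9.symm⟩, ζ ∘L D', fun w => ?_, fun w => ?_⟩
  · exact (h7 w).trans (congrArg ζ ((hD'.self_of_nhds rfl).2 w))
  · exact (h8 w).trans (congrArg ζ ((h2 h9).2 w))

variable (F)

/-- The covector `ξ` annihilates the leaf through its base point. -/
def IsConormal (ξ : Cot n M) : Prop := ∃ φ ∈ F.atlas, SameLift φ ξ ξ

/-- The equivalence relation of lying in the same leaf of the lifted foliation. -/
def LiftRel : Cot n M → Cot n M → Prop :=
  Relation.ReflTransGen fun ξ ξ' => ∃ φ ∈ F.atlas, SameLift φ ξ ξ'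

variable {F}

lemma IsConormal.sameLift {ξ : Cot n M} (h : F.IsConormal ξ) {ψ : FolChart M p q}
    (hψ : ψ ∈ F.atlas) (hx : ξ.proj ∈ ψ.source) : SameLift ψ ξ ξ := by
  obtain ⟨φ, hφ, h⟩ := h
  exact (eventually_sameLift hφ hψ hx).self_of_nhds h

lemma LiftRel.symm {ξ ξ' : Cot n M} (h : F.LiftRel ξ ξ') : F.LiftRel ξ' ξ := by
  induction h with
  | refl => exact .refl
  | tail _ h ih =>
    obtain ⟨φ, hφ, h⟩ := h
    exact .head ⟨φ, hφ, h.symm⟩ ih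

lemma LiftRel.mem_leaf {ξ ξ' : Cot n M} (h : F.LiftRel ξ ξ') : ξ'.proj ∈ F.leaf ξ.proj := by
  induction h with
  | refl => exact .refl
  | tail _ h ih =>
    obtain ⟨φ, hφ, h⟩ := h
    exact .tail ih ⟨φ, hφ, h.samePlaque⟩

lemma LiftRel.isConormal {ξ ξ' : Cot n M} (h : F.LiftRel ξ ξ') (hξ : F.IsConormal ξ) :
    F.IsConormal ξ' := by
  induction h with
  | refl => exact hξ
  | tail _ h ih =>
    obtain ⟨φ, hφ, h⟩ := h
    exact ⟨φ, hφ, h.symm.left⟩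

lemma LiftRel.energy_eq {g : ContMDiffRiemannianMetric (𝓡 n) ∞ (EuclideanSpace ℝ (Fin n))
    (fun x : M => TangentSpace (𝓡 n) x)} (hg : F.IsBundleLike g) {ξ ξ' : Cot n M}
    (h : F.LiftRel ξ ξ') : energy g ξ = energy g ξ' := by
  induction h with
  | refl => rfl
  | tail _ h ih =>
    obtain ⟨φ, hφ, h⟩ := h
    exact ih.trans (h.energy_eq hg hφ)

lemma isClosed_isConormal : IsClosed {ξ | F.IsConormal (n := n) (M := M) ξ} := by
  refine isOpen_compl_iff.1 (isOpen_iff_mem_nhds.2 fun ξ hξ => ?_)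
  obtain ⟨φ, hφ, hx⟩ := F.cover ξ.proj
  have hs := (F.smoothBox φ hφ).isSmoothChart
  have hcc : ContinuousAt (cotCoord φ) ξ := hs.cotLift.continuousAt hx
  let L : (EuclideanSpace ℝ (Fin p) × EuclideanSpace ℝ (Fin q) →L[ℝ] ℝ) →L[ℝ]
      (EuclideanSpace ℝ (Fin p) →L[ℝ] ℝ) :=
    (ContinuousLinearMap.compL ℝ (EuclideanSpace ℝ (Fin p)) _ ℝ).flip
      (ContinuousLinearMap.inl ℝ _ _)
  have h1 : L (cotCoord φ ξ).2 ≠ 0 := fun h =>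
    hξ ⟨φ, hφ, _, _, _, _, φ.map_source hx, φ.map_source hx, hs.eq_liftPt_cotCoord hx h,
      hs.eq_liftPt_cotCoord hx h⟩
  have h2 : ContinuousAt (fun ξ => L (cotCoord φ ξ).2) ξ :=
    L.continuous.continuousAt.comp hcc.snd
  have hπ : Continuous (fun ξ : Cot n M => ξ.proj) := contMDiff_cot_proj.continuous
  filter_upwards [h2.eventually_ne h1, (hπ.tendsto ξ).eventually (φ.open_source.mem_nhds hx)]
    with ξ' h3 h4 h5
  obtain ⟨u, u', v, ζ, h6, h7, h8, h9⟩ := IsConormal.sameLift h5 hφ h4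
  refine h3 ?_
  rw [h8, hs.cotCoord_liftPt h6]
  ext w
  simp [L]

end Foliation

variable [T2Space M] [CompactSpace M]

variable {F} {g : ContMDiffRiemannianMetric (𝓡 n) ∞ (EuclideanSpace ℝ (Fin n))
    (fun x : M => TangentSpace (𝓡 n) x)} (hg : F.IsBundleLike g)

namespace Foliation

variable (F g) in
/-- The geodesic flow for time `t` maps plaques near `ξ` into plaques. -/
def FlowPreserves (t : ℝ) (ξ : Cot n M) : Prop :=
  ∀ φ ∈ F.atlas, ξ.proj ∈ φ.source → ∀ ψ ∈ F.atlas, (geoFlow g t ξ).proj ∈ ψ.source →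
    ∀ᶠ ξ' in 𝓝 ξ, SameLift φ ξ ξ' → SameLift ψ (geoFlow g t ξ) (geoFlow g t ξ')

lemma continuous_geoFlow_time (t : ℝ) : Continuous (geoFlow (M := M) g t) :=
  (continuous_geoFlow g).comp (continuous_const.prodMk continuous_id)

/-- By `eventually_sameLift` it makes no difference locally which charts are used at the two ends.
-/
lemma FlowPreserves.of_chart {t : ℝ} {ξ : Cot n M} {φ ψ : FolChart M p q} (hφ : φ ∈ F.atlas)
    (hx : ξ.proj ∈ φ.source) (hψ : ψ ∈ F.atlas)
    (h : ∀ᶠ ξ' in 𝓝 ξ, SameLift φ ξ ξ' → SameLift ψ (geoFlow g t ξ) (geoFlow g t ξ')) :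
    F.FlowPreserves g t ξ := by
  intro φ' hφ' hx' ψ' hψ' hy'
  filter_upwards [h, eventually_sameLift hφ' hφ hx,
    ((continuous_geoFlow_time t).tendsto ξ).eventually (eventually_sameLift hψ hψ' hy')]
    with ξ' h1 h2 h3 h4
  exact h3 (h1 (h2 h4))

lemma FlowPreserves.isConormal {t : ℝ} {ξ : Cot n M} (h : F.FlowPreserves g t ξ)
    (hξ : F.IsConormal ξ) : F.IsConormal (geoFlow g t ξ) := by
  obtain ⟨ψ, hψ, hy⟩ := F.cover (geoFlow g t ξ).proj
  obtain ⟨φ, hφ, hξ⟩ := hξ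
  exact ⟨ψ, hψ, (h φ hφ hξ.samePlaque.1 ψ hψ hy).self_of_nhds hξ⟩

lemma FlowPreserves.add {s t : ℝ} {ξ : Cot n M} (h : F.FlowPreserves g t ξ)
    (h' : F.FlowPreserves g s (geoFlow g t ξ)) : F.FlowPreserves g (s + t) ξ := by
  obtain ⟨φ, hφ, hx⟩ := F.cover ξ.proj
  obtain ⟨ψ, hψ, hy⟩ := F.cover (geoFlow g t ξ).proj
  obtain ⟨χ, hχ, hz⟩ := F.cover (geoFlow g s (geoFlow g t ξ)).proj
  refine FlowPreserves.of_chart hφ hx hχ ?_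
  filter_upwards [h φ hφ hx ψ hψ hy,
    ((continuous_geoFlow_time t).tendsto ξ).eventually (h' ψ hψ hy χ hχ hz)] with ξ' h1 h2 h3
  rw [geoFlow_add, geoFlow_add]
  exact h2 (h1 h3)

include hg

lemma exists_flowPreserves {ξ₀ : Cot n M} (h₀ : F.IsConormal ξ₀) : ∃ ε > 0, ∀ᶠ ξ in 𝓝 ξ₀,
    F.IsConormal ξ → ∀ s ∈ Ioo (-ε) ε, F.FlowPreserves g s ξ := by
  obtain ⟨φ, hφ, h₀⟩ := h₀
  obtain ⟨ε, hε, h⟩ := exists_sameLift_geoFlow hg hφ h₀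
  refine ⟨ε, hε, ?_⟩
  have hπ : Continuous (fun ξ : Cot n M => ξ.proj) := contMDiff_cot_proj.continuous
  have h1 := ((continuous_id.prodMk continuous_id).tendsto ξ₀).eventually
    (eventually_eventually_nhds.2 h)
  filter_upwards [h1, (hπ.tendsto ξ₀).eventually (φ.open_source.mem_nhds h₀.samePlaque.1)]
    with ξ h2 h3 h4 s hs
  have h5 := ((continuous_const.prodMk continuous_id).tendsto ξ).eventually h2
  refine FlowPreserves.of_chart hφ h3 hφ ?_
  filter_upwards [h5] with ξ' h6 h7
  exact h6 h7 s hs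

/-- The conormal covectors of bounded energy form a compact set, on which the local existence of ε
becomes uniform. The flow preserves this set, so t can be cut into N short steps. -/
theorem flowPreserves {ξ : Cot n M} (hξ : F.IsConormal ξ) (t : ℝ) : F.FlowPreserves g t ξ := by
  let K : Set (Cot n M) := {η | |energy g η| ≤ energy g ξ} ∩ {η | F.IsConormal η}
  have hK : IsCompact K := (isCompact_energy_le g _).inter_right isClosed_isConormal
  obtain ⟨ε, hε, h⟩ : ∃ ε > 0, ∀ η ∈ K, ∀ s ∈ Ioo (-ε) ε, F.FlowPreserves g s η := by
    refine hK.induction_on (p := fun S => ∃ ε > 0, ∀ η ∈ S, ∀ s ∈ Ioo (-ε) ε,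
      F.FlowPreserves g s η) ⟨1, one_pos, by simp⟩ ?_ ?_ ?_
    · rintro S T hST ⟨ε, hε, h⟩
      exact ⟨ε, hε, fun η hη => h η (hST hη)⟩
    · rintro S T ⟨ε, hε, h⟩ ⟨ε', hε', h'⟩
      refine ⟨min ε ε', lt_min hε hε', fun η hη s hs => ?_⟩
      have h1 := min_le_left ε ε'
      have h2 := min_le_right ε ε'
      rcases hη with hη | hη
      · exact h η hη s ⟨by linarith [hs.1], by linarith [hs.2]⟩
      · exact h' η hη s ⟨by linarith [hs.1], by linarith [hs.2]⟩
    · rintro η ⟨-, hη⟩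
      obtain ⟨ε, hε, h⟩ := exists_flowPreserves hg hη
      refine ⟨_, Filter.inter_mem (mem_nhdsWithin_of_mem_nhds h) self_mem_nhdsWithin, ε, hε, ?_⟩
      rintro η' ⟨h1, h2⟩
      exact h1 h2.2
  obtain ⟨N, hN⟩ := exists_nat_gt (|t| / ε)
  have hN0 : (0 : ℝ) < N := lt_of_le_of_lt (by positivity) hN
  have hs : t / N ∈ Ioo (-ε) ε := by
    rw [mem_Ioo, ← abs_lt, abs_div, Nat.abs_cast, div_lt_comm₀ hN0 hε]
    exact hN
  have key : ∀ k : ℕ, F.FlowPreserves g (k * (t / N)) ξ := by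
    intro k
    induction k with
    | zero =>
      obtain ⟨φ, hφ, hx⟩ := F.cover ξ.proj
      refine FlowPreserves.of_chart hφ hx hφ (Filter.Eventually.of_forall fun ξ' h => ?_)
      simpa using h
    | succ k ih =>
      have h1 : ((k + 1 : ℕ) : ℝ) * (t / N) = t / N + k * (t / N) := by push_cast; ring
      rw [h1]
      refine ih.add (h _ ⟨?_, ih.isConormal hξ⟩ _ hs)
      change |energy g (geoFlow g _ ξ)| ≤ _
      rw [energy_geoFlow, abs_of_nonneg (energy_nonneg g ξ)]
  have h1 := key N
  rwa [mul_div_cancel₀ _ hN0.ne'] at h1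

lemma IsConormal.geoFlow {ξ : Cot n M} (hξ : F.IsConormal ξ) (t : ℝ) :
    F.IsConormal (geoFlow g t ξ) := (flowPreserves hg hξ t).isConormal hξ

/-- The geodesic flow permutes the leaves of the lifted foliation. -/
theorem LiftRel.geoFlow {ξ ξ' : Cot n M} (h : F.LiftRel ξ ξ') (t : ℝ) :
    F.LiftRel (geoFlow g t ξ) (geoFlow g t ξ') := by
  induction h with
  | refl => exact .refl
  | tail _ h ih =>
    refine Relation.ReflTransGen.trans ih ?_
    obtain ⟨φ, hφ, u, u', v, ζ, h1, h2, rfl, rfl⟩ := h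
    have hs := (F.smoothBox φ hφ).isSmoothChart
    have hb := F.smoothBox φ hφ
    have hv := (hb.mem_target.1 h1).2
    let B := Metric.ball (0 : EuclideanSpace ℝ (Fin p)) 1
    have hB : IsPreconnected B := (convex_ball _ _).isPreconnected
    -- A plaque is connected, so it is enough that the relation hold between each point and its
    -- neighbours in the plaque; this is what preservation of plaques by the flow says.
    refine hB.induction₂ (fun u u' => F.LiftRel (BasicWave.geoFlow g t (liftPt n φ u v ζ))
      (BasicWave.geoFlow g t (liftPt n φ u' v ζ))) ?_
      (fun _ _ _ _ _ _ h h' => Relation.ReflTransGen.trans h h') (fun _ _ _ _ h => h.symm)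
      (hb.mem_target.1 h1).1 (hb.mem_target.1 h2).1
    intro a ha
    have hat : (a, v) ∈ φ.target := hb.mem_target.2 ⟨ha, hv⟩
    have hc : SameLift φ (liftPt n φ a v ζ) (liftPt n φ a v ζ) := ⟨a, a, v, ζ, hat, hat, rfl, rfl⟩
    obtain ⟨ψ, hψ, hy⟩ := F.cover (BasicWave.geoFlow g t (liftPt n φ a v ζ)).proj
    have h3 := flowPreserves hg ⟨φ, hφ, hc⟩ t φ hφ hc.samePlaque.1 ψ hψ hy
    have h4 : ContinuousWithinAt (fun u => liftPt n φ u v ζ) B a := by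
      refine (hs.continuousOn_liftPt.comp (s := B) (f := fun u => (u, v, ζ))
        (by fun_prop) fun b hb' => ?_) a ha
      exact hb.mem_target.2 ⟨hb', hv⟩
    filter_upwards [h4.tendsto.eventually h3, self_mem_nhdsWithin] with b h5 hb'
    exact Relation.ReflTransGen.single ⟨ψ, hψ, h5 ⟨a, b, v, ζ, hat, hb.mem_target.2 ⟨hb', hv⟩,
      rfl, rfl⟩⟩

end Foliation

end LiftedFoliation

/-! ### Closed leaves and the minimal stratum -/

section ClosedLeaves

variable {n : ℕ} {M : Type*} [TopologicalSpace M] [ChartedSpace (EuclideanSpace ℝ (Fin n)) M]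
  [IsManifold (𝓡 n) ∞ M] {p q : ℕ} {F : Foliation n M p q}

namespace Foliation

/-- Sliding along the plaques to the leaf coordinate of z is continuous near y, moves points inside
their leaves, and takes y to z. -/
lemma mem_closure_leaf_of_samePlaque {φ : FolChart M p q} (hφ : φ ∈ F.atlas) {x y z : M}
    (h : SamePlaque φ y z) (hy : y ∈ closure (F.leaf x)) : z ∈ closure (F.leaf x) := by
  obtain ⟨h1, h2, h3⟩ := h
  have hb := F.smoothBox φ hφ
  let s : M → M := fun w => φ.symm ((φ z).1, (φ w).2)
  have ht : ∀ w ∈ φ.source, ((φ z).1, (φ w).2) ∈ φ.target := fun w hw =>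
    hb.mem_target.2 ⟨(hb.mem_target.1 (φ.map_source h2)).1, (hb.mem_target.1 (φ.map_source hw)).2⟩
  have hsy : s y = z := by
    have h4 : (φ y).2 = (φ z).2 := h3
    simp only [s, h4]
    exact φ.left_inv h2
  have hs : ContinuousAt s y := by
    have h4 : ContinuousAt (fun w => ((φ z).1, (φ w).2)) y :=
      continuousAt_const.prodMk (φ.continuousAt h1).snd
    exact ContinuousAt.comp (g := φ.symm) (φ.symm.continuousAt (ht y h1)) h4
  rw [mem_closure_iff_frequently] at hy ⊢
  rw [← hsy]
  refine hs.tendsto.frequently ((hy.and_eventually (φ.open_source.mem_nhds h1)).mono ?_)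
  rintro w ⟨h4, h5⟩
  refine Relation.ReflTransGen.tail h4 ⟨φ, hφ, h5, φ.map_target (ht w h5), ?_⟩
  simp only [transverse, s, φ.right_inv (ht w h5)]

/-- The stratum of lowest dimension consists of the closed leaves that meet small distinguished
charts in a single plaque. -/
lemma mem_stratum_zero_iff {x : M} : x ∈ F.stratum 0 ↔ IsClosed (F.leaf x) ∧
    ∀ y ∈ F.leaf x, ∀ φ ∈ F.atlas, y ∈ φ.source →
      ∀ᶠ z in 𝓝 y, z ∈ F.leaf x → transverse φ z = transverse φ y := by
  constructor
  · intro hx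
    have key : ∀ y ∈ closure (F.leaf x), ∀ φ ∈ F.atlas, y ∈ φ.source →
        ∀ᶠ z in 𝓝 y, z ∈ closure (F.leaf x) → transverse φ z = transverse φ y :=
      fun y hy φ hφ hys => (F.smoothBox φ hφ).isSmoothChart.eventually_transverse_eq hys (hx y hy)
        fun z hz => mem_closure_leaf_of_samePlaque hφ hz hy
    refine ⟨isClosed_of_closure_subset fun y hy => ?_, fun y hy φ hφ hys => ?_⟩
    · obtain ⟨φ, hφ, hys⟩ := F.cover y
      -- A limit point y of the leaf has leaf points z arbitrarily close, and those have the
      -- transverse coordinate of y. So y lies in a plaque of the leaf.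
      obtain ⟨z, hz, h1, h2⟩ := ((mem_closure_iff_frequently.1 hy).and_eventually
        ((key y hy φ hφ hys).and (φ.open_source.mem_nhds hys))).exists
      exact Relation.ReflTransGen.tail hz ⟨φ, hφ, h2, hys, h1 (subset_closure hz)⟩
    · filter_upwards [key y (subset_closure hy) φ hφ hys] with z h1 h2
      exact h1 (subset_closure h2)
  · rintro ⟨h1, h2⟩ y hy
    rw [h1.closure_eq] at hy ⊢
    obtain ⟨φ, hφ, hys⟩ := F.cover y
    have hs := (F.smoothBox φ hφ).isSmoothChart
    obtain ⟨O, hO, hOo, hyO⟩ := eventually_nhds_iff.1 (h2 y hy φ hφ hys)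
    refine isSubmanifoldAt_of_submersion (Z := EuclideanSpace ℝ (Fin q))
      (f := fun z => transverse φ z - transverse φ y) (hOo.inter φ.open_source) ⟨hyO, hys⟩ ?_ ?_ ?_
      ?_
    · intro z hz
      have h3 : ContMDiff 𝓘(ℝ, EuclideanSpace ℝ (Fin q)) 𝓘(ℝ, EuclideanSpace ℝ (Fin q)) ∞
          (fun v => v - transverse φ y) := (contDiff_id.sub contDiff_const).contMDiff
      exact (h3.contMDiffAt.comp z (hs.contMDiffAt_transverse hz.2)).contMDiffWithinAt
    · rintro z ⟨hzO, hzs⟩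
      rw [sub_eq_zero]
      exact ⟨fun h => hO z hzO h, fun h => Relation.ReflTransGen.tail hy ⟨φ, hφ, hys, hzs, h.symm⟩⟩
    · rintro z ⟨-, hzs⟩
      have h3 : HasFDerivAt (fun v => v - transverse φ y)
          (ContinuousLinearMap.id ℝ (EuclideanSpace ℝ (Fin q))) (transverse φ z) :=
        (hasFDerivAt_id _).sub_const _
      have h4 := h3.hasMFDerivAt.comp z
        ((hs.contMDiffAt_transverse hzs).mdifferentiableAt (by simp)).hasMFDerivAt
      rw [show mfderiv (𝓡 n) 𝓘(ℝ, EuclideanSpace ℝ (Fin q))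
        (fun z => transverse φ z - transverse φ y) z = _ from h4.mfderiv]
      exact hs.surjective_dTransverse hzs
    · rw [finrank_euclideanSpace_fin, finrank_euclideanSpace_fin, add_zero, add_comm]
      exact hs.finrank_eq hys

end Foliation

end ClosedLeaves

/-! ### Transport of conormal covectors along the leaves -/

section Transport

variable {n : ℕ} {M : Type*} [TopologicalSpace M] [ChartedSpace (EuclideanSpace ℝ (Fin n)) M]
  [IsManifold (𝓡 n) ∞ M] {p q : ℕ} {F : Foliation n M p q}

lemma SameLift.eq_liftPt {φ : FolChart M p q} {ξ ξ' : Cot n M}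
    (h : SameLift φ ξ ξ') {u : EuclideanSpace ℝ (Fin p)} {v : EuclideanSpace ℝ (Fin q)}
    (hu : (u, v) ∈ φ.target) (hξ : ξ.proj = φ.symm (u, v)) : ∃ ζ, ξ = liftPt n φ u v ζ := by
  obtain ⟨u₁, u₂, v₁, ζ, h1, h2, rfl, rfl⟩ := h
  rw [proj_liftPt] at hξ
  have h3 : (u₁, v₁) = (u, v) := φ.symm.injOn h1 hu hξ
  obtain ⟨rfl, rfl⟩ := Prod.mk.inj h3
  exact ⟨ζ, rfl⟩

lemma IsSmoothChart.covec_liftPt_eq_iff {φ : FolChart M p q} (hφ : IsSmoothChart (𝓡 n) φ)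
    {u : EuclideanSpace ℝ (Fin p)} {v : EuclideanSpace ℝ (Fin q)} (h : (u, v) ∈ φ.target)
    {a b : ℝ} {ζ ζ₁ ζ₂ : EuclideanSpace ℝ (Fin q) →L[ℝ] ℝ} :
    covec (liftPt n φ u v ζ) = a • covec (liftPt n φ u v ζ₁) + b • covec (liftPt n φ u v ζ₂) ↔
      ζ = a • ζ₁ + b • ζ₂ := by
  have key : ∀ (ζ : EuclideanSpace ℝ (Fin q) →L[ℝ] ℝ) (X : EuclideanSpace ℝ (Fin n)),
      covec (liftPt n φ u v ζ) X = ζ (dTransverse n φ (φ.symm (u, v)) X) := hφ.covec_liftPt h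
  constructor
  · intro h1
    ext w
    obtain ⟨X, rfl⟩ := hφ.surjective_dTransverse (φ.map_target h) w
    have h2 : covec (liftPt n φ u v ζ) X =
        a * covec (liftPt n φ u v ζ₁) X + b * covec (liftPt n φ u v ζ₂) X :=
      congrArg (fun A : EuclideanSpace ℝ (Fin n) →L[ℝ] ℝ => A X) h1
    exact (key ζ X).symm.trans (h2.trans (congrArg₂ (fun s t => a * s + b * t) (key ζ₁ X)
      (key ζ₂ X)))
  · rintro rfl
    refine ContinuousLinearMap.ext fun X => ?_
    exact (key _ X).trans (congrArg₂ (fun s t => a * s + b * t) (key ζ₁ X) (key ζ₂ X)).symm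

namespace Foliation

/-- Covectors can be transported along the leaves. -/
lemma exists_transport {x y : M} (h : y ∈ F.leaf x) : ∃ T : Cot n M → Cot n M,
    InjOn T {ξ | F.IsConormal ξ ∧ ξ.proj = x} ∧
      ∀ ξ, F.IsConormal ξ → ξ.proj = x → (T ξ).proj = y ∧ F.LiftRel ξ (T ξ) := by
  induction h with
  | refl => exact ⟨id, injOn_id _, fun ξ _ hξ => ⟨hξ, .refl⟩⟩
  | @tail y z _ h ih =>
    obtain ⟨T, hT, hT'⟩ := ih
    obtain ⟨φ, hφ, hy, hz, hyz⟩ := h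
    have hs := (F.smoothBox φ hφ).isSmoothChart
    have hyt : ((φ y).1, (φ z).2) ∈ φ.target := by
      have h1 : (φ y).2 = (φ z).2 := hyz
      rw [← h1]
      exact φ.map_source hy
    have hzt : ((φ z).1, (φ z).2) ∈ φ.target := φ.map_source hz
    have key : ∀ ξ, F.IsConormal ξ → ξ.proj = x → ∃ ζ, T ξ = liftPt n φ (φ y).1 (φ z).2 ζ := by
      intro ξ hξ hx
      obtain ⟨h1, h2⟩ := hT' ξ hξ hx
      have h3 := (h2.isConormal hξ).sameLift hφ (h1 ▸ hy)
      refine h3.eq_liftPt hyt ?_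
      have h4 : ((φ y).1, (φ z).2) = φ y := Prod.ext rfl hyz.symm
      rw [h1, h4, φ.left_inv hy]
    choose! ζ hζ using key
    refine ⟨fun ξ => liftPt n φ (φ z).1 (φ z).2 (ζ ξ), ?_, fun ξ hξ hx => ⟨φ.left_inv hz, ?_⟩⟩
    · rintro ξ ⟨hξ, hx⟩ ξ' ⟨hξ', hx'⟩ h1
      refine hT ⟨hξ, hx⟩ ⟨hξ', hx'⟩ ?_
      rw [hζ ξ hξ hx, hζ ξ' hξ' hx', hs.liftPt_injective hzt h1]
    · refine Relation.ReflTransGen.tail (hT' ξ hξ hx).2 ⟨φ, hφ, ?_⟩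
      rw [hζ ξ hξ hx]
      exact ⟨_, _, _, _, hyt, hzt, rfl, rfl⟩

/-- Transport along the leaves is linear. -/
lemma LiftRel.exists_linear {ξ ξ' : Cot n M} (h : F.LiftRel ξ ξ') {a b : ℝ} {ξ₁ ξ₂ : Cot n M}
    (h₁ : F.IsConormal ξ₁) (h₂ : F.IsConormal ξ₂) (hp₁ : ξ₁.proj = ξ.proj)
    (hp₂ : ξ₂.proj = ξ.proj) (hab : covec ξ = a • covec ξ₁ + b • covec ξ₂) :
    ∃ ξ₁' ξ₂', F.LiftRel ξ₁ ξ₁' ∧ F.LiftRel ξ₂ ξ₂' ∧ ξ₁'.proj = ξ'.proj ∧ ξ₂'.proj = ξ'.proj ∧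
      covec ξ' = a • covec ξ₁' + b • covec ξ₂' := by
  induction h with
  | refl => exact ⟨ξ₁, ξ₂, .refl, .refl, hp₁, hp₂, hab⟩
  | tail _ h ih =>
    obtain ⟨η₁, η₂, h1, h2, hq₁, hq₂, hη⟩ := ih
    obtain ⟨φ, hφ, u, u', v, ζ, ht, ht', rfl, rfl⟩ := h
    have hs := (F.smoothBox φ hφ).isSmoothChart
    rw [proj_liftPt] at hq₁ hq₂
    obtain ⟨ζ₁, rfl⟩ := ((h1.isConormal h₁).sameLift hφ (hq₁ ▸ φ.map_target ht)).eq_liftPt ht hq₁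
    obtain ⟨ζ₂, rfl⟩ := ((h2.isConormal h₂).sameLift hφ (hq₂ ▸ φ.map_target ht)).eq_liftPt ht hq₂
    have hζ := (hs.covec_liftPt_eq_iff ht).1 hη
    refine ⟨liftPt n φ u' v ζ₁, liftPt n φ u' v ζ₂, h1.tail ⟨φ, hφ, _, _, _, _, ht, ht', rfl, rfl⟩,
      h2.tail ⟨φ, hφ, _, _, _, _, ht, ht', rfl, rfl⟩, rfl, rfl, (hs.covec_liftPt_eq_iff ht').2 hζ⟩

/-- The holonomy orbit, in the conormal space at a point of a distinguished chart. -/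
def orbit (F : Foliation n M p q) (φ : FolChart M p q) (u : EuclideanSpace ℝ (Fin p))
    (v : EuclideanSpace ℝ (Fin q)) (ζ : EuclideanSpace ℝ (Fin q) →L[ℝ] ℝ) :
    Set (EuclideanSpace ℝ (Fin q) →L[ℝ] ℝ) :=
  {ζ' | F.LiftRel (liftPt n φ u v ζ) (liftPt n φ u v ζ')}

variable {φ : FolChart M p q} (hφ : φ ∈ F.atlas) {u : EuclideanSpace ℝ (Fin p)}
    {v : EuclideanSpace ℝ (Fin q)} (hu : (u, v) ∈ φ.target)
include hφ hu

lemma isConormal_liftPt (ζ : EuclideanSpace ℝ (Fin q) →L[ℝ] ℝ) :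
    F.IsConormal (liftPt n φ u v ζ) := ⟨φ, hφ, _, _, _, _, hu, hu, rfl, rfl⟩

/-- A chain of plaques that transports the combination transports both summands, and the result is
the combination of the results. Only an inclusion holds, since independent choices of chains for the
summands are also allowed on the right; it suffices for finiteness. -/
lemma orbit_linear_subset (a b : ℝ) (ζ₁ ζ₂ : EuclideanSpace ℝ (Fin q) →L[ℝ] ℝ) :
    F.orbit φ u v (a • ζ₁ + b • ζ₂) ⊆
      image2 (fun η₁ η₂ => a • η₁ + b • η₂) (F.orbit φ u v ζ₁) (F.orbit φ u v ζ₂) := by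
  intro ζ' h
  have hs := (F.smoothBox φ hφ).isSmoothChart
  obtain ⟨η₁, η₂, h1, h2, h3, h4, h5⟩ := LiftRel.exists_linear (a := a) (b := b) h
    (isConormal_liftPt hφ hu ζ₁) (isConormal_liftPt hφ hu ζ₂) rfl rfl
    ((hs.covec_liftPt_eq_iff hu).2 rfl)
  obtain ⟨ζ₁', rfl⟩ := ((h1.isConormal (isConormal_liftPt hφ hu ζ₁)).sameLift hφ
    (h3 ▸ φ.map_target hu)).eq_liftPt hu h3
  obtain ⟨ζ₂', rfl⟩ := ((h2.isConormal (isConormal_liftPt hφ hu ζ₂)).sameLift hφ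
    (h4 ▸ φ.map_target hu)).eq_liftPt hu h4
  exact ⟨ζ₁', h1, ζ₂', h2, ((hs.covec_liftPt_eq_iff hu).1 h5).symm⟩

variable (F) in
/-- The conormal vectors with finite holonomy orbit form a linear subspace. -/
def finiteOrbits : Submodule ℝ (EuclideanSpace ℝ (Fin q) →L[ℝ] ℝ) where
  carrier := {ζ | (F.orbit φ u v ζ).Finite}
  add_mem' {ζ₁ ζ₂} h₁ h₂ := (Finite.image2 _ h₁ h₂).subset (by
    simpa only [one_smul] using orbit_linear_subset hφ hu 1 1 ζ₁ ζ₂)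
  zero_mem' := by
    refine (finite_singleton (0 : EuclideanSpace ℝ (Fin q) →L[ℝ] ℝ)).subset ?_
    have h := orbit_linear_subset hφ hu 0 0 0 0
    simp only [zero_smul, add_zero] at h
    rintro ζ hζ
    obtain ⟨ζ₁, -, ζ₂, -, h1⟩ := h hζ
    exact h1.symm
  smul_mem' r ζ h := (Finite.image2 (fun η₁ η₂ => r • η₁ + (0 : ℝ) • η₂) h h).subset (by
    simpa only [zero_smul, add_zero] using orbit_linear_subset hφ hu r 0 ζ ζ)

end Foliation

end Transport

/-! ### Finite holonomy orbits and the minimal stratum -/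

/-- The points of C where the local property fails form a compact set; its image is closed and does
not contain z. -/
lemma eventually_mem_image_of_isCompact {X Y : Type*} [TopologicalSpace X] [TopologicalSpace Y]
    [T2Space Y] {C : Set X} (hC : IsCompact C) {f : X → Y} (hf : Continuous f) {Q : Y → Prop}
    {z : Y} (h : ∀ c ∈ C, f c = z → ∀ᶠ c' in 𝓝 c, c' ∈ C → Q (f c')) :
    ∀ᶠ z' in 𝓝 z, z' ∈ f '' C → Q z' := by
  let D := C ∩ {c | ∀ᶠ c' in 𝓝 c, c' ∈ C → Q (f c')}ᶜ
  have hD : IsCompact (f '' D) :=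
    (hC.inter_right (isOpen_setOfPred_eventually_nhds.isClosed_compl)).image hf
  have hz : z ∉ f '' D := by
    rintro ⟨c, ⟨h1, h2⟩, h3⟩
    exact h2 (h c h1 h3)
  filter_upwards [hD.isClosed.isOpen_compl.mem_nhds hz]
  rintro _ h1 ⟨c, hc, rfl⟩
  by_contra h2
  exact h1 ⟨c, ⟨hc, fun h3 => h2 (h3.self_of_nhds hc)⟩, rfl⟩

section FiniteOrbits

variable {n : ℕ} {M : Type*} [TopologicalSpace M] [ChartedSpace (EuclideanSpace ℝ (Fin n)) M]
  [IsManifold (𝓡 n) ∞ M] {p q : ℕ} {F : Foliation n M p q}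

namespace Foliation

variable {φ : FolChart M p q} (hφ : φ ∈ F.atlas) {u : EuclideanSpace ℝ (Fin p)}
    {v : EuclideanSpace ℝ (Fin q)} (hu : (u, v) ∈ φ.target)
    {ζ : EuclideanSpace ℝ (Fin q) →L[ℝ] ℝ}

include hφ hu

/-- Transport back to the original point is injective and lands in the orbit there, so finiteness of
one fibre of the lifted leaf passes to all fibres. -/
lemma finite_liftRel_fiber (hζ : (F.orbit φ u v ζ).Finite) {ψ : FolChart M p q}
    (hψ : ψ ∈ F.atlas) {a : EuclideanSpace ℝ (Fin p)} {b : EuclideanSpace ℝ (Fin q)}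
    (ha : (a, b) ∈ ψ.target) (hx : ψ.symm (a, b) ∈ F.leaf (φ.symm (u, v))) :
    {η | F.LiftRel (liftPt n φ u v ζ) (liftPt n ψ a b η)}.Finite := by
  have hs := (F.smoothBox ψ hψ).isSmoothChart
  have hx' : φ.symm (u, v) ∈ F.leaf (ψ.symm (a, b)) := by
    rw [F.leaf_eq_of_mem hx]
    exact F.mem_leaf_self _
  obtain ⟨T, hT, hT'⟩ := exists_transport hx'
  have hc := fun η => isConormal_liftPt hψ ha η
  refine Finite.of_finite_image (f := fun η => T (liftPt n ψ a b η))
    ((hζ.image (liftPt n φ u v)).subset ?_) fun η _ η' _ h => hs.liftPt_injective ha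
      (hT ⟨hc η, rfl⟩ ⟨hc η', rfl⟩ h)
  rintro _ ⟨η, hη, rfl⟩
  obtain ⟨h1, h2⟩ := hT' _ (hc η) rfl
  obtain ⟨ζ', h3⟩ := ((h2.isConormal (hc η)).sameLift hφ (h1 ▸ φ.map_target hu)).eq_liftPt hu h1
  refine ⟨ζ', ?_, h3.symm⟩
  change F.LiftRel _ _
  rw [← h3]
  exact Relation.ReflTransGen.trans hη h2

/-- Over a leaf of the minimal stratum, a finite holonomy orbit spans a leaf of the lifted
foliation that meets small charts in a single plaque. -/
lemma eventually_sameLift_of_liftRel (hx : φ.symm (u, v) ∈ F.stratum 0)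
    (hζ : (F.orbit φ u v ζ).Finite) {η : Cot n M} (hη : F.IsConormal η)
    (hηx : η.proj ∈ F.leaf (φ.symm (u, v))) {ψ : FolChart M p q} (hψ : ψ ∈ F.atlas)
    (hηψ : η.proj ∈ ψ.source) :
    ∀ᶠ η' in 𝓝 η, F.LiftRel (liftPt n φ u v ζ) η' → SameLift ψ η η' := by
  have hs := (F.smoothBox ψ hψ).isSmoothChart
  have hπ : Continuous (fun ξ : Cot n M => ξ.proj) := contMDiff_cot_proj.continuous
  obtain ⟨a, a', b, ζ₁, ha, -, rfl, -⟩ := hη.sameLift hψ hηψ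
  have hfin := finite_liftRel_fiber hφ hu hζ hψ ha hηx
  let L : (EuclideanSpace ℝ (Fin p) × EuclideanSpace ℝ (Fin q) →L[ℝ] ℝ) →L[ℝ]
      (EuclideanSpace ℝ (Fin q) →L[ℝ] ℝ) :=
    (ContinuousLinearMap.compL ℝ (EuclideanSpace ℝ (Fin q)) _ ℝ).flip
      (ContinuousLinearMap.inr ℝ _ _)
  have hL : ∀ {a b ζ}, (a, b) ∈ ψ.target → L (cotCoord ψ (liftPt n ψ a b ζ)).2 = ζ := by
    intro a b ζ h
    rw [hs.cotCoord_liftPt h]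
    ext w
    simp [L]
  have hcc : ContinuousAt (fun ξ => L (cotCoord ψ ξ).2) (liftPt n ψ a b ζ₁) :=
    L.continuous.continuousAt.comp (hs.cotLift.continuousAt hηψ).snd
  -- The other momenta of the lifted leaf in this fibre are finite in number, so they stay away from
  -- ζ₁. Points of the lifted leaf near η project to the same plaque, because the leaf is closed and
  -- locally a single plaque; sliding them to the fibre of η then forces the momentum ζ₁.
  have hne := hcc.eventually ((hfin.subset (sdiff_subset (t := {ζ₁}))).isClosed.isOpen_compl.mem_nhds
    fun h => h.2 (hL ha))
  filter_upwards [hne, (hπ.tendsto _).eventually (ψ.open_source.mem_nhds hηψ),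
    (hπ.tendsto _).eventually ((mem_stratum_zero_iff.1 hx).2 _ hηx ψ hψ hηψ)] with η' h1 h2 h3 h4
  obtain ⟨a₂, -, b₂, ζ₂, h5, -, h6, -⟩ :=
    (h4.isConormal (isConormal_liftPt hφ hu ζ)).sameLift hψ h2
  have h7 := h3 h4.mem_leaf
  rw [h6, proj_liftPt, proj_liftPt] at h7
  simp only [transverse, ψ.right_inv h5, ψ.right_inv ha] at h7
  subst h7
  have h8 : ζ₂ = ζ₁ := by
    by_contra h9
    refine h1 ⟨?_, ?_⟩
    · rw [h6, hL h5]
      exact Relation.ReflTransGen.tail h4 ⟨ψ, hψ, a₂, a, b₂, ζ₂, h5, ha, h6, rfl⟩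
    · rw [h6, hL h5]
      exact h9
  subst h8
  exact ⟨a, a₂, b₂, ζ₂, ha, h5, rfl, h6⟩

variable [T2Space M] [CompactSpace M]
  {g : ContMDiffRiemannianMetric (𝓡 n) ∞ (EuclideanSpace ℝ (Fin n))
    (fun x : M => TangentSpace (𝓡 n) x)} (hg : F.IsBundleLike g)
include hg

/-- The energy is constant on a lifted leaf, so the leaf lies in a compact set. It is closed: a
limit point is conormal and lies over the closed leaf, and nearby points of the lifted leaf belong
to its plaque. -/
lemma isCompact_liftRel (hx : φ.symm (u, v) ∈ F.stratum 0) (hζ : (F.orbit φ u v ζ).Finite) :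
    IsCompact {η | F.LiftRel (liftPt n φ u v ζ) η} := by
  have hc := isConormal_liftPt hφ hu ζ
  have hπ : Continuous (fun ξ : Cot n M => ξ.proj) := contMDiff_cot_proj.continuous
  refine (isCompact_energy_le g (energy g (liftPt n φ u v ζ))).of_isClosed_subset
    (isClosed_of_closure_subset fun η hη => ?_) fun η hη => ?_
  · have h1 : F.IsConormal η :=
      closure_minimal (fun η' h => LiftRel.isConormal h hc) isClosed_isConormal hη
    have h2 : η.proj ∈ F.leaf (φ.symm (u, v)) :=
      closure_minimal (fun η' h => LiftRel.mem_leaf h)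
        ((mem_stratum_zero_iff.1 hx).1.preimage hπ) hη
    obtain ⟨ψ, hψ, hηψ⟩ := F.cover η.proj
    obtain ⟨η', h3, h4⟩ := ((mem_closure_iff_frequently.1 hη).and_eventually
      (eventually_sameLift_of_liftRel hφ hu hx hζ h1 h2 hψ hηψ)).exists
    exact Relation.ReflTransGen.tail h3 ⟨ψ, hψ, (h4 h3).symm⟩
  · change |energy g η| ≤ _
    rw [← LiftRel.energy_eq hg hη, abs_of_nonneg (energy_nonneg g _)]

/-- The geodesics that start in the direction of a finite holonomy orbit stay in the minimal
stratum. -/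
theorem proj_geoFlow_mem_stratum (hx : φ.symm (u, v) ∈ F.stratum 0)
    (hζ : (F.orbit φ u v ζ).Finite) (t : ℝ) :
    (geoFlow g t (liftPt n φ u v ζ)).proj ∈ F.stratum 0 := by
  have hc := isConormal_liftPt hφ hu ζ
  let C := {η | F.LiftRel (liftPt n φ u v ζ) η}
  let f : Cot n M → M := fun η => (geoFlow g t η).proj
  have hC : IsCompact C := isCompact_liftRel hφ hu hg hx hζ
  have hπ : Continuous (fun ξ : Cot n M => ξ.proj) := contMDiff_cot_proj.continuous
  have hf : Continuous f := hπ.comp (continuous_geoFlow_time t)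
  -- A point z of the leaf at the endpoint receives a transported covector; flowing it back for time
  -- t lands in C, as the flow permutes the lifted leaves. Hence this leaf is the projection of the
  -- flowed compact set.
  have hfC : F.leaf (geoFlow g t (liftPt n φ u v ζ)).proj = f '' C := by
    ext z
    constructor
    · intro hz
      obtain ⟨T, -, hT⟩ := exists_transport hz
      obtain ⟨h1, h2⟩ := hT _ (hc.geoFlow hg t) rfl
      have h3 := h2.geoFlow hg (-t)
      rw [← geoFlow_add, neg_add_cancel, geoFlow_zero] at h3
      refine ⟨_, h3, ?_⟩
      change (geoFlow g t (geoFlow g (-t) _)).proj = z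
      rw [← geoFlow_add, add_neg_cancel, geoFlow_zero, h1]
    · rintro ⟨η, hη, rfl⟩
      exact (LiftRel.geoFlow hg hη t).mem_leaf
  rw [mem_stratum_zero_iff, hfC]
  refine ⟨(hC.image hf).isClosed, fun y _ ψ hψ hy => ?_⟩
  -- Several points of C may end at the same y, so each of them must be controlled: near each, C is
  -- one lifted plaque, which the flow maps into a plaque.
  refine eventually_mem_image_of_isCompact hC hf ?_
  rintro η hη rfl
  obtain ⟨χ, hχ, hηχ⟩ := F.cover η.proj
  filter_upwards [eventually_sameLift_of_liftRel hφ hu hx hζ (LiftRel.isConormal hη hc)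
    (LiftRel.mem_leaf hη) hχ hηχ, flowPreserves hg (LiftRel.isConormal hη hc) t χ hχ hηχ ψ hψ hy]
    with η' h1 h2 h3
  exact (h2 (h1 h3)).samePlaque.2.2.symm

/-- Conversely, geodesics that end in the minimal stratum start in the direction of a finite
holonomy orbit. -/
theorem finite_orbit {t : ℝ} (hx : (geoFlow g t (liftPt n φ u v ζ)).proj ∈ F.stratum 0)
    {D : Set (EuclideanSpace ℝ (Fin q) →L[ℝ] ℝ)} (hD : IsCompact D) (hζD : F.orbit φ u v ζ ⊆ D)
    {ψ : FolChart M p q} (hψ : ψ ∈ F.atlas)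
    (hDψ : ∀ η ∈ D, (geoFlow g t (liftPt n φ u v η)).proj ∈ ψ.source)
    (hinj : InjOn (fun η => transverse ψ (geoFlow g t (liftPt n φ u v η)).proj) D) :
    (F.orbit φ u v ζ).Finite := by
  have hs := (F.smoothBox φ hφ).isSmoothChart
  have hπ : Continuous (fun ξ : Cot n M => ξ.proj) := contMDiff_cot_proj.continuous
  let f : (EuclideanSpace ℝ (Fin q) →L[ℝ] ℝ) → M := fun η => (geoFlow g t (liftPt n φ u v η)).proj
  have hf : Continuous f := by
    refine hπ.comp ((continuous_geoFlow_time t).comp (continuousOn_univ.1 ?_))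
    exact hs.continuousOn_liftPt.comp (f := fun η => (u, v, η)) (by fun_prop) fun η _ => hu
  obtain ⟨h1, h2⟩ := mem_stratum_zero_iff.1 hx
  -- The flow sends the orbit into the closed leaf through the endpoint, so the orbit lies in the
  -- compact set K. On K the transverse coordinate of the endpoint is locally constant, hence takes
  -- finitely many values, and it separates the points of the orbit.
  let K := D ∩ f ⁻¹' F.leaf (f ζ)
  have hK : IsCompact K := hD.inter_right (h1.preimage hf)
  have hKfin : ((fun η => transverse ψ (f η)) '' K).Finite := by
    refine hK.induction_on (p := fun S => ((fun η => transverse ψ (f η)) '' S).Finite) (by simp)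
      (fun S T hST h => h.subset (image_mono hST)) (fun S T h h' => ?_) ?_
    · rw [image_union]
      exact h.union h'
    · rintro η ⟨hηD, hη⟩
      refine ⟨_, Filter.inter_mem (mem_nhdsWithin_of_mem_nhds
        ((hf.tendsto η).eventually (h2 _ hη ψ hψ (hDψ η hηD)))) self_mem_nhdsWithin,
        (finite_singleton (transverse ψ (f η))).subset ?_⟩
      rintro _ ⟨η', ⟨h3, h4⟩, rfl⟩
      exact h3 h4.2
  refine Finite.of_finite_image (f := fun η => transverse ψ (f η)) (hKfin.subset ?_)
    (hinj.mono hζD)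
  refine image_mono fun η hη => ⟨hζD hη, ?_⟩
  exact (LiftRel.geoFlow hg hη t).mem_leaf

end Foliation

end FiniteOrbits

/-! ### The minimal stratum is locally a product -/

lemma exists_isSubmanifoldAt_submodule {E : Type*} [NormedAddCommGroup E] [NormedSpace ℝ E]
    [FiniteDimensional ℝ E] (A : Submodule ℝ E) (x : E) :
    ∃ d, IsSubmanifoldAt 𝓘(ℝ, E) (A : Set E) d x := by
  obtain ⟨B, hB⟩ := A.exists_isCompl
  let P : E →L[ℝ] B := LinearMap.toContinuousLinearMap (B.projectionOnto A hB.symm)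
  refine exists_isSubmanifoldAt_of_submersion (Z := B) isOpen_univ (mem_univ _) (f := P)
    P.contDiff.contMDiff.contMDiffOn (fun z _ => ?_) fun z _ => ?_
  · have h := Submodule.ker_projectionOnto hB.symm
    rw [SetLike.mem_coe, ← h]
    exact LinearMap.mem_ker
  · rw [mfderiv_eq_fderiv, P.fderiv]
    exact Submodule.projectionOnto_surjective hB.symm

section Slices

variable {n : ℕ} {M : Type*} [TopologicalSpace M] [ChartedSpace (EuclideanSpace ℝ (Fin n)) M]
  [IsManifold (𝓡 n) ∞ M] {p q : ℕ} {F : Foliation n M p q}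
  (g : ContMDiffRiemannianMetric (𝓡 n) ∞ (EuclideanSpace ℝ (Fin n))
    (fun x : M => TangentSpace (𝓡 n) x))

lemma energy_scale (r : ℝ) (ξ : Cot n M) : energy g (scale r ξ) = r ^ 2 * energy g ξ := by
  let κ := chartAt (EuclideanSpace ℝ (Fin n)) ξ.proj
  have hκ : IsSmoothChart (𝓡 n) κ := isSmoothChart_chartAt _
  have hξ : ξ.proj ∈ κ.source := mem_chart_source _ _
  have h1 : ∀ η : Cot n M, η.proj ∈ κ.source → energy g η =
      (cotCoord κ η).2 ((chartMetric g κ (cotCoord κ η).1).inverse (cotCoord κ η).2) / 2 :=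
    fun η hη => by
      rw [← hκ.energy_cotCoordSymm g (P := cotCoord κ η) (κ.map_source hη),
        hκ.cotCoordSymm_cotCoord hη]
  rw [h1 _ hξ, h1 (scale r ξ) hξ, cotCoord_scale]
  simp only [map_smul, smul_apply, smul_eq_mul]
  ring

variable {φ : FolChart M p q} (hφ : IsSmoothChart (𝓡 n) φ) {u : EuclideanSpace ℝ (Fin p)}
    {v : EuclideanSpace ℝ (Fin q)} (hu : (u, v) ∈ φ.target)
include hφ hu

lemma continuous_liftPt : Continuous (liftPt n φ u v) :=
  continuousOn_univ.1 (hφ.continuousOn_liftPt.comp (f := fun η => (u, v, η)) (by fun_prop)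
    fun _ _ => hu)

lemma covec_liftPt_ne_zero {ζ : EuclideanSpace ℝ (Fin q) →L[ℝ] ℝ} (hζ : ζ ≠ 0) :
    covec (liftPt n φ u v ζ) ≠ 0 := by
  intro h
  refine hζ ?_
  have h1 := (hφ.covec_liftPt_eq_iff hu (a := 0) (b := 0) (ζ := ζ) (ζ₁ := 0) (ζ₂ := 0)).1
    (by
      rw [h]
      simp only [zero_smul, add_zero])
  simpa using h1

/-- Covectors of small energy are small. -/
lemma exists_energy_lt {δ : ℝ} (hδ : 0 < δ) : ∃ r > 0, ∀ ζ, energy g (liftPt n φ u v ζ) < r →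
    ζ ∈ Metric.closedBall 0 δ := by
  have hc : Continuous fun ζ => energy g (liftPt n φ u v ζ) :=
    (contMDiff_energy g).continuous.comp (continuous_liftPt hφ hu)
  have hpos : ∀ ζ ≠ 0, 0 < energy g (liftPt n φ u v ζ) := fun ζ hζ =>
    energy_pos g (covec_liftPt_ne_zero hφ hu hζ)
  obtain ⟨r, hr, h⟩ : ∃ r > 0, ∀ ζ ∈ Metric.sphere 0 δ, r ≤ energy g (liftPt n φ u v ζ) := by
    rcases (Metric.sphere (0 : EuclideanSpace ℝ (Fin q) →L[ℝ] ℝ) δ).eq_empty_or_nonempty with h | h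
    · exact ⟨1, one_pos, by simp [h]⟩
    · obtain ⟨ζ, hζ, hmin⟩ := (isCompact_sphere _ δ).exists_isMinOn h hc.continuousOn
      refine ⟨_, hpos ζ ?_, fun η hη => hmin hη⟩
      rintro rfl
      simp only [mem_sphere_iff_norm, sub_self, norm_zero] at hζ
      exact hδ.ne hζ
  refine ⟨r, hr, fun ζ hζ => ?_⟩
  by_contra hn
  rw [mem_closedBall_zero_iff, not_le] at hn
  have hn0 : 0 < ‖ζ‖ := hδ.trans hn
  -- A covector outside the ball is shrunk to the sphere of radius δ, which does not increase its
  -- energy since the energy is quadratic.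
  have h1 := h ((δ / ‖ζ‖) • ζ) (by
    rw [mem_sphere_zero_iff_norm, norm_smul, Real.norm_of_nonneg (by positivity),
      div_mul_cancel₀ _ hn0.ne'])
  rw [← scale_liftPt, energy_scale] at h1
  have h2 : (δ / ‖ζ‖) ^ 2 ≤ 1 := pow_le_one₀ (by positivity) ((div_le_one hn0).2 hn.le)
  have h3 := mul_le_of_le_one_left (energy_nonneg g (liftPt n φ u v ζ)) h2
  linarith

variable [T2Space M] [CompactSpace M]

lemma geoFlow_liftPt_smul (t s : ℝ) (ζ : EuclideanSpace ℝ (Fin q) →L[ℝ] ℝ) :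
    (geoFlow g t (liftPt n φ u v (s • ζ))).proj = (geoFlow g (s * t) (liftPt n φ u v ζ)).proj := by
  rw [← scale_liftPt, geoFlow_scale, proj_scale]

/-- The geodesics orthogonal to the leaf through a point parametrize a local transversal. -/
lemma exists_exponential_chart :
    ∃ e : OpenPartialHomeomorph (EuclideanSpace ℝ (Fin q) →L[ℝ] ℝ) (EuclideanSpace ℝ (Fin q)),
      0 ∈ e.source ∧ e 0 = v ∧
      (∀ ζ ∈ e.source, (geoFlow g 1 (liftPt n φ u v ζ)).proj ∈ φ.source ∧
        transverse φ (geoFlow g 1 (liftPt n φ u v ζ)).proj = e ζ) ∧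
      ContDiffOn ℝ ∞ e e.source ∧ ContDiffOn ℝ ∞ e.symm e.target := by
  let ex : (EuclideanSpace ℝ (Fin q) →L[ℝ] ℝ) → M := fun ζ => (geoFlow g 1 (liftPt n φ u v ζ)).proj
  let f : (EuclideanSpace ℝ (Fin q) →L[ℝ] ℝ) → EuclideanSpace ℝ (Fin q) :=
    fun ζ => transverse φ (ex ζ)
  have hex : ContMDiff 𝓘(ℝ, EuclideanSpace ℝ (Fin q) →L[ℝ] ℝ) (𝓡 n) ∞ ex := by
    let j : (EuclideanSpace ℝ (Fin q) →L[ℝ] ℝ) → (EuclideanSpace ℝ (Fin p) ×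
        EuclideanSpace ℝ (Fin q)) × (EuclideanSpace ℝ (Fin p) × EuclideanSpace ℝ (Fin q) →L[ℝ] ℝ) :=
      fun ζ => ((u, v), ζ ∘L ContinuousLinearMap.snd ℝ _ _)
    have h0 : ContDiff ℝ ∞ j := contDiff_const.prodMk (contDiff_id.clm_comp contDiff_const)
    have h1 : ContMDiff 𝓘(ℝ, EuclideanSpace ℝ (Fin q) →L[ℝ] ℝ) (cotModel n) ∞
        (liftPt n φ u v) := by
      intro ζ
      have h2 := (hφ.contMDiffOn_cotCoordSymm (j ζ) ⟨hu, mem_univ _⟩).contMDiffAt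
        ((φ.open_target.prod isOpen_univ).mem_nhds ⟨hu, mem_univ _⟩)
      exact h2.comp ζ h0.contMDiff.contMDiffAt
    have h2 : ContMDiff (cotModel n) (cotModel n) ∞ (geoFlow (M := M) g 1) :=
      (contMDiff_geoFlow g).comp (contMDiff_const.prodMk contMDiff_id)
    exact contMDiff_cot_proj.comp (h2.comp h1)
  have hex0 : ex 0 = φ.symm (u, v) := by
    have h1 := geoFlow_liftPt_smul g hφ hu 1 0 0
    rwa [zero_smul, zero_mul, geoFlow_zero] at h1
  let O := ex ⁻¹' φ.source
  have hO : IsOpen O := φ.open_source.preimage hex.continuous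
  have h0O : (0 : EuclideanSpace ℝ (Fin q) →L[ℝ] ℝ) ∈ O := by
    change ex 0 ∈ φ.source
    rw [hex0]
    exact φ.map_target hu
  have hf : ContDiffOn ℝ ∞ f O := fun ζ hζ =>
    (contMDiffAt_iff_contDiffAt.1 ((hφ.contMDiffAt_transverse hζ).comp ζ
      hex.contMDiffAt)).contDiffWithinAt
  have hf0 : f 0 = v := by
    change transverse φ (ex 0) = v
    rw [hex0, transverse, φ.right_inv hu]
  have hfd : HasFDerivAt f (fderiv ℝ f 0) 0 :=
    ((hf.contDiffAt (hO.mem_nhds h0O)).differentiableAt (by simp)).hasFDerivAt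
  -- By homogeneity the endpoint for sζ at time 1 is the endpoint for ζ at time s, so the derivative
  -- at 0 is the transverse component of the initial velocity, which is the vector dual to ζ.
  have hder : ∀ ζ, fderiv ℝ f 0 ζ =
      dTransverse n φ (φ.symm (u, v)) (raise g (liftPt n φ u v ζ)) := by
    intro ζ
    have h1 : HasDerivAt (fun s : ℝ => f (s • ζ)) (fderiv ℝ f 0 ζ) 0 := by
      simpa using hasDerivAt_line hfd ζ
    have h2 := hφ.hasDerivAt_cotCoord g (t := 0) (γ := fun t => geoFlow g t (liftPt n φ u v ζ))
      (by rw [geoFlow_zero]; exact φ.map_target hu)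
      (isMIntegralCurve_geoFlow g (liftPt n φ u v ζ) 0)
    let L : (EuclideanSpace ℝ (Fin p) × EuclideanSpace ℝ (Fin q)) ×
        (EuclideanSpace ℝ (Fin p) × EuclideanSpace ℝ (Fin q) →L[ℝ] ℝ) →L[ℝ]
        EuclideanSpace ℝ (Fin q) :=
      (ContinuousLinearMap.snd ℝ _ _) ∘L (ContinuousLinearMap.fst ℝ _ _)
    have h3 := L.hasFDerivAt.comp_hasDerivAt (0 : ℝ) h2
    have h4 : (L ∘ (cotCoord φ ∘ fun t => geoFlow g t (liftPt n φ u v ζ))) =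
        fun s : ℝ => f (s • ζ) := by
      funext s
      change (φ _).2 = (φ _).2
      rw [show ex (s • ζ) = _ from geoFlow_liftPt_smul g hφ hu 1 s ζ, mul_one]
    rw [h4] at h3
    have h5 := h1.unique h3
    simp only [geoFlow_zero] at h5
    rw [h5]
    have h6 := hφ.hamCoord_fst_eq_raise g (ξ := liftPt n φ u v ζ) (φ.map_target hu)
    rw [hφ.dTransverse_eq (φ.map_target hu)]
    exact congrArg Prod.snd h6
  -- If the dual vector has no transverse component, ζ annihilates it, and its pairing with ζ is
  -- twice the energy.
  have hinj : ∀ ζ, fderiv ℝ f 0 ζ = 0 → ζ = 0 := by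
    intro ζ hζ
    by_contra hne
    have h1 := energy_pos g (covec_liftPt_ne_zero hφ hu hne)
    have h2 : covec (liftPt n φ u v ζ) (raise g (liftPt n φ u v ζ)) = 0 :=
      (hφ.covec_liftPt hu ζ _).trans ((congrArg ζ ((hder ζ).symm.trans hζ)).trans (map_zero ζ))
    have h3 : energy g (liftPt n φ u v ζ) =
        covec (liftPt n φ u v ζ) (raise g (liftPt n φ u v ζ)) / 2 := rfl
    rw [h3, h2] at h1
    simp at h1
  let E : (EuclideanSpace ℝ (Fin q) →L[ℝ] ℝ) ≃L[ℝ] EuclideanSpace ℝ (Fin q) :=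
    (LinearMap.linearEquivOfInjective (fderiv ℝ f 0).toLinearMap
      ((injective_iff_map_eq_zero _).2 hinj) (by
        rw [← (LinearMap.toContinuousLinearMap (𝕜 := ℝ) (E := EuclideanSpace ℝ (Fin q))
          (F' := ℝ)).finrank_eq]
        exact Subspace.dual_finrank_eq)).toContinuousLinearEquiv
  obtain ⟨e, h0, heO, hef, he, he'⟩ := exists_smooth_localInverse hO h0O hf E hfd
  refine ⟨e, h0, ?_, fun ζ hζ => ⟨heO hζ, ?_⟩, he, he'⟩
  · rw [hef, hf0]
  · rw [hef]

omit hφ hu in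
variable {g} in
-- In exponential coordinates at x the slice of the stratum is, near 0, the linear subspace of
-- covectors with finite holonomy orbit.
lemma exists_isSubmanifoldAt_minimal_stratum (hg : F.IsBundleLike g) {φ : FolChart M p q}
    (hφ : φ ∈ F.atlas) {x : M} (hx : x ∈ φ.source) (hx0 : x ∈ F.stratum 0) :
    ∃ T : Set (EuclideanSpace ℝ (Fin q)),
      (∃ d, IsSubmanifoldAt 𝓘(ℝ, EuclideanSpace ℝ (Fin q)) T d (transverse φ x)) ∧
        ∀ y ∈ φ.source, y ∈ F.stratum 0 ↔ transverse φ y ∈ T := by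
  have hb := F.smoothBox φ hφ
  have hs := hb.isSmoothChart
  -- The stratum is a union of leaves, so membership can be tested at the centre of each plaque.
  let T : Set (EuclideanSpace ℝ (Fin q)) := {v | φ.symm (0, v) ∈ F.stratum 0}
  have hT : ∀ y ∈ φ.source, y ∈ F.stratum 0 ↔ transverse φ y ∈ T := by
    intro y hy
    have ht : ((0 : EuclideanSpace ℝ (Fin p)), transverse φ y) ∈ φ.target :=
      hb.mem_target.2 ⟨Metric.mem_ball_self one_pos, (hb.mem_target.1 (φ.map_source hy)).2⟩
    refine F.mem_stratum_iff_of_mem_leaf (x := φ.symm (0, transverse φ y))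
      (F.mem_leaf_of_samePlaque hφ ⟨φ.map_target ht, hy, ?_⟩)
    rw [transverse, φ.right_inv ht]
  refine ⟨T, ?_, hT⟩
  let u := (φ x).1
  let v := (φ x).2
  have hu : (u, v) ∈ φ.target := φ.map_source hx
  have hx0' : φ.symm (u, v) ∈ F.stratum 0 := by
    rw [show φ.symm (u, v) = x from φ.left_inv hx]
    exact hx0
  obtain ⟨e, h0, he0, hex, he, he'⟩ := exists_exponential_chart g hs hu
  obtain ⟨δ, hδ, hδe⟩ := Metric.nhds_basis_closedBall.mem_iff.1 (e.open_source.mem_nhds h0)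
  obtain ⟨r, hr, hrδ⟩ := exists_energy_lt g hs hu hδ
  let A := F.finiteOrbits hφ hu
  have hE0 : energy g (liftPt n φ u v 0) = 0 := by
    have h1 := energy_scale g 0 (liftPt n φ u v 0)
    rwa [scale_liftPt, smul_zero, zero_pow two_ne_zero, zero_mul] at h1
  -- Smallness is measured by the energy because it is constant on holonomy orbits: the whole orbit
  -- of ζ then stays in the δ-ball, where the exponential chart is injective, as `finite_orbit`
  -- requires.
  have key : ∀ ζ, energy g (liftPt n φ u v ζ) < r → (e ζ ∈ T ↔ ζ ∈ A) := by
    intro ζ hζ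
    obtain ⟨h1, h2⟩ := hex ζ (hδe (hrδ ζ hζ))
    rw [← h2, ← hT _ h1]
    constructor
    · intro h3
      refine Foliation.finite_orbit hφ hu hg h3 (isCompact_closedBall 0 δ) ?_ hφ
        (fun η hη => (hex η (hδe hη)).1) fun η hη η' hη' h => ?_
      · intro η hη
        refine hrδ η ?_
        rwa [← Foliation.LiftRel.energy_eq hg hη]
      · refine e.injOn (hδe hη) (hδe hη') ?_
        rw [← (hex η (hδe hη)).2, ← (hex η' (hδe hη')).2]
        exact h
    · intro h3
      exact Foliation.proj_geoFlow_mem_stratum hφ hu hg hx0' h3 1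
  have hev : v ∈ e.target := by
    rw [← he0]
    exact e.map_source h0
  have hsymm : e.symm v = 0 := by
    rw [← he0]
    exact e.left_inv h0
  refine exists_isSubmanifoldAt_congr (S' := {w | w ∈ e.target ∧ e.symm w ∈ A}) ?_ ?_
  · have hc : ContinuousAt (fun w => energy g (liftPt n φ u v (e.symm w))) v := by
      refine ((contMDiff_energy g).continuous.comp (continuous_liftPt hs hu)).continuousAt.comp
        (e.symm.continuousAt hev)
    have hlt : energy g (liftPt n φ u v (e.symm v)) < r := by
      rw [hsymm, hE0]
      exact hr
    filter_upwards [hc.eventually (gt_mem_nhds hlt), e.open_target.mem_nhds hev]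
      with w h1 h2
    have h3 := key _ h1
    rw [e.right_inv h2] at h3
    rw [h3]
    exact ⟨fun h => ⟨h2, h⟩, fun h => h.2⟩
  · have hchart : IsSmoothChart 𝓘(ℝ, EuclideanSpace ℝ (Fin q)) e.symm :=
      ⟨contMDiffOn_iff_contDiffOn.2 he', contMDiffOn_iff_contDiffOn.2 he⟩
    refine hchart.exists_isSubmanifoldAt (S' := (A : Set _)) hev
      (fun w hw => ⟨fun h => h.2, fun h => ⟨hw, h⟩⟩) ?_
    exact exists_isSubmanifoldAt_submodule A _

end Slices

theorem intersectsCleanly_Czero {n : ℕ} {M : Type*} [TopologicalSpace M] [T2Space M]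
    [CompactSpace M] [ChartedSpace (EuclideanSpace ℝ (Fin n)) M] [IsManifold (𝓡 n) ∞ M]
    {p q : ℕ} {F : Foliation n M p q}
    {g : ContMDiffRiemannianMetric (𝓡 n) ∞ (EuclideanSpace ℝ (Fin n))
      (fun x : M => TangentSpace (𝓡 n) x)} (hg : F.IsBundleLike g) (σ : ℝ) :
    IntersectsCleanly F.Czero (F.sheets 0 F.atlas) (waveRelation g σ) :=
  intersectsCleanly_of_slices g (k := 0) F.smoothBox
    (fun _ hφ _ _ h => subset_closure (F.mem_leaf_of_samePlaque hφ h))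
    fun _ hφ _ hx hx0 => exists_isSubmanifoldAt_minimal_stratum hg hφ hx hx0

end BasicWave

end

theorem mainTheorem7 {n p q : ℕ} (hn : n = p + q)
    {M : Type*} [TopologicalSpace M] [T2Space M] [CompactSpace M]
    [ChartedSpace (EuclideanSpace ℝ (Fin n)) M] [IsManifold (𝓡 n) ∞ M]
    (g : ContMDiffRiemannianMetric (𝓡 n) ∞ (EuclideanSpace ℝ (Fin n))
      (fun x : M => TangentSpace (𝓡 n) x))
    (F : BasicWave.Foliation n M p q) (hg : F.IsBundleLike g)
    (σ : ℝ) (hσ : σ = -1 ∨ σ = 1) :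
    (∀ kmax : ℕ, IsGreatest {k | (F.stratum k).Nonempty} kmax →
      BasicWave.IntersectsCleanly (F.Cmax kmax) (F.sheets kmax (F.closureAtlas kmax))
        (BasicWave.waveRelation g σ)) ∧
    (IsLeast {k | (F.stratum k).Nonempty} 0 →
      BasicWave.IntersectsCleanly F.Czero (F.sheets 0 F.atlas) (BasicWave.waveRelation g σ)) :=
  ⟨fun kmax _ => BasicWave.intersectsCleanly_Cmax g F σ kmax,
    fun _ => BasicWave.intersectsCleanly_Czero hg σ⟩
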